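/- **Setting.** Let $q\ge p\ge 1$ be integers, $\alpha_0>0$, $\alpha_1,\dots,\alpha_p,\beta_1,\dots,\beta_q\in\mathbb R$ with $\alpha_p\neq0$, $\beta_q\ne 0$, and $\alpha_{p+1}=\dots=\alpha_q=0$. Let $B$ be the $q\times q$ companion matrix with ones on the superdiagonal, last row $(-\beta_q,\dots,-\beta_1)$ and zeros elsewhere ($B=-\beta_1$ if $q=1$), $\mathbf a=(\alpha_1,\dots,\alpha_q)'$ and $\mathbf e=(0,\dots,0,1)'$. Let $L=(L_t)_{t\ge0}$ be a real Lévy process whose Lévy measure $\nu_L$ (the measure on $\mathbb R\setminus\{0\}$ for which $\nu_L(A)$ is the expected number of jumps of $L$ in $(0,1]$ with size in $A$) is nonzero and finite. Write $\Delta L_s=L_s-L_{s-}$, and let $[L,L]^{(d)}_t=\sum_{0<s\le t}(\Delta L_s)^2$. Let $\mathbf Y$ be the COGARCH$(p,q)$ state process, i.e. the càdlàg solution of $$d\mathbf Y_t=B\mathbf Y_{t-}\,dt+\mathbf e(\alpha_0+\mathbf a'\mathbf Y_{t-})\,d[L,L]^{(d)}_t,\qquad t>0,$$ with $\mathbf Y_0$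 independent of $L$. Let $N(t)$ be the number of jumps of $L$ in $(0,t]$, $0=\Gamma_0<\Gamma_1<\Gamma_2<\cdots$ with $\Gamma_n$ ($n\ge 1$) the time of the $n$th jump, $T_i=\Gamma_i-\Gamma_{i-1}$, $Z_i=(\Delta L_{\Gamma_i})^2$ for $i\ge1$ and $$C_i=(I+Z_i\mathbf e\mathbf a')e^{BT_i},\qquad \mathbf D_i=\alpha_0Z_i\mathbf e .$$ **(a)** Almost surely $N(t)<\infty$ and $[L,L]^{(d)}_t=\sum_{i=1}^{N(t)}Z_i$ for all $t\ge 0$, and $$\mathbf Y_{\Gamma_{n+1}}=C_{n+1}\mathbf Y_{\Gamma_n}+\mathbf D_{n+1}\quad\text{for all } n\in\mathbb N_0 .$$ Moreover, almost surely, for all $t>0$, $$\mathbf Y_t=e^{B(t-\Gamma_{N(t)})}\Big[\mathbf 1_{\{N(t)\ne0\}}\mathbf D_{N(t)}+\sum_{i=0}^{N(t)-2}C_{N(t)}\cdots C_{N(t)-i}\mathbf D_{N(t)-i-1}+C_{N(t)}\cdots C_1\mathbf Y_0\Big],$$ and for every $t>0$, $$\mathbf Y_t\stackrel d=e^{B(t-\Gamma_{N(t)})}\Big[\mathbf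 1_{\{N(t)\ne0\}}\mathbf D_1+\sum_{i=1}^{N(t)-1}C_1\cdots C_i\mathbf D_{i+1}+C_1\cdots C_{N(t)}\mathbf Y_0\Big].$$ **(b)** Assume in addition that the eigenvalues of $B$ are pairwise distinct and that, for some $r\in[1,\infty]$ and some invertible complex matrix $S$ with $S^{-1}BS$ diagonal, $$\int_{\mathbb R}\log\big(1+\|S^{-1}\mathbf e\mathbf a'S\|_r\,y^2\big)\,d\nu_L(y)<-\lambda(B),$$ where $\lambda(B)$ is the largest real part of the eigenvalues of $B$ and $\|\cdot\|_r$ is the matrix norm induced by the $L^r$-norm on $\mathbb C^q$. Then $\sum_{i=0}^\infty C_1\cdots C_i\mathbf D_{i+1}$ converges almost surely absolutely to a random vector $\hat{\mathbf Y}$, whose law is the stationary distribution of the sequence $(\mathbf Y_{\Gamma_n})_{n\in\mathbb N_0}$, that is, this sequence is strictly stationary if and only if $\mathbf Y_0\stackrel d=\hat{\mathbf Y}$. As $t\to\infty$, $\mathbf Y_t$ converges in distribution to a (finite) random vector $\mathbf Y_\infty$, and $$\mathbf Y_\infty\stackrel d=e^{BT}\hat{\mathbf Y},$$ where $T\stackrel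 d=T_1$ is independent of $\hat{\mathbf Y}$ (for instance, independent of $(T_i,Z_i)_{i\ge1}$). Finally, let $(T_0,Z_0)\stackrel d=(T_1,Z_1)$, $Q=e^{BT_0}(I+Z_0\mathbf e\mathbf a')$ and $\mathbf R=\alpha_0Z_0e^{BT_0}\mathbf e$. The law of $\mathbf Y_\infty$ is the unique solution of the distributional fixed point equation $\mathbf X\stackrel d=Q\mathbf X+\mathbf R$ with $\mathbf X$ independent of $(Q,\mathbf R)$: for every random vector $\mathbf X$ independent of $(Q,\mathbf R)$, one has $Q\mathbf X+\mathbf R\stackrel d=\mathbf X$ if and only if $\mathbf X\stackrel d=\mathbf Y_\infty$. -/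

import Mathlib

open MeasureTheory ProbabilityTheory Filter Topology
open scoped NNReal ENNReal Matrix

noncomputable section

namespace Cogarch

/-! ### Parameters and the companion matrix -/

/-- Admissible COGARCH(`p`, `q`) parameters. The sequences are indexed as in the usual notation:
`α 0 = α₀`, `α 1, …, α q` are the entries of the vector `a`, and `β 1, …, β q` are the
coefficients of the companion matrix `B`. Other values of `α`, `β` are never used. -/
structure IsParam (p q : ℕ) (α β : ℕ → ℝ) : Prop where
  one_le_p : 1 ≤ p
  p_le_q : p ≤ q
  alpha_zero_pos : 0 < α 0
  alpha_p_ne : α p ≠ 0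
  alpha_eq_zero : ∀ j, p < j → j ≤ q → α j = 0
  beta_q_ne : β q ≠ 0

/-- The companion matrix: ones above the diagonal, last row `(-β_q, …, -β_1)`. -/
def matB (q : ℕ) (β : ℕ → ℝ) : Matrix (Fin q) (Fin q) ℝ := fun i j =>
  if i.val + 1 = q then -β (q - j.val) else if j.val = i.val + 1 then 1 else 0

/-- The vector `a = (α_1, …, α_q)'`. -/
def vecA (q : ℕ) (α : ℕ → ℝ) : Fin q → ℝ := fun i => α (i.val + 1)

/-- The vector `e = (0, …, 0, 1)'`. -/
def vecE (q : ℕ) : Fin q → ℝ := fun i => if i.val + 1 = q then 1 else 0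

/-- The rank-one matrix `e a'`. -/
def matEA (q : ℕ) (α : ℕ → ℝ) : Matrix (Fin q) (Fin q) ℝ := Matrix.vecMulVec (vecE q) (vecA q α)

/-- A real matrix viewed as a complex matrix. -/
def toC {q : ℕ} (M : Matrix (Fin q) (Fin q) ℝ) : Matrix (Fin q) (Fin q) ℂ :=
  M.map (algebraMap ℝ ℂ)

/-- `λ(B)`, the largest real part of the (complex) eigenvalues. -/
def maxRe {q : ℕ} (M : Matrix (Fin q) (Fin q) ℝ) : ℝ :=
  sSup (Complex.re '' spectrum ℂ (toC M))

/-- The natural matrix norm on `ℂ^{q × q}` associated with the vector `L^r`-norm on `ℂ^q`. -/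
def natNorm {q : ℕ} (r : ℝ≥0∞) [Fact (1 ≤ r)] (M : Matrix (Fin q) (Fin q) ℂ) : ℝ :=
  ‖LinearMap.toContinuousLinearMap (Matrix.toLpLin r r M)‖

/-- The stationarity conditions: `B` has pairwise distinct eigenvalues, and for some
`r ∈ [1, ∞]` and some `S` diagonalising `B`,
`∫ log (1 + ‖S⁻¹ e a' S‖_r y²) dν(y) < -λ(B)` (in particular the integral is finite). -/
def StationarityCondition (q : ℕ) (α β : ℕ → ℝ) (ν : Measure ℝ) : Prop :=
  (toC (matB q β)).charpoly.roots.Nodup ∧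
  ∃ (r : ℝ≥0∞) (_ : Fact (1 ≤ r)) (S : Matrix (Fin q) (Fin q) ℂ),
    IsUnit S.det ∧ (S⁻¹ * toC (matB q β) * S).IsDiag ∧
    Integrable (fun y : ℝ => Real.log (1 + natNorm r (S⁻¹ * toC (matEA q α) * S) * y ^ 2)) ν ∧
    ∫ y, Real.log (1 + natNorm r (S⁻¹ * toC (matEA q α) * S) * y ^ 2) ∂ν < -maxRe (matB q β)

/-! ### Cadlag paths, Lévy processes, Lévy measure -/

/-- Right-continuous with left limits. -/
def IsCadlag {E : Type*} [TopologicalSpace E] (f : ℝ≥0 → E) : Prop :=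
  ∀ t, ContinuousWithinAt f (Set.Ioi t) t ∧ ∃ l, Tendsto f (𝓝[<] t) (𝓝 l)

/-- The jump `Δf_t = f_t - f_{t-}`; it is `0` at `t = 0`. -/
def jump (f : ℝ≥0 → ℝ) (t : ℝ≥0) : ℝ := f t - Function.leftLim f t

/-- Real-valued Lévy processes on `[0, ∞)`. -/
structure IsLevyProcess {Ω : Type*} [MeasurableSpace Ω] (P : Measure Ω) (L : ℝ≥0 → Ω → ℝ) :
    Prop where
  measurable : ∀ t, Measurable (L t)
  zero : ∀ᵐ ω ∂P, L 0 ω = 0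
  cadlag : ∀ᵐ ω ∂P, IsCadlag (fun t => L t ω)
  indep : HasIndepIncrements L P
  stationary : ∀ s h : ℝ≥0, IdentDistrib (fun ω => L (s + h) ω - L s ω) (L h) P P

/-- `ν` is the Lévy measure of `L`: it does not charge `0`, and for Borel `A` not containing `0`,
`ν A` is the expected number of jumps of `L` with size in `A` during the time interval `(0, 1]`. -/
def IsLevyMeasure {Ω : Type*} [MeasurableSpace Ω] (P : Measure Ω) (L : ℝ≥0 → Ω → ℝ)
    (ν : Measure ℝ) : Prop :=
  ν {0} = 0 ∧ ∀ A : Set ℝ, MeasurableSet A → (0 : ℝ) ∉ A →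
    ν A = ∫⁻ ω, (({s ∈ Set.Ioc (0 : ℝ≥0) 1 | jump (fun t => L t ω) s ∈ A}.encard : ℕ∞) : ℝ≥0∞) ∂P

/-! ### The state process -/

/-- `∫_0^t g_{s-} d[f, f]^{(d)}_s = ∑_{0 < s ≤ t} g_{s-} (Δf_s)²`, the integral of the left-continuous
version of `g` against the discrete part of the quadratic variation of the path `f`. -/
def jumpIntegral (g f : ℝ≥0 → ℝ) (t : ℝ≥0) : ℝ :=
  ∑' s : Set.Ioc (0 : ℝ≥0) t, Function.leftLim g s * jump f s ^ 2

/-- `Y` is a state process of the COGARCH process with parameters `α`, `β` and driving Lévy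
process `L`: a cadlag process whose initial value is independent of `L` and which solves
`dY_t = B Y_{t-} dt + e (α₀ + a' Y_{t-}) d[L, L]^{(d)}_t`. -/
structure IsStateProcess {Ω : Type*} [MeasurableSpace Ω] (P : Measure Ω) {q : ℕ} (α β : ℕ → ℝ)
    (L : ℝ≥0 → Ω → ℝ) (Y : ℝ≥0 → Ω → Fin q → ℝ) : Prop where
  measurable : ∀ t, Measurable (Y t)
  indep : IndepFun (Y 0) (fun ω t => L t ω) P
  cadlag : ∀ᵐ ω ∂P, IsCadlag (fun t => Y t ω)
  sde : ∀ᵐ ω ∂P, ∀ t : ℝ≥0,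
    Y t ω = Y 0 ω
      + (∫ s in (0 : ℝ)..(t : ℝ), matB q β *ᵥ Function.leftLim (fun u => Y u ω) s.toNNReal)
      + jumpIntegral (fun u => α 0 + vecA q α ⬝ᵥ Y u ω) (fun u => L u ω) t • vecE q

/-! ### Jump times and the random recurrence coefficients -/

section Path

variable (f : ℝ≥0 → ℝ)

/-- The set of jump times in `(0, t]`. -/
def jumpSet (t : ℝ≥0) : Set ℝ≥0 := {s | 0 < s ∧ s ≤ t ∧ jump f s ≠ 0}

/-- `N(t)`, the number of jumps in `(0, t]`. -/
def jumpCount (t : ℝ≥0) : ℕ := (jumpSet f t).ncard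

/-- `Γ_0 = 0`, and `Γ_{n+1}` is the time of the first jump after `Γ_n`. -/
def jumpTime : ℕ → ℝ≥0
  | 0 => 0
  | n + 1 => sInf {s | jumpTime n < s ∧ jump f s ≠ 0}

/-- `T_i = Γ_i - Γ_{i-1}`, for `i ≥ 1`. -/
def waitTime (i : ℕ) : ℝ := (jumpTime f i : ℝ) - (jumpTime f (i - 1) : ℝ)

/-- `Z_i`, the square of the size of the `i`th jump, for `i ≥ 1`. -/
def sqJump (i : ℕ) : ℝ := jump f (jumpTime f i) ^ 2

end Path

section Coefficients

variable (q : ℕ) (α β : ℕ → ℝ)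

/-- `(I + z e a') e^{B t}`. -/
def coefC (t z : ℝ) : Matrix (Fin q) (Fin q) ℝ :=
  (1 + z • matEA q α) * NormedSpace.exp (t • matB q β)

/-- `α₀ z e`. -/
def coefD (z : ℝ) : Fin q → ℝ := (α 0 * z) • vecE q

/-- `e^{B t} (I + z e a')`. -/
def coefQ (t z : ℝ) : Matrix (Fin q) (Fin q) ℝ :=
  NormedSpace.exp (t • matB q β) * (1 + z • matEA q α)

/-- `α₀ z e^{B t} e`. -/
def coefR (t z : ℝ) : Fin q → ℝ := (α 0 * z) • (NormedSpace.exp (t • matB q β) *ᵥ vecE q)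

/-- `C_i = (I + Z_i e a') e^{B T_i}`, for `i ≥ 1`. -/
def seqC (f : ℝ≥0 → ℝ) (i : ℕ) : Matrix (Fin q) (Fin q) ℝ :=
  coefC q α β (waitTime f i) (sqJump f i)

/-- `D_i = α₀ Z_i e`, for `i ≥ 1`. -/
def seqD (f : ℝ≥0 → ℝ) (i : ℕ) : Fin q → ℝ := coefD q α (sqJump f i)

end Coefficients

/-- The product `C_1 C_2 ⋯ C_k` (the identity if `k = 0`). -/
def ascProd {q : ℕ} (C : ℕ → Matrix (Fin q) (Fin q) ℝ) (k : ℕ) : Matrix (Fin q) (Fin q) ℝ :=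
  ((List.range k).map fun j => C (j + 1)).prod

/-- The product `C_n C_{n-1} ⋯ C_{n-k+1}` of `k` factors (the identity if `k = 0`). -/
def descProd {q : ℕ} (C : ℕ → Matrix (Fin q) (Fin q) ℝ) (n k : ℕ) : Matrix (Fin q) (Fin q) ℝ :=
  ((List.range k).map fun j => C (n - j)).prod

/-- `1_{n ≠ 0} D_n + ∑_{i=0}^{n-2} C_n ⋯ C_{n-i} D_{n-i-1} + C_n ⋯ C_1 y`. -/
def forwardSum {q : ℕ} (C : ℕ → Matrix (Fin q) (Fin q) ℝ) (D : ℕ → Fin q → ℝ) (n : ℕ)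
    (y : Fin q → ℝ) : Fin q → ℝ :=
  (if n ≠ 0 then D n else 0)
    + ∑ i ∈ Finset.range (n - 1), descProd C n (i + 1) *ᵥ D (n - i - 1)
    + descProd C n n *ᵥ y

/-- `1_{n ≠ 0} D_1 + ∑_{i=1}^{n-1} C_1 ⋯ C_i D_{i+1} + C_1 ⋯ C_n y`. -/
def backwardSum {q : ℕ} (C : ℕ → Matrix (Fin q) (Fin q) ℝ) (D : ℕ → Fin q → ℝ) (n : ℕ)
    (y : Fin q → ℝ) : Fin q → ℝ :=
  (if n ≠ 0 then D 1 else 0)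
    + ∑ i ∈ Finset.Icc 1 (n - 1), ascProd C i *ᵥ D (i + 1)
    + ascProd C n *ᵥ y

/-- Strict stationarity of a random sequence: all shifts have the same law. -/
def IsStrictlyStationary {Ω E : Type*} [MeasurableSpace Ω] [MeasurableSpace E] (P : Measure Ω)
    (X : ℕ → Ω → E) : Prop :=
  ∀ k : ℕ, IdentDistrib (fun ω n => X (n + k) ω) (fun ω n => X n ω) P P

end Cogarch

end

noncomputable section

namespace Cogarch

/-! ### Cadlag paths and their jumps -/

/-! Since the Lévy measure is nonzero and finite, almost every path of `L` has finitely many jumps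
on bounded intervals and infinitely many in total (`IsLevyLaw.ae_regular`). Whatever continuous part
`L` has plays no role. Between two jumps the state solves `y' = B y`; a jump with square `z` sends
`y` to `(I + z e a') y + α₀ z e`. This is the recursion (`SolvesStateEq.recursion`), and iterating
it up to the last jump before `t` gives the pathwise formula.

The pairs (waiting time, jump size) are i.i.d. (`IsLevyLaw.map_jumpSeq`), and within a pair the two
entries are independent (`IsLevyLaw.indepFun_arrival_mark`). Both facts are derived on the space of
cadlag paths from one property: the path stopped at a fixed time `s` is independent of the path
restarted at `s`, and the restarted path has the original law. The restart at the random first jump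
time is a limit of restarts at grid times. Reversing the first `n` pairs changes neither their law
nor the times `Γ_n`, `Γ_{n+1}`, hence neither the event `N(t) = n` nor the time since the last jump;
it turns forward iterates into backward ones (`measure_fwdIter_eq`). This is the identity in law.

For part (b) put `ρ(M) = ‖S⁻¹ M S‖_r`. Then `ρ(C_i) ≤ exp(log(1 + c Z_i) + λ T_i)`. The Lévy measure
is the jump rate `r` times the law of a jump (`IsLevyMeasure.eq_smul`), and `r E T ≥ 1`, so the
hypothesis makes the expected exponent negative. The exact law of `T` is never needed. By the strong
law of large numbers `C_1 ⋯ C_n` decays exponentially while `D_n` grows subexponentially, so the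
backward series converges absolutely and its sum forgets the starting point
(`IsContractive.exists_isPerpetuity`). A law fixed by one step of the recursion is the law of every
backward iterate, hence that of the limit: the stationary law exists and is unique.

For the limit of `Y_t`, the time since the last jump before `t` is distributed as `min(T, t)`. It is
asymptotically independent of the backward iterate, because that iterate hardly changes after a late
fixed time `u` whereas the elapsed time depends only on the path after `u` as soon as a jump has
occurred there (`IsLevyLaw.tendsto_integral_backState`). The limit law is therefore that of `e^{BT}
Yhat`. Finally, a step of the recursion is "flow, then jump" and `X ↦ Q X + R` is "jump, then flow";
the fixed laws of the two compositions correspond under the flow (`IsPerpetuity.reverseLaw_eq_iff`).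
-/

theorem IsCadlag.tendsto_leftLim {E : Type*} [TopologicalSpace E] {f : ℝ≥0 → E} (hf : IsCadlag f)
    (t : ℝ≥0) : Tendsto f (𝓝[<] t) (𝓝 (Function.leftLim f t)) :=
  tendsto_leftLim_of_tendsto (hf t).2

theorem IsCadlag.continuousWithinAt_Ici {E : Type*} [TopologicalSpace E] {f : ℝ≥0 → E}
    (hf : IsCadlag f) (t : ℝ≥0) : ContinuousWithinAt f (Set.Ici t) t :=
  continuousWithinAt_Ioi_iff_Ici.1 (hf t).1

theorem nhdsLT_neBot_of_pos {t : ℝ≥0} (ht : 0 < t) : (𝓝[<] t).NeBot :=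
  nhdsLT_neBot_of_exists_lt ⟨0, ht⟩

theorem jump_zero (f : ℝ≥0 → ℝ) : jump f 0 = 0 := by
  rw [jump, leftLim_eq_of_isBot (fun _ => zero_le), sub_self]

theorem pos_of_jump_ne_zero {f : ℝ≥0 → ℝ} {t : ℝ≥0} (h : jump f t ≠ 0) : 0 < t := by
  rcases eq_or_ne t 0 with rfl | h0
  · exact absurd (jump_zero f) h
  · exact pos_iff_ne_zero.2 h0

/-- The number of jumps in `(0, t]`, possibly infinite. -/
def jumpNum (f : ℝ≥0 → ℝ) (t : ℝ≥0) : ℕ∞ := (jumpSet f t).encard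

/-- Finitely many jumps on bounded intervals. -/
def FiniteActivity (f : ℝ≥0 → ℝ) : Prop := ∀ t, (jumpSet f t).Finite

theorem jumpSet_mono (f : ℝ≥0 → ℝ) : Monotone (jumpSet f) := fun _ _ h _ hs =>
  ⟨hs.1, hs.2.1.trans h, hs.2.2⟩

theorem jumpNum_mono (f : ℝ≥0 → ℝ) : Monotone (jumpNum f) := fun _ _ h =>
  Set.encard_le_encard (jumpSet_mono f h)

theorem jumpSet_zero (f : ℝ≥0 → ℝ) : jumpSet f 0 = ∅ := by
  ext s
  simp only [jumpSet, Set.mem_ofPred_eq, Set.mem_empty_iff_false, iff_false, not_and]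
  intro h1 h2
  exact absurd h1 (not_lt.2 h2)

theorem jumpNum_zero (f : ℝ≥0 → ℝ) : jumpNum f 0 = 0 := by
  rw [jumpNum, jumpSet_zero, Set.encard_empty]

theorem FiniteActivity.jumpNum_eq {f : ℝ≥0 → ℝ} (hf : FiniteActivity f) (t : ℝ≥0) :
    jumpNum f t = jumpCount f t := by
  rw [jumpNum, jumpCount, (hf t).cast_ncard_eq]

theorem finiteActivity_iff {f : ℝ≥0 → ℝ} : FiniteActivity f ↔ ∀ n : ℕ, jumpNum f n < ⊤ := by
  constructor
  · intro h n
    exact (h n).encard_lt_top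
  · intro h t
    obtain ⟨n, hn⟩ := exists_nat_ge t
    exact (Set.encard_lt_top_iff.1 (h n)).subset (jumpSet_mono f hn)

/-- If `m` is the first jump after `s`, then there is exactly one more jump up to time `m`. -/
theorem jumpNum_eq_add_one {f : ℝ≥0 → ℝ} {s m : ℝ≥0} (hsm : s < m) (hm : jump f m ≠ 0)
    (hfirst : ∀ u, s < u → jump f u ≠ 0 → m ≤ u) : jumpNum f m = jumpNum f s + 1 := by
  have : jumpSet f m = insert m (jumpSet f s) := by
    ext u
    simp only [jumpSet, Set.mem_ofPred_eq, Set.mem_insert_iff]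
    constructor
    · rintro ⟨h0, h1, h2⟩
      by_cases hu : s < u
      · exact Or.inl (le_antisymm h1 (hfirst u hu h2))
      · exact Or.inr ⟨h0, not_lt.1 hu, h2⟩
    · rintro (rfl | ⟨h0, h1, h2⟩)
      · exact ⟨pos_of_jump_ne_zero hm, le_rfl, hm⟩
      · exact ⟨h0, h1.trans hsm.le, h2⟩
  rw [jumpNum, this, Set.encard_insert_of_notMem, jumpNum]
  exact fun h => absurd h.2.1 (not_le.2 hsm)

/-- Finiteness provides a first jump after `s`: the jumps in `(s, t]` form a finite nonempty set,
and its minimum also precedes every jump after `t`. -/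
theorem FiniteActivity.exists_first {f : ℝ≥0 → ℝ} (hf : FiniteActivity f) {s t : ℝ≥0}
    (h : jumpNum f s < jumpNum f t) :
    ∃ m, s < m ∧ jump f m ≠ 0 ∧ m ≤ t ∧ ∀ u, s < u → jump f u ≠ 0 → m ≤ u := by
  have hne : (jumpSet f t \ jumpSet f s).Nonempty := by
    by_contra hcon
    rw [Set.not_nonempty_iff_eq_empty, Set.sdiff_eq_empty] at hcon
    exact absurd (Set.encard_le_encard hcon) (not_le.2 h)
  have hfin : (jumpSet f t \ jumpSet f s).Finite := (hf t).sdiff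
  obtain ⟨m, hm, hmin⟩ := Set.exists_min_image _ id hfin hne
  have hsm : s < m := by
    by_contra hcon
    exact hm.2 ⟨hm.1.1, not_lt.1 hcon, hm.1.2.2⟩
  refine ⟨m, hsm, hm.1.2.2, hm.1.2.1, fun u hu hju => ?_⟩
  rcases le_total u t with hut | hut
  · exact hmin u ⟨⟨pos_of_jump_ne_zero hju, hut, hju⟩, fun h' => absurd h'.2.1 (not_le.2 hu)⟩
  · exact hm.1.2.1.trans hut

theorem jumpTime_succ_eq {f : ℝ≥0 → ℝ} {n : ℕ} {m : ℝ≥0} (hm : jumpTime f n < m)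
    (hj : jump f m ≠ 0) (hfirst : ∀ u, jumpTime f n < u → jump f u ≠ 0 → m ≤ u) :
    jumpTime f (n + 1) = m := by
  have : IsLeast {s | jumpTime f n < s ∧ jump f s ≠ 0} m :=
    ⟨⟨hm, hj⟩, fun u hu => hfirst u hu.1 hu.2⟩
  exact this.csInf_eq

/-- The three facts are proved together because finding the next jump requires the exact count at
the current one. Requiring that `n` jumps occur by some time keeps the recursive infimum away from
the empty set. -/
theorem FiniteActivity.jumpTime_spec {f : ℝ≥0 → ℝ} (hf : FiniteActivity f) (n : ℕ) :
    ∀ t, (n : ℕ∞) ≤ jumpNum f t → jumpNum f (jumpTime f n) = n ∧ jumpTime f n ≤ t ∧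
      (n ≠ 0 → jump f (jumpTime f n) ≠ 0) := by
  induction n with
  | zero =>
    intro t _
    simp [jumpTime, jumpNum_zero]
  | succ n ih =>
    intro t ht
    have hn : (n : ℕ∞) < jumpNum f t :=
      lt_of_lt_of_le (by exact_mod_cast Nat.lt_succ_self n) ht
    obtain ⟨h1, -, -⟩ := ih t hn.le
    obtain ⟨m, hsm, hj, hmt, hfirst⟩ := hf.exists_first (h1 ▸ hn : jumpNum f (jumpTime f n) < _)
    rw [jumpTime_succ_eq hsm hj hfirst]
    refine ⟨?_, hmt, fun _ => hj⟩
    rw [jumpNum_eq_add_one hsm hj hfirst, h1]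
    push_cast
    rfl

theorem FiniteActivity.jumpTime_le_iff {f : ℝ≥0 → ℝ} (hf : FiniteActivity f) {n : ℕ}
    (hn : ∃ t, (n : ℕ∞) ≤ jumpNum f t) (t : ℝ≥0) :
    jumpTime f n ≤ t ↔ (n : ℕ∞) ≤ jumpNum f t := by
  constructor
  · intro h
    obtain ⟨t', ht'⟩ := hn
    rw [← (hf.jumpTime_spec n t' ht').1]
    exact jumpNum_mono f h
  · exact fun h => (hf.jumpTime_spec n t h).2.1

theorem FiniteActivity.jumpTime_lt_succ {f : ℝ≥0 → ℝ} (hf : FiniteActivity f) {n : ℕ}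
    (hn : ∃ t, ((n + 1 : ℕ) : ℕ∞) ≤ jumpNum f t) : jumpTime f n < jumpTime f (n + 1) := by
  have hn' : ∃ t, (n : ℕ∞) ≤ jumpNum f t := by
    obtain ⟨t, ht⟩ := hn
    exact ⟨t, le_trans (by exact_mod_cast Nat.le_succ n) ht⟩
  rw [← not_le, hf.jumpTime_le_iff hn]
  obtain ⟨t, ht⟩ := hn'
  rw [(hf.jumpTime_spec n t ht).1, not_le]
  exact_mod_cast Nat.lt_succ_self n

/-- The first time at which `n` jumps have occurred. -/
def arrival (n : ℕ) (f : ℝ≥0 → ℝ) : ℝ≥0 := sInf {t | (n : ℕ∞) ≤ jumpNum f t}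

/-- The size of the `n`th jump. -/
def mark (n : ℕ) (f : ℝ≥0 → ℝ) : ℝ := jump f (arrival n f)

theorem arrival_zero (f : ℝ≥0 → ℝ) : arrival 0 f = 0 := by
  simp [arrival]

/-- The recursive `jumpTime` belongs to the statement; `arrival` is expressed through the counting
function, which makes its measurability accessible. -/
theorem FiniteActivity.jumpTime_eq_arrival {f : ℝ≥0 → ℝ} (hf : FiniteActivity f) {n : ℕ}
    (hn : ∃ t, (n : ℕ∞) ≤ jumpNum f t) : jumpTime f n = arrival n f := by
  have : {t | (n : ℕ∞) ≤ jumpNum f t} = Set.Ici (jumpTime f n) := by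
    ext t
    exact (hf.jumpTime_le_iff hn t).symm
  rw [arrival, this, csInf_Ici]

/-- Paths with infinitely many jumps, finitely many of them on each bounded interval. -/
structure IsRegular (f : ℝ≥0 → ℝ) : Prop where
  finite : FiniteActivity f
  unbounded : ∀ n : ℕ, ∃ t, (n : ℕ∞) ≤ jumpNum f t


theorem IsRegular.jumpTime_eq_arrival {f : ℝ≥0 → ℝ} (hf : IsRegular f) (n : ℕ) :
    jumpTime f n = arrival n f :=
  hf.finite.jumpTime_eq_arrival (hf.unbounded n)

theorem IsRegular.arrival_le_iff {f : ℝ≥0 → ℝ} (hf : IsRegular f) (n : ℕ) (t : ℝ≥0) :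
    arrival n f ≤ t ↔ n ≤ jumpCount f t := by
  rw [← hf.jumpTime_eq_arrival, hf.finite.jumpTime_le_iff (hf.unbounded n), hf.finite.jumpNum_eq]
  exact Nat.cast_le

theorem IsRegular.lt_arrival_iff {f : ℝ≥0 → ℝ} (hf : IsRegular f) (n : ℕ) (t : ℝ≥0) :
    t < arrival n f ↔ jumpCount f t < n := by
  rw [← not_le, hf.arrival_le_iff, not_le]

theorem IsRegular.jumpCount_eq_iff {f : ℝ≥0 → ℝ} (hf : IsRegular f) (n : ℕ) (t : ℝ≥0) :
    jumpCount f t = n ↔ arrival n f ≤ t ∧ t < arrival (n + 1) f := by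
  rw [hf.arrival_le_iff, hf.lt_arrival_iff]
  omega

theorem IsRegular.arrival_strictMono {f : ℝ≥0 → ℝ} (hf : IsRegular f) :
    StrictMono (fun n => arrival n f) := by
  refine strictMono_nat_of_lt_succ fun n => ?_
  rw [← hf.jumpTime_eq_arrival, ← hf.jumpTime_eq_arrival]
  exact hf.finite.jumpTime_lt_succ (hf.unbounded _)

theorem IsRegular.mark_ne_zero {f : ℝ≥0 → ℝ} (hf : IsRegular f) {n : ℕ} (hn : n ≠ 0) :
    mark n f ≠ 0 := by
  obtain ⟨t, ht⟩ := hf.unbounded n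
  rw [mark, ← hf.jumpTime_eq_arrival]
  exact (hf.finite.jumpTime_spec n t ht).2.2 hn

theorem IsRegular.tendsto_jumpCount {f : ℝ≥0 → ℝ} (hf : IsRegular f) :
    Tendsto (jumpCount f) atTop atTop := by
  refine tendsto_atTop.2 fun n => ?_
  filter_upwards [eventually_ge_atTop (arrival n f)] with t ht
  exact (hf.arrival_le_iff n t).1 ht

/-- If that arrival were strictly earlier than `s`, the jump at `s` would make the count at `s`
strictly larger than itself. -/
theorem FiniteActivity.arrival_eq_of_jump {f : ℝ≥0 → ℝ} (hf : FiniteActivity f) {s : ℝ≥0}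
    (hs : jump f s ≠ 0) : arrival (jumpCount f s) f = s := by
  have hle : ((jumpCount f s : ℕ) : ℕ∞) ≤ jumpNum f s := (hf.jumpNum_eq s).ge
  obtain ⟨h1, h2, -⟩ := hf.jumpTime_spec _ s hle
  rw [← hf.jumpTime_eq_arrival ⟨s, hle⟩]
  refine h2.antisymm (not_lt.1 fun hlt => ?_)
  have hss : jumpSet f (jumpTime f (jumpCount f s)) ⊂ jumpSet f s := by
    refine ⟨jumpSet_mono f hlt.le, fun hcon => ?_⟩
    exact absurd (hcon ⟨pos_of_jump_ne_zero hs, le_rfl, hs⟩).2.1 (not_le.2 hlt)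
  have := (hf _).encard_lt_encard hss
  rw [← jumpNum, ← jumpNum, h1, hf.jumpNum_eq] at this
  exact lt_irrefl _ this

theorem IsRegular.jumpSet_eq {f : ℝ≥0 → ℝ} (hf : IsRegular f) (t : ℝ≥0) :
    jumpSet f t = (fun n => arrival n f) '' Set.Icc 1 (jumpCount f t) := by
  ext s
  constructor
  · rintro ⟨h0, h1, h2⟩
    have he := hf.finite.arrival_eq_of_jump h2
    refine ⟨jumpCount f s, ⟨?_, ?_⟩, he⟩
    · rw [Nat.one_le_iff_ne_zero]
      intro h
      rw [h, arrival_zero] at he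
      exact h0.ne he
    · rw [← hf.arrival_le_iff, he]
      exact h1
  · rintro ⟨n, ⟨hn1, hn2⟩, rfl⟩
    have := hf.mark_ne_zero (Nat.one_le_iff_ne_zero.1 hn1)
    exact ⟨pos_of_jump_ne_zero this, (hf.arrival_le_iff n t).2 hn2, this⟩

/-- Converts the sums over uncountably many times in the statement into finite sums: the summand is
supported on the jump times. -/
theorem IsRegular.tsum_jumps {f : ℝ≥0 → ℝ} (hf : IsRegular f) {g : ℝ≥0 → ℝ}
    (hg : ∀ s, jump f s = 0 → g s = 0) (t : ℝ≥0) :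
    ∑' s : Set.Ioc (0 : ℝ≥0) t, g s = ∑ i ∈ Finset.Icc 1 (jumpCount f t), g (arrival i f) := by
  classical
  rw [tsum_subtype (Set.Ioc (0 : ℝ≥0) t) g]
  rw [tsum_eq_sum (s := (Finset.Icc 1 (jumpCount f t)).image (fun i => arrival i f)),
    Finset.sum_image (fun i _ j _ h => hf.arrival_strictMono.injective h)]
  · refine Finset.sum_congr rfl fun i hi => ?_
    rw [Set.indicator_of_mem]
    have : arrival i f ∈ jumpSet f t := by
      rw [hf.jumpSet_eq]
      exact ⟨i, by simpa using hi, rfl⟩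
    exact ⟨this.1, this.2.1⟩
  · intro s hs
    by_cases hst : s ∈ Set.Ioc (0 : ℝ≥0) t
    · rw [Set.indicator_of_mem hst]
      refine hg s (by_contra fun hj => hs ?_)
      have : s ∈ jumpSet f t := ⟨hst.1, hst.2, hj⟩
      rw [hf.jumpSet_eq] at this
      obtain ⟨i, hi, rfl⟩ := this
      exact Finset.mem_image.2 ⟨i, by simpa using hi, rfl⟩
    · exact Set.indicator_of_notMem hst _

/-! ### Restarting and stopping a path -/

/-- The space of real cadlag paths, with the σ-algebra generated by the coordinates. -/
abbrev CadlagPath : Type := {f : ℝ≥0 → ℝ // IsCadlag f}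

/-- The increments of `f` after time `s`. -/
def shiftPath (s : ℝ≥0) (f : ℝ≥0 → ℝ) : ℝ≥0 → ℝ := fun h => f (s + h) - f s

/-- The path `f` stopped at time `s`. -/
def stopPath (s : ℝ≥0) (f : ℝ≥0 → ℝ) : ℝ≥0 → ℝ := fun h => f (min h s)

theorem tendsto_add_nhdsLT (s h : ℝ≥0) : Tendsto (fun u => s + u) (𝓝[<] h) (𝓝[<] (s + h)) :=
  tendsto_nhdsWithin_iff.2 ⟨((continuous_const.add continuous_id).tendsto h).mono_left
    nhdsWithin_le_nhds, eventually_nhdsWithin_of_forall fun _ hu => (add_lt_add_iff_left s).2 hu⟩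

theorem tendsto_add_nhdsGT (s h : ℝ≥0) : Tendsto (fun u => s + u) (𝓝[>] h) (𝓝[>] (s + h)) :=
  tendsto_nhdsWithin_iff.2 ⟨((continuous_const.add continuous_id).tendsto h).mono_left
    nhdsWithin_le_nhds, eventually_nhdsWithin_of_forall fun _ hu => (add_lt_add_iff_left s).2 hu⟩

theorem IsCadlag.shiftPath {f : ℝ≥0 → ℝ} (hf : IsCadlag f) (s : ℝ≥0) :
    IsCadlag (shiftPath s f) := fun h => by
  refine ⟨?_, Function.leftLim f (s + h) - f s, ?_⟩
  · exact ((hf (s + h)).1.tendsto.comp (tendsto_add_nhdsGT s h)).sub tendsto_const_nhds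
  · exact ((hf.tendsto_leftLim (s + h)).comp (tendsto_add_nhdsLT s h)).sub tendsto_const_nhds

/-- `0 < h` matters: at `h = 0` the restarted path has no jump by convention, whereas `f` may jump
at `s`. -/
theorem IsCadlag.jump_shiftPath {f : ℝ≥0 → ℝ} (hf : IsCadlag f) (s : ℝ≥0) {h : ℝ≥0} (hh : 0 < h) :
    jump (Cogarch.shiftPath s f) h = jump f (s + h) := by
  have := nhdsLT_neBot_of_pos hh
  rw [jump, jump, leftLim_eq_of_tendsto (f := Cogarch.shiftPath s f)
    (((hf.tendsto_leftLim (s + h)).comp (tendsto_add_nhdsLT s h)).sub tendsto_const_nhds),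
    Cogarch.shiftPath]
  ring

theorem IsCadlag.jump_stopPath {f : ℝ≥0 → ℝ} (hf : IsCadlag f) (s h : ℝ≥0) :
    jump (stopPath s f) h = if h ≤ s then jump f h else 0 := by
  rcases eq_or_ne h 0 with rfl | h0
  · simp [jump_zero]
  have := nhdsLT_neBot_of_pos (pos_iff_ne_zero.2 h0)
  split_ifs with hs
  · rw [jump, jump, leftLim_eq_of_tendsto (f := stopPath s f) (y := Function.leftLim f h)]
    · simp [stopPath, hs]
    · refine (hf.tendsto_leftLim h).congr' ?_
      filter_upwards [self_mem_nhdsWithin] with u hu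
      rw [stopPath, min_eq_left ((le_of_lt hu).trans hs)]
  · have hs := not_le.1 hs
    rw [jump, leftLim_eq_of_tendsto (f := stopPath s f) (y := f s)]
    · simp [stopPath, hs.le]
    · refine tendsto_const_nhds.congr' ?_
      filter_upwards [mem_nhdsWithin_of_mem_nhds (Ioi_mem_nhds hs)] with u hu
      rw [stopPath, min_eq_right (le_of_lt hu)]

theorem IsCadlag.stopPath {f : ℝ≥0 → ℝ} (hf : IsCadlag f) (s : ℝ≥0) :
    IsCadlag (stopPath s f) := fun h => by
  rcases lt_or_ge h s with hs | hs
  · have he : Cogarch.stopPath s f =ᶠ[𝓝 h] f := by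
      filter_upwards [Iio_mem_nhds hs] with u hu
      rw [Cogarch.stopPath, min_eq_left (le_of_lt hu)]
    refine ⟨(hf h).1.congr_of_eventuallyEq (he.filter_mono nhdsWithin_le_nhds) he.eq_of_nhds,
      Function.leftLim f h, (hf.tendsto_leftLim h).congr' (he.symm.filter_mono nhdsWithin_le_nhds)⟩
  · constructor
    · refine tendsto_const_nhds.congr' ?_
      filter_upwards [self_mem_nhdsWithin] with u hu
      rw [Cogarch.stopPath, Cogarch.stopPath, min_eq_right hs, min_eq_right (hs.trans (le_of_lt hu))]
    · rcases hs.eq_or_lt with rfl | hs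
      · refine ⟨Function.leftLim f s, (hf.tendsto_leftLim s).congr' ?_⟩
        filter_upwards [self_mem_nhdsWithin] with u hu
        rw [Cogarch.stopPath, min_eq_left (le_of_lt hu)]
      · refine ⟨f s, tendsto_const_nhds.congr' ?_⟩
        filter_upwards [mem_nhdsWithin_of_mem_nhds (Ioi_mem_nhds hs)] with u hu
        rw [Cogarch.stopPath, min_eq_right (le_of_lt hu)]

theorem IsCadlag.jumpNum_add {f : ℝ≥0 → ℝ} (hf : IsCadlag f) (u h : ℝ≥0) :
    jumpNum f (u + h) = jumpNum f u + jumpNum (Cogarch.shiftPath u f) h := by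
  have hset : jumpSet f (u + h) =
      jumpSet f u ∪ (fun s => u + s) '' jumpSet (Cogarch.shiftPath u f) h := by
    ext s
    constructor
    · rintro ⟨h0, h1, h2⟩
      rcases le_or_gt s u with hsu | hsu
      · exact Or.inl ⟨h0, hsu, h2⟩
      · have hs : u + (s - u) = s := add_tsub_cancel_of_le hsu.le
        have hpos : 0 < s - u := tsub_pos_of_lt hsu
        refine Or.inr ⟨s - u, ⟨hpos, ?_, ?_⟩, hs⟩
        · rwa [tsub_le_iff_left]
        · rwa [hf.jump_shiftPath u hpos, hs]
    · rintro (⟨h0, h1, h2⟩ | ⟨s, ⟨h0, h1, h2⟩, rfl⟩)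
      · exact ⟨h0, h1.trans le_self_add, h2⟩
      · rw [hf.jump_shiftPath u h0] at h2
        exact ⟨pos_of_jump_ne_zero h2, (add_le_add_iff_left u).2 h1, h2⟩
  rw [jumpNum, hset, Set.encard_union_eq, jumpNum, jumpNum,
    Function.Injective.encard_image (add_right_injective u)]
  rw [Set.disjoint_left]
  rintro _ hs ⟨s, hs', rfl⟩
  exact absurd hs.2.1 (not_le.2 (lt_add_of_pos_right u hs'.1))

theorem IsCadlag.jumpSet_stopPath {f : ℝ≥0 → ℝ} (hf : IsCadlag f) (s t : ℝ≥0) :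
    jumpSet (Cogarch.stopPath s f) t = jumpSet f (min t s) := by
  ext u
  simp only [jumpSet, Set.mem_ofPred_eq, hf.jump_stopPath, le_min_iff]
  split_ifs with h <;> simp [h]

theorem IsCadlag.jumpNum_stopPath {f : ℝ≥0 → ℝ} (hf : IsCadlag f) (s t : ℝ≥0) :
    jumpNum (Cogarch.stopPath s f) t = jumpNum f (min t s) := by
  rw [jumpNum, hf.jumpSet_stopPath, jumpNum]

theorem IsRegular.shiftPath {f : ℝ≥0 → ℝ} (hc : IsCadlag f) (hf : IsRegular f) (u : ℝ≥0) :
    IsRegular (Cogarch.shiftPath u f) := by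
  have hadd := hc.jumpNum_add u
  constructor
  · intro t
    have h : jumpNum (Cogarch.shiftPath u f) t ≤ jumpNum f (u + t) := by
      rw [hadd]
      exact le_add_self
    exact Set.encard_lt_top_iff.1 (h.trans_lt (hf.finite (u + t)).encard_lt_top)
  · intro n
    obtain ⟨t, ht⟩ := hf.unbounded (jumpCount f u + n)
    refine ⟨t, ?_⟩
    have h2 := ht.trans (jumpNum_mono f (le_add_self : t ≤ u + t))
    rw [hadd, hf.finite.jumpNum_eq u] at h2
    push_cast at h2
    exact (ENat.add_le_add_iff_left (ENat.natCast_ne_top _)).1 h2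

theorem IsRegular.jumpCount_add {f : ℝ≥0 → ℝ} (hc : IsCadlag f) (hf : IsRegular f) (u h : ℝ≥0) :
    jumpCount f (u + h) = jumpCount f u + jumpCount (Cogarch.shiftPath u f) h := by
  have := hc.jumpNum_add u h
  rw [hf.finite.jumpNum_eq, hf.finite.jumpNum_eq, (hf.shiftPath hc u).finite.jumpNum_eq] at this
  exact_mod_cast this

/-- For `n = 0` the left side would be `u` itself instead of the last jump time before it. -/
theorem IsRegular.arrival_shiftPath {f : ℝ≥0 → ℝ} (hc : IsCadlag f) (hf : IsRegular f) (u : ℝ≥0)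
    {n : ℕ} (hn : n ≠ 0) :
    u + arrival n (Cogarch.shiftPath u f) = arrival (jumpCount f u + n) f := by
  have hlt : u < arrival (jumpCount f u + n) f := by
    rw [hf.lt_arrival_iff]
    omega
  apply le_antisymm
  · rw [← le_tsub_iff_left hlt.le, (hf.shiftPath hc u).arrival_le_iff]
    have := hf.jumpCount_add hc u (arrival (jumpCount f u + n) f - u)
    rw [add_tsub_cancel_of_le hlt.le] at this
    have h2 := (hf.arrival_le_iff (jumpCount f u + n) _).1 le_rfl
    omega
  · rw [hf.arrival_le_iff, hf.jumpCount_add hc]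
    have := ((hf.shiftPath hc u).arrival_le_iff n _).1 le_rfl
    omega

theorem IsRegular.mark_shiftPath {f : ℝ≥0 → ℝ} (hc : IsCadlag f) (hf : IsRegular f) (u : ℝ≥0)
    {n : ℕ} (hn : n ≠ 0) :
    mark n (Cogarch.shiftPath u f) = mark (jumpCount f u + n) f := by
  have hr := hf.shiftPath hc u
  have hpos : 0 < arrival n (Cogarch.shiftPath u f) := pos_of_jump_ne_zero (hr.mark_ne_zero hn)
  rw [mark, hc.jump_shiftPath u hpos, hf.arrival_shiftPath hc u hn, mark]

/-- Stopping at `s` does not affect the first `n` arrivals if they occur before `s`. -/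
theorem IsRegular.arrival_stopPath {f : ℝ≥0 → ℝ} (hc : IsCadlag f) (hf : IsRegular f) {s : ℝ≥0}
    {n : ℕ} (hn : n ≤ jumpCount f s) :
    arrival n (Cogarch.stopPath s f) = arrival n f := by
  have : {t | (n : ℕ∞) ≤ jumpNum (Cogarch.stopPath s f) t} = Set.Ici (arrival n f) := by
    ext t
    rw [Set.mem_ofPred_eq, hc.jumpNum_stopPath, hf.finite.jumpNum_eq, Set.mem_Ici, Nat.cast_le,
      ← hf.arrival_le_iff, le_min_iff, and_iff_left_iff_imp]
    exact fun _ => (hf.arrival_le_iff n s).2 hn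
  rw [arrival, this, csInf_Ici]

/-- The stopped path never makes `n` jumps, so the infimum runs over the empty set, which gives `0`
in `ℝ≥0`. -/
theorem IsRegular.arrival_stopPath_eq_zero {f : ℝ≥0 → ℝ} (hc : IsCadlag f) (hf : IsRegular f)
    {s : ℝ≥0} {n : ℕ} (hn : jumpCount f s < n) :
    arrival n (Cogarch.stopPath s f) = 0 := by
  have : {t | (n : ℕ∞) ≤ jumpNum (Cogarch.stopPath s f) t} = ∅ := by
    ext t
    rw [Set.mem_ofPred_eq, hc.jumpNum_stopPath, hf.finite.jumpNum_eq, Nat.cast_le]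
    simp only [Set.mem_empty_iff_false, iff_false, not_le]
    refine lt_of_le_of_lt ?_ hn
    rw [← hf.arrival_le_iff]
    exact ((hf.arrival_le_iff _ (min t s)).2 le_rfl).trans (min_le_right _ _)
  rw [arrival, this, NNReal.sInf_empty]

theorem IsRegular.mark_stopPath {f : ℝ≥0 → ℝ} (hc : IsCadlag f) (hf : IsRegular f) {s : ℝ≥0}
    {n : ℕ} (hn : n ≤ jumpCount f s) :
    mark n (Cogarch.stopPath s f) = mark n f := by
  rw [mark, hf.arrival_stopPath hc hn, hc.jump_stopPath, if_pos ((hf.arrival_le_iff n s).2 hn), mark]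

theorem IsCadlag.jumpCount_stopPath {f : ℝ≥0 → ℝ} (hc : IsCadlag f) (s : ℝ≥0) :
    jumpCount (Cogarch.stopPath s f) s = jumpCount f s := by
  rw [jumpCount, hc.jumpSet_stopPath, min_self, jumpCount]

/-! ### Measurability of the jump functionals on the path space -/

namespace CadlagPath

theorem measurable_eval (t : ℝ≥0) : Measurable fun f : CadlagPath => f.1 t :=
  (measurable_pi_apply t).comp measurable_subtype_coe

/-- The increments after time `s`, as a map of the path space. -/
def shift (s : ℝ≥0) (f : CadlagPath) : CadlagPath := ⟨shiftPath s f.1, f.2.shiftPath s⟩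

/-- Stopping at time `s`, as a map of the path space. -/
def stopAt (s : ℝ≥0) (f : CadlagPath) : CadlagPath := ⟨stopPath s f.1, f.2.stopPath s⟩

theorem measurable_shift (s : ℝ≥0) : Measurable (shift s) :=
  Measurable.subtype_mk (measurable_pi_iff.2 fun h =>
    (measurable_eval (s + h)).sub (measurable_eval s))

theorem measurable_stopAt (s : ℝ≥0) : Measurable (stopAt s) :=
  Measurable.subtype_mk (measurable_pi_iff.2 fun h => measurable_eval (min h s))

end CadlagPath

open CadlagPath TopologicalSpace

/-- A countable dense family of points of `[s, t]`, containing `t`. -/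
def gridPoint (s t : ℝ≥0) (i : ℕ) : ℝ≥0 := max s (min t (denseSeq ℝ≥0 i))

theorem exists_denseSeq_mem_Ioo {a b : ℝ≥0} (h : a < b) : ∃ i, denseSeq ℝ≥0 i ∈ Set.Ioo a b :=
  (denseRange_denseSeq ℝ≥0).exists_mem_open isOpen_Ioo (Set.nonempty_Ioo.2 h)

theorem frequently_gridPoint_left {s t v : ℝ≥0} (hs : s < v) (ht : v ≤ t) :
    ∃ᶠ u in 𝓝[<] v, ∃ i, gridPoint s t i = u := by
  intro hev
  rw [Filter.Eventually, mem_nhdsLT_iff_exists_Ioo_subset' hs] at hev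
  obtain ⟨a, ha, hsub⟩ := hev
  obtain ⟨i, hi⟩ := exists_denseSeq_mem_Ioo (max_lt ha hs : max a s < v)
  refine hsub ⟨(le_max_left _ _).trans_lt hi.1, hi.2⟩ ⟨i, ?_⟩
  rw [gridPoint, min_eq_right (hi.2.le.trans ht), max_eq_right ((le_max_right a s).trans hi.1.le)]

/-- The filter `𝓝[≥] v` includes `v` itself because nothing lies to the right of `v = t` in the
grid; there the clipping at `t` makes the grid hit `v` exactly. -/
theorem frequently_gridPoint_right {s t v : ℝ≥0} (hs : s ≤ v) (ht : v ≤ t) :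
    ∃ᶠ u in 𝓝[≥] v, ∃ i, gridPoint s t i = u := by
  intro hev
  rcases ht.eq_or_lt with rfl | ht
  · obtain ⟨i, hi⟩ := exists_denseSeq_mem_Ioo (lt_add_of_pos_right v one_pos)
    refine hev.self_of_nhdsWithin (Set.mem_Ici.2 le_rfl) ⟨i, ?_⟩
    rw [gridPoint, min_eq_left hi.1.le, max_eq_right hs]
  · rw [Filter.Eventually, mem_nhdsGE_iff_exists_Ico_subset' ht] at hev
    obtain ⟨b, hb, hsub⟩ := hev
    obtain ⟨i, hi⟩ := exists_denseSeq_mem_Ioo (lt_min hb ht : v < min b t)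
    refine hsub ⟨hi.1.le, hi.2.trans_le (min_le_left _ _)⟩ ⟨i, ?_⟩
    rw [gridPoint, min_eq_right (hi.2.le.trans (min_le_right _ _)), max_eq_right (hs.trans hi.1.le)]

theorem IsCadlag.continuousAt_of_jump_eq_zero {f : ℝ≥0 → ℝ} (hf : IsCadlag f) {v : ℝ≥0}
    (hj : jump f v = 0) : ContinuousAt f v := by
  refine continuousAt_iff_continuous_left'_right'.2 ⟨?_, (hf v).1⟩
  have := hf.tendsto_leftLim v
  rwa [← sub_eq_zero.1 hj] at this

/-- The path has no jump in `(s, t]`. -/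
def NoJump (f : ℝ≥0 → ℝ) (s t : ℝ≥0) : Prop := ∀ u, s < u → u ≤ t → jump f u = 0

/-- A cadlag path without jumps in `(s, t]` is continuous on the compact interval `[s, t]`, hence
uniformly continuous. Conversely, grid points on the two sides of a jump are arbitrarily close while
the values stay apart. The right side involves countably many coordinates only, which is what
measurability needs. -/
theorem IsCadlag.noJump_iff {f : ℝ≥0 → ℝ} (hf : IsCadlag f) {s t : ℝ≥0} (hst : s ≤ t) :
    NoJump f s t ↔ ∀ m : ℕ, ∃ k : ℕ, ∀ i j : ℕ,
      dist (gridPoint s t i) (gridPoint s t j) < 1 / ((k : ℝ) + 1) →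
      dist (f (gridPoint s t i)) (f (gridPoint s t j)) < 1 / ((m : ℝ) + 1) := by
  constructor
  · intro h m
    have hc : ContinuousOn f (Set.Icc s t) := by
      intro v hv
      rcases hv.1.eq_or_lt with rfl | hsv
      · exact (hf.continuousWithinAt_Ici s).mono Set.Icc_subset_Ici_self
      · exact (hf.continuousAt_of_jump_eq_zero (h v hsv hv.2)).continuousWithinAt
    have huc := isCompact_Icc.uniformContinuousOn_of_continuous hc
    obtain ⟨δ, hδ, h'⟩ := Metric.uniformContinuousOn_iff.1 huc (1 / ((m : ℝ) + 1)) (by positivity)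
    obtain ⟨k, hk⟩ := exists_nat_one_div_lt hδ
    have hmem : ∀ i, gridPoint s t i ∈ Set.Icc s t := fun i =>
      ⟨le_max_left _ _, max_le hst (min_le_left _ _)⟩
    exact ⟨k, fun i j hij => h' _ (hmem i) _ (hmem j) (hij.trans hk)⟩
  · intro h v hsv hvt
    by_contra hj
    have hpos : 0 < dist (Function.leftLim f v) (f v) := by
      rw [dist_pos]
      exact fun he => hj (sub_eq_zero.2 he.symm)
    -- A third of the jump: the two one-sided errors and the claimed oscillation bound then add up
    -- to less than the jump, a contradiction.
    obtain ⟨m, hm⟩ := exists_nat_one_div_lt (by positivity : 0 < dist (Function.leftLim f v) (f v) / 3)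
    obtain ⟨k, hk⟩ := h m
    have hδ : (0 : ℝ) < 1 / ((k : ℝ) + 1) / 2 := by positivity
    have hl : ∀ᶠ u in 𝓝[<] v, dist u v < 1 / ((k : ℝ) + 1) / 2 ∧
        dist (f u) (Function.leftLim f v) < dist (Function.leftLim f v) (f v) / 3 :=
      Filter.Eventually.and (mem_nhdsWithin_of_mem_nhds (Metric.ball_mem_nhds v hδ))
        ((hf.tendsto_leftLim v) (Metric.ball_mem_nhds _ (by positivity)))
    have hr : ∀ᶠ u in 𝓝[≥] v, dist u v < 1 / ((k : ℝ) + 1) / 2 ∧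
        dist (f u) (f v) < dist (Function.leftLim f v) (f v) / 3 :=
      Filter.Eventually.and (mem_nhdsWithin_of_mem_nhds (Metric.ball_mem_nhds v hδ))
        ((hf.continuousWithinAt_Ici v) (Metric.ball_mem_nhds _ (by positivity)))
    obtain ⟨u, ⟨i, rfl⟩, hu1, hu2⟩ := ((frequently_gridPoint_left hsv hvt).and_eventually hl).exists
    obtain ⟨w, ⟨j, rfl⟩, hw1, hw2⟩ :=
      ((frequently_gridPoint_right hsv.le hvt).and_eventually hr).exists
    have h1 := hk i j (by
      have := dist_triangle_right (gridPoint s t i) (gridPoint s t j) v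
      linarith)
    have h2 := dist_triangle4 (Function.leftLim f v) (f (gridPoint s t i)) (f (gridPoint s t j)) (f v)
    rw [dist_comm (Function.leftLim f v) (f (gridPoint s t i))] at h2
    linarith

theorem measurableSet_noJump {s t : ℝ≥0} (hst : s ≤ t) :
    MeasurableSet {f : CadlagPath | NoJump f.1 s t} := by
  have : {f : CadlagPath | NoJump f.1 s t} = ⋂ m : ℕ, ⋃ k : ℕ, ⋂ i : ℕ, ⋂ j : ℕ,
      {f : CadlagPath | dist (gridPoint s t i) (gridPoint s t j) < 1 / ((k : ℝ) + 1) →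
        dist (f.1 (gridPoint s t i)) (f.1 (gridPoint s t j)) < 1 / ((m : ℝ) + 1)} := by
    ext f
    simp only [Set.mem_ofPred_eq, Set.mem_iInter, Set.mem_iUnion]
    exact f.2.noJump_iff hst
  rw [this]
  refine MeasurableSet.iInter fun m => MeasurableSet.iUnion fun k => MeasurableSet.iInter fun i =>
    MeasurableSet.iInter fun j => ?_
  refine MeasurableSet.imp (MeasurableSet.const _) ?_
  exact measurableSet_lt ((measurable_eval _).dist (measurable_eval _)) measurable_const

/-- Inductive step for the measurability of the count. Given `n + 1` jumps, a point of the dense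
sequence separates the last of them from the others. -/
theorem add_one_le_jumpNum_iff (f : ℝ≥0 → ℝ) (n : ℕ) (t : ℝ≥0) :
    ((n + 1 : ℕ) : ℕ∞) ≤ jumpNum f t ↔ ∃ i, denseSeq ℝ≥0 i ≤ t ∧
      (n : ℕ∞) ≤ jumpNum f (denseSeq ℝ≥0 i) ∧ ¬ NoJump f (denseSeq ℝ≥0 i) t := by
  classical
  constructor
  · intro h
    obtain ⟨F, hF, hcard⟩ := Set.exists_subset_encard_eq h
    have hfin : F.Finite := Set.finite_of_encard_eq_coe hcard
    lift F to Finset ℝ≥0 using hfin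
    rw [Set.encard_coe_eq_coe_finsetCard, Nat.cast_inj] at hcard
    have hne : F.Nonempty := Finset.card_pos.1 (by omega)
    set m := F.max' hne with hm
    have hmF : m ∈ F := F.max'_mem hne
    have hmj := hF hmF
    obtain ⟨i, hi⟩ := exists_denseSeq_mem_Ioo (a := (F.erase m).sup id) (b := m) (by
      rw [Finset.sup_lt_iff (show (⊥ : ℝ≥0) < m from hmj.1)]
      intro b hb
      exact lt_of_le_of_ne (F.le_max' b (Finset.mem_of_mem_erase hb)) (Finset.ne_of_mem_erase hb))
    refine ⟨i, hi.2.le.trans hmj.2.1, ?_, fun hno => hmj.2.2 (hno m hi.2 hmj.2.1)⟩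
    have hsub : ((F.erase m : Finset ℝ≥0) : Set ℝ≥0) ⊆ jumpSet f (denseSeq ℝ≥0 i) := by
      intro b hb
      have hbF := hF (Finset.mem_of_mem_erase (Finset.mem_coe.1 hb))
      exact ⟨hbF.1, (Finset.le_sup (f := id) (Finset.mem_coe.1 hb)).trans hi.1.le, hbF.2.2⟩
    refine le_trans ?_ (Set.encard_le_encard hsub)
    rw [Set.encard_coe_eq_coe_finsetCard, Finset.card_erase_of_mem hmF, hcard]
    simp
  · rintro ⟨i, hit, hn, hno⟩
    unfold NoJump at hno
    push Not at hno
    obtain ⟨u, hu1, hu2, hu3⟩ := hno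
    have hsub : insert u (jumpSet f (denseSeq ℝ≥0 i)) ⊆ jumpSet f t :=
      Set.insert_subset ⟨pos_of_jump_ne_zero hu3, hu2, hu3⟩ (jumpSet_mono f hit)
    refine le_trans ?_ (Set.encard_le_encard hsub)
    rw [Set.encard_insert_of_notMem fun h => absurd h.2.1 (not_le.2 hu1)]
    push_cast
    gcongr
    exact hn

theorem measurableSet_le_jumpNum (n : ℕ) :
    ∀ t : ℝ≥0, MeasurableSet {f : CadlagPath | (n : ℕ∞) ≤ jumpNum f.1 t} := by
  induction n with
  | zero => simp
  | succ n ih =>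
    intro t
    simp only [add_one_le_jumpNum_iff]
    rw [Set.ofPred_exists]
    refine MeasurableSet.iUnion fun i => ?_
    by_cases hi : denseSeq ℝ≥0 i ≤ t
    · exact (MeasurableSet.const _).inter ((ih _).inter (measurableSet_noJump hi).compl)
    · simp [hi]

theorem measurable_jumpNum (t : ℝ≥0) : Measurable fun f : CadlagPath => jumpNum f.1 t := by
  refine measurable_to_countable' fun x => ?_
  induction x with
  | top =>
    have : (fun f : CadlagPath => jumpNum f.1 t) ⁻¹' {⊤} =
        ⋂ n : ℕ, {f | (n : ℕ∞) ≤ jumpNum f.1 t} := by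
      ext f
      simp [ENat.eq_top_iff_forall_ge]
    rw [this]
    exact MeasurableSet.iInter fun n => measurableSet_le_jumpNum n t
  | coe n =>
    have : (fun f : CadlagPath => jumpNum f.1 t) ⁻¹' {(n : ℕ∞)} =
        {f | (n : ℕ∞) ≤ jumpNum f.1 t} ∩ {f | ((n + 1 : ℕ) : ℕ∞) ≤ jumpNum f.1 t}ᶜ := by
      ext f
      simp only [Set.mem_preimage, Set.mem_singleton_iff, Set.mem_inter_iff, Set.mem_ofPred_eq,
        Set.mem_compl_iff, Nat.cast_add, Nat.cast_one, ENat.add_one_le_iff (ENat.natCast_ne_top n)]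
      rw [not_lt, le_antisymm_iff, and_comm]
    rw [this]
    exact (measurableSet_le_jumpNum n t).inter (measurableSet_le_jumpNum (n + 1) t).compl

theorem measurable_jumpCount (t : ℝ≥0) : Measurable fun f : CadlagPath => jumpCount f.1 t :=
  (Measurable.of_discrete (f := ENat.toNat)).comp (measurable_jumpNum t)

theorem measurable_arrival (n : ℕ) : Measurable fun f : CadlagPath => arrival n f.1 := by
  refine measurable_of_Iio fun t => ?_
  -- The second set collects the paths that never make `n` jumps, whose arrival time is `0` by
  -- convention.
  have : (fun f : CadlagPath => arrival n f.1) ⁻¹' Set.Iio t =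
      (⋃ i, {f | denseSeq ℝ≥0 i < t ∧ (n : ℕ∞) ≤ jumpNum f.1 (denseSeq ℝ≥0 i)}) ∪
      (⋂ k : ℕ, {f | (n : ℕ∞) ≤ jumpNum f.1 k}ᶜ) ∩ {f | 0 < t} := by
    ext f
    simp only [Set.mem_preimage, Set.mem_Iio, Set.mem_union, Set.mem_iUnion, Set.mem_inter_iff,
      Set.mem_iInter, Set.mem_compl_iff, Set.mem_ofPred_eq]
    by_cases hne : ∃ k : ℕ, (n : ℕ∞) ≤ jumpNum f.1 k
    · have hne' : {t | (n : ℕ∞) ≤ jumpNum f.1 t}.Nonempty := ⟨_, hne.choose_spec⟩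
      have : ¬ ∀ k : ℕ, ¬ (n : ℕ∞) ≤ jumpNum f.1 k := by simpa using hne
      simp only [this, false_and, or_false]
      rw [arrival, csInf_lt_iff (OrderBot.bddBelow _) hne']
      constructor
      · rintro ⟨u, hu, hut⟩
        obtain ⟨i, hi⟩ := exists_denseSeq_mem_Ioo hut
        exact ⟨i, hi.2, le_trans hu (jumpNum_mono _ hi.1.le)⟩
      · rintro ⟨i, hi, hi'⟩
        exact ⟨_, hi', hi⟩
    · have hem : {t | (n : ℕ∞) ≤ jumpNum f.1 t} = ∅ := by
        ext u
        simp only [Set.mem_ofPred_eq, Set.mem_empty_iff_false, iff_false]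
        intro hu
        obtain ⟨k, hk⟩ := exists_nat_ge u
        exact hne ⟨k, le_trans hu (jumpNum_mono _ hk)⟩
      have h0 : ∀ u, ¬ (n : ℕ∞) ≤ jumpNum f.1 u := fun u hu => by
        have : u ∈ (∅ : Set ℝ≥0) := hem ▸ hu
        exact this
      simp [arrival, h0]
  rw [this]
  refine (MeasurableSet.iUnion fun i => ?_).union (MeasurableSet.inter
    (MeasurableSet.iInter fun k => (measurableSet_le_jumpNum n k).compl) (MeasurableSet.const _))
  exact (MeasurableSet.const _).inter (measurableSet_le_jumpNum n _)

theorem tendsto_grid_above (t : ℝ≥0) :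
    Tendsto (fun k : ℕ => ((⌊t * (k + 1)⌋₊ + 1 : ℕ) : ℝ≥0) / (k + 1)) atTop (𝓝[≥] t) := by
  refine tendsto_nhdsWithin_iff.2 ⟨?_, Eventually.of_forall fun k => ?_⟩
  · rw [← NNReal.tendsto_coe]
    push_cast
    have h1 : Tendsto (fun k : ℕ => (t : ℝ) + 1 / ((k : ℝ) + 1)) atTop (𝓝 (t + 0)) :=
      tendsto_const_nhds.add tendsto_one_div_add_atTop_nhds_zero_nat
    rw [add_zero] at h1
    refine tendsto_of_tendsto_of_tendsto_of_le_of_le tendsto_const_nhds h1 (fun k => ?_)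
      (fun k => ?_)
    · rw [le_div_iff₀ (by positivity)]
      exact_mod_cast (Nat.lt_floor_add_one (t * ((k : ℝ≥0) + 1))).le
    · rw [div_le_iff₀ (by positivity), add_mul, one_div_mul_cancel (by positivity)]
      gcongr
      exact_mod_cast Nat.floor_le (zero_le (a := t * ((k : ℝ≥0) + 1)))
  · rw [Set.mem_Ici, le_div_iff₀ (by positivity)]
    exact_mod_cast (Nat.lt_floor_add_one (t * ((k : ℝ≥0) + 1))).le

theorem tendsto_grid_below {t : ℝ≥0} (ht : t ≠ 0) :
    Tendsto (fun k : ℕ => t - 1 / ((k : ℝ≥0) + 1)) atTop (𝓝[<] t) := by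
  refine tendsto_nhdsWithin_iff.2 ⟨?_, ?_⟩
  · have h1 : Tendsto (fun k : ℕ => 1 / ((k : ℝ≥0) + 1)) atTop (𝓝 0) :=
      tendsto_one_div_add_atTop_nhds_zero_nat
    simpa using tendsto_const_nhds.sub h1
  · exact Eventually.of_forall fun k => tsub_lt_self (pos_iff_ne_zero.2 ht) (by positivity)

/-- By right-continuity the value is a limit of values at grid points approaching the time from the
right, and these take countably many values. -/
theorem measurable_eval_prod : Measurable fun p : CadlagPath × ℝ≥0 => p.1.1 p.2 := by
  refine measurable_of_tendsto_metrizable (f := fun (k : ℕ) (p : CadlagPath × ℝ≥0) =>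
    p.1.1 (((⌊p.2 * (k + 1)⌋₊ + 1 : ℕ) : ℝ≥0) / (k + 1))) (fun k => ?_) ?_
  · have h1 : Measurable fun p : CadlagPath × ℕ => p.1.1 ((p.2 : ℝ≥0) / (k + 1)) :=
      measurable_from_prod_countable_left fun n => measurable_eval ((n : ℝ≥0) / (k + 1))
    have h2 : Measurable fun p : CadlagPath × ℝ≥0 => ⌊p.2 * (k + 1)⌋₊ + 1 :=
      (Nat.measurable_floor.comp (measurable_snd.mul_const _)).add_const 1
    exact h1.comp (measurable_fst.prodMk h2)
  · rw [tendsto_pi_nhds]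
    intro p
    exact (p.1.2.continuousWithinAt_Ici p.2).tendsto.comp (tendsto_grid_above p.2)

theorem measurable_jump : Measurable fun p : CadlagPath × ℝ≥0 => jump p.1.1 p.2 := by
  refine measurable_eval_prod.sub (measurable_of_tendsto_metrizable
    (f := fun (k : ℕ) (p : CadlagPath × ℝ≥0) => p.1.1 (p.2 - 1 / ((k : ℝ≥0) + 1))) (fun k => ?_) ?_)
  · exact measurable_eval_prod.comp (measurable_fst.prodMk (measurable_snd.sub_const _))
  · rw [tendsto_pi_nhds]
    rintro ⟨f, t⟩
    rcases eq_or_ne t 0 with rfl | ht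
    · simp [leftLim_eq_of_isBot (f := f.1) (fun _ => zero_le : IsBot (0 : ℝ≥0))]
    · exact (f.2.tendsto_leftLim t).comp (tendsto_grid_below ht)

theorem measurable_mark (n : ℕ) : Measurable fun f : CadlagPath => mark n f.1 :=
  measurable_jump.comp (measurable_id.prodMk (measurable_arrival n))

/-! ### The law of a Lévy process on the path space -/

/-- Independence of increments is applied along monotone sequences of times; the finite set is
listed in increasing order and then repeated at its maximum. -/
theorem exists_monotone_enum (K : Finset ℝ≥0) :
    ∃ τ : ℕ → ℝ≥0, Monotone τ ∧ ∀ u ∈ K, ∃ k, τ k = u := by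
  rcases K.eq_empty_or_nonempty with rfl | hK
  · exact ⟨fun _ => 0, monotone_const, by simp⟩
  have hc : 0 < K.card := hK.card_pos
  refine ⟨fun k => K.orderEmbOfFin rfl ⟨min k (K.card - 1), by omega⟩, fun a b hab => ?_, ?_⟩
  · refine (K.orderEmbOfFin rfl).monotone ?_
    rw [Fin.mk_le_mk]
    omega
  · intro u hu
    have : u ∈ Set.range (K.orderEmbOfFin rfl) := by rwa [Finset.range_orderEmbOfFin]
    obtain ⟨k, hk⟩ := this
    refine ⟨k, ?_⟩
    rw [← hk]
    refine congrArg (K.orderEmbOfFin rfl) ?_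
    exact Fin.ext (min_eq_left (Nat.le_sub_one_of_lt k.2))

variable {Ω : Type*} [MeasurableSpace Ω] {P : Measure Ω} [IsProbabilityMeasure P]
  {L : ℝ≥0 → Ω → ℝ}

/-- Finite-dimensional marginals determine the law, and each is a fixed function (partial sums) of
the increments along sorted times. Before and after the shift these increments are independent with
the same individual laws. -/
theorem IsLevyProcess.map_shift (hL : IsLevyProcess P L) (s : ℝ≥0) :
    P.map (fun ω h => L (s + h) ω - L s ω) = P.map (fun ω h => L h ω) := by
  have hm := hL.measurable
  refine (map_eq_iff_forall_finset_map_restrict_eq (X := fun h ω => L (s + h) ω - L s ω)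
    (measurable_pi_lambda _ fun h => (hm _).sub (hm _)).aemeasurable
    (measurable_pi_lambda _ hm).aemeasurable).2 fun I => ?_
  classical
  obtain ⟨τ, hτ, hK⟩ := exists_monotone_enum (insert 0 I)
  have hτ0 : τ 0 = 0 := by
    obtain ⟨k, hk⟩ := hK 0 (Finset.mem_insert_self _ _)
    exact le_antisymm (hk ▸ hτ (Nat.zero_le k)) zero_le
  choose! idx hidx using hK
  have hi1 := hL.indep.nat hτ
  have hi2 := hL.indep.nat (t := fun j => s + τ j) (fun a b hab => add_le_add_right (hτ hab) s)
  have hlaw : ∀ j, P.map (fun ω => L (s + τ (j + 1)) ω - L (s + τ j) ω) =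
      P.map (fun ω => L (τ (j + 1)) ω - L (τ j) ω) := by
    intro j
    have hd : τ j + (τ (j + 1) - τ j) = τ (j + 1) := add_tsub_cancel_of_le (hτ (Nat.le_succ j))
    have h1 := (hL.stationary (s + τ j) (τ (j + 1) - τ j)).map_eq
    have h2 := (hL.stationary (τ j) (τ (j + 1) - τ j)).map_eq
    rw [add_assoc, hd] at h1
    rw [hd] at h2
    rw [h1, h2]
  have hmap : P.map (fun ω j => L (s + τ (j + 1)) ω - L (s + τ j) ω) =
      P.map (fun ω j => L (τ (j + 1)) ω - L (τ j) ω) := by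
    rw [hi1.map_fun_eq_infinitePi_map₀ (by fun_prop), hi2.map_fun_eq_infinitePi_map₀ (by fun_prop)]
    simp_rw [hlaw]
  let g : (ℕ → ℝ) → (I → ℝ) := fun d u => ∑ j ∈ Finset.range (idx u), d j
  have hg : Measurable g := by fun_prop
  have hg1 : (fun ω => I.restrict fun h => L (s + h) ω - L s ω) =
      fun ω => g fun j => L (s + τ (j + 1)) ω - L (s + τ j) ω := by
    ext ω u
    simp only [g, Finset.restrict]
    rw [Finset.sum_range_sub (fun j => L (s + τ j) ω), hidx u (Finset.mem_insert_of_mem u.2), hτ0,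
      add_zero]
  have hg2 : (fun ω => I.restrict fun h => L h ω) =ᵐ[P]
      fun ω => g fun j => L (τ (j + 1)) ω - L (τ j) ω := by
    filter_upwards [hL.zero] with ω hω
    ext u
    simp only [g, Finset.restrict]
    rw [Finset.sum_range_sub (fun j => L (τ j) ω), hidx u (Finset.mem_insert_of_mem u.2), hτ0, hω,
      sub_zero]
  rw [Measure.map_congr hg2, hg1]
  have e1 := Measure.map_map (μ := P) hg
    (show Measurable fun ω (j : ℕ) => L (s + τ (j + 1)) ω - L (s + τ j) ω by fun_prop)
  have e2 := Measure.map_map (μ := P) hg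
    (show Measurable fun ω (j : ℕ) => L (τ (j + 1)) ω - L (τ j) ω by fun_prop)
  rw [hmap] at e1
  exact e1.symm.trans e2

/-- With all relevant times listed in increasing order and `s` at index `k0`, the stopped marginals
are sums of increments of index below `k0` and the restarted ones are sums of increments of index at
least `k0`. -/
theorem IsLevyProcess.indepFun_stop_shift (hL : IsLevyProcess P L) (s : ℝ≥0) :
    IndepFun (fun ω h => L (min h s) ω) (fun ω h => L (s + h) ω - L s ω) P := by
  have hm := hL.measurable
  refine IndepFun.process_indepFun_process (fun h => hm _) (fun h => (hm _).sub (hm _))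
    fun I J => ?_
  classical
  obtain ⟨τ, hτ, hK⟩ := exists_monotone_enum
    (insert 0 (insert s (I.image (fun h => min h s) ∪ J.image (fun h => s + h))))
  have hτ0 : τ 0 = 0 := by
    obtain ⟨k, hk⟩ := hK 0 (Finset.mem_insert_self _ _)
    exact le_antisymm (hk ▸ hτ (Nat.zero_le k)) zero_le
  obtain ⟨k0, hk0⟩ := hK s (by simp)
  have hKI : ∀ h ∈ I, ∃ k ≤ k0, τ k = min h s := by
    intro h hh
    obtain ⟨k, hk⟩ := hK (min h s) (Finset.mem_insert_of_mem (Finset.mem_insert_of_mem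
      (Finset.mem_union_left _ (Finset.mem_image_of_mem _ hh))))
    rcases le_total k k0 with hkk | hkk
    · exact ⟨k, hkk, hk⟩
    · refine ⟨k0, le_rfl, ?_⟩
      exact le_antisymm (hk ▸ hτ hkk) (hk0 ▸ min_le_right h s)
  have hKJ : ∀ h ∈ J, ∃ k, k0 ≤ k ∧ τ k = s + h := by
    intro h hh
    obtain ⟨k, hk⟩ := hK (s + h) (Finset.mem_insert_of_mem (Finset.mem_insert_of_mem
      (Finset.mem_union_right _ (Finset.mem_image_of_mem _ hh))))
    rcases le_total k0 k with hkk | hkk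
    · exact ⟨k, hkk, hk⟩
    · refine ⟨k0, le_rfl, ?_⟩
      exact le_antisymm (hk0 ▸ le_self_add) (hk ▸ hτ hkk)
  choose! a ha1 ha2 using hKI
  choose! b hb1 hb2 using hKJ
  let n := J.sup b
  have hind := (hL.indep.nat hτ).indepFun_finset (Finset.range k0) (Finset.Ico k0 n)
    (by
      rw [Finset.disjoint_left]
      intro x hx hx'
      exact absurd (Finset.mem_range.1 hx) (not_lt.2 (Finset.mem_Ico.1 hx').1))
    (fun j => (hm _).sub (hm _))
  let g : (Finset.range k0 → ℝ) → (I → ℝ) := fun d u =>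
    ∑ j : Finset.range k0, if (j : ℕ) < a u then d j else 0
  let g' : (Finset.Ico k0 n → ℝ) → (J → ℝ) := fun d u =>
    ∑ j : Finset.Ico k0 n, if (j : ℕ) < b u then d j else 0
  have hg : Measurable g := by
    refine measurable_pi_lambda _ fun u => Finset.measurable_sum _ fun j _ => ?_
    split_ifs <;> fun_prop
  have hg' : Measurable g' := by
    refine measurable_pi_lambda _ fun u => Finset.measurable_sum _ fun j _ => ?_
    split_ifs <;> fun_prop
  refine (hind.comp hg hg').congr ?_ (ae_of_all _ fun ω => ?_)
  · filter_upwards [hL.zero] with ω hω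
    ext u
    simp only [g, Function.comp]
    rw [Finset.sum_coe_sort (Finset.range k0) (fun j => if j < a u then
      L (τ (j + 1)) ω - L (τ j) ω else 0), ← Finset.sum_filter]
    have : (Finset.range k0).filter (fun j => j < a u) = Finset.range (a u) := by
      ext j
      have := ha1 u u.2
      simp only [Finset.mem_filter, Finset.mem_range]
      omega
    rw [this, Finset.sum_range_sub (fun j => L (τ j) ω), ha2 u u.2, hτ0, hω, sub_zero]
  · ext u
    simp only [g', Function.comp]
    rw [Finset.sum_coe_sort (Finset.Ico k0 n) (fun j => if j < b u then
      L (τ (j + 1)) ω - L (τ j) ω else 0), ← Finset.sum_filter]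
    have : (Finset.Ico k0 n).filter (fun j => j < b u) = Finset.Ico k0 (b u) := by
      ext j
      have := hb1 u u.2
      have h2 : b u ≤ n := Finset.le_sup (f := b) u.2
      simp only [Finset.mem_filter, Finset.mem_Ico]
      omega
    rw [this, Finset.sum_Ico_sub (fun j => L (τ j) ω) (hb1 u u.2), hb2 u u.2, hk0]

open CadlagPath

/-- Laws on the path space under which the increments are stationary and independent. -/
structure IsLevyLaw (μ : Measure CadlagPath) : Prop where
  map_shift : ∀ s, μ.map (shift s) = μ
  indep : ∀ s, IndepFun (stopAt s) (shift s) μ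

theorem CadlagPath.measure_ext {μ μ' : Measure CadlagPath}
    (h : μ.map Subtype.val = μ'.map Subtype.val) : μ = μ' := by
  ext A ⟨B, hB, hA⟩
  rw [← hA, ← Measure.map_apply measurable_subtype_coe hB, h,
    Measure.map_apply measurable_subtype_coe hB]

omit [IsProbabilityMeasure P] in
theorem CadlagPath.indepFun_left {β : Type*} [MeasurableSpace β] {F : Ω → CadlagPath} {G : Ω → β}
    (h : IndepFun (fun ω => (F ω).1) G P) : IndepFun F G P := by
  rw [IndepFun_iff] at h ⊢
  refine fun t1 t2 ht1 ht2 => h t1 t2 ?_ ht2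
  obtain ⟨A, ⟨B, hB, rfl⟩, rfl⟩ := ht1
  exact ⟨B, hB, rfl⟩

omit [IsProbabilityMeasure P] in
theorem CadlagPath.indepFun_iff {β : Type*} [MeasurableSpace β] {F : Ω → CadlagPath} {G : Ω → β} :
    IndepFun F G P ↔ IndepFun (fun ω => (F ω).1) G P :=
  ⟨fun h => h.comp measurable_subtype_coe measurable_id, CadlagPath.indepFun_left⟩

theorem isCadlag_const (c : ℝ) : IsCadlag (fun _ : ℝ≥0 => c) := fun _ =>
  ⟨continuousWithinAt_const, c, tendsto_const_nhds⟩

/-- Setting the path to zero on a null set makes every path cadlag, so that the functionals of the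
path space can be composed with it. -/
theorem IsLevyProcess.exists_path (hL : IsLevyProcess P L) :
    ∃ F : Ω → CadlagPath, Measurable F ∧ (∀ᵐ ω ∂P, (F ω).1 = fun t => L t ω) ∧
      IsLevyLaw (P.map F) := by
  classical
  -- A measurable null superset is used so that the modified map is measurable; measurability of the
  -- exceptional set itself is not known.
  obtain ⟨A, hA, hAm, hA0⟩ := exists_measurable_superset_of_null (ae_iff.1 hL.cadlag)
  have hcad : ∀ ω, ω ∉ A → IsCadlag (fun t => L t ω) := fun ω hω => by
    by_contra hcon
    exact hω (hA hcon)
  let F : Ω → CadlagPath := fun ω =>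
    if h : ω ∈ A then ⟨fun _ => 0, isCadlag_const 0⟩ else ⟨fun t => L t ω, hcad ω h⟩
  have hFv : ∀ ω, (F ω).1 = fun t => if ω ∈ A then 0 else L t ω := by
    intro ω
    by_cases h : ω ∈ A <;> simp [F, h]
  have hF : Measurable F := by
    refine measurable_comap_iff.2 (measurable_pi_iff.2 fun t => ?_)
    have : (fun ω => (F ω).1 t) = fun ω => if ω ∈ A then 0 else L t ω := by
      ext ω
      rw [hFv]
    exact this ▸ Measurable.ite hAm measurable_const (hL.measurable t)
  have hFL : ∀ᵐ ω ∂P, (F ω).1 = fun t => L t ω := by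
    filter_upwards [measure_eq_zero_iff_ae_notMem.1 hA0] with ω hω
    simp [hFv, hω]
  have hm := hL.measurable
  refine ⟨F, hF, hFL, ⟨fun s => ?_, fun s => ?_⟩⟩
  · rw [Measure.map_map (measurable_shift s) hF]
    refine CadlagPath.measure_ext ?_
    rw [Measure.map_map measurable_subtype_coe ((measurable_shift s).comp hF),
      Measure.map_map measurable_subtype_coe hF]
    have h1 : (Subtype.val ∘ shift s ∘ F : Ω → ℝ≥0 → ℝ) =ᵐ[P]
        fun ω h => L (s + h) ω - L s ω := by
      filter_upwards [hFL] with ω hω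
      simp only [Function.comp, shift, hω]
      rfl
    have h2 : (Subtype.val ∘ F : Ω → ℝ≥0 → ℝ) =ᵐ[P] fun ω h => L h ω := hFL
    rw [Measure.map_congr h1, Measure.map_congr h2, hL.map_shift s]
  · have hind : IndepFun (fun ω => stopAt s (F ω)) (fun ω => shift s (F ω)) P := by
      rw [CadlagPath.indepFun_iff]
      refine IndepFun.symm ?_
      rw [CadlagPath.indepFun_iff]
      refine (hL.indepFun_stop_shift s).symm.congr ?_ ?_
      · filter_upwards [hFL] with ω hω
        simp only [shift, hω]
        rfl
      · filter_upwards [hFL] with ω hω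
        simp only [stopAt, hω]
        rfl
    rw [indepFun_iff_measure_inter_preimage_eq_mul] at hind ⊢
    intro B C hB hC
    have hB' := measurable_stopAt s hB
    have hC' := measurable_shift s hC
    rw [Measure.map_apply hF (hB'.inter hC'), Measure.map_apply hF hB', Measure.map_apply hF hC']
    exact hind B C hB hC

/-! ### Jumps of a process with stationary independent increments -/

/-- A measure on sequences is an i.i.d. law if the first term is independent of the remaining
sequence, which has the law of the whole sequence. -/
theorem eq_infinitePi_of_map_head_tail {E : Type*} [MeasurableSpace E] {ρ : Measure (ℕ → E)}
    [IsProbabilityMeasure ρ] {ρ₀ : Measure E} [IsProbabilityMeasure ρ₀]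
    (h : ρ.map (fun x => (x 0, fun n => x (n + 1))) = ρ₀.prod ρ) :
    ρ = Measure.infinitePi (fun _ => ρ₀) := by
  have key : ∀ (N : ℕ) (t : ℕ → Set E), (∀ i, MeasurableSet (t i)) →
      ρ {x | ∀ i < N, x i ∈ t i} = ∏ i ∈ Finset.range N, ρ₀ (t i) := by
    intro N
    induction N with
    | zero => intro t _; simp
    | succ N ih =>
      intro t ht
      have hms : MeasurableSet {x : ℕ → E | ∀ i < N, x i ∈ t (i + 1)} := by
        have : {x : ℕ → E | ∀ i < N, x i ∈ t (i + 1)} =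
            ⋂ i, ⋂ (_ : i < N), (fun x => x i) ⁻¹' t (i + 1) := by
          ext x; simp
        rw [this]
        exact MeasurableSet.iInter fun i => MeasurableSet.iInter fun _ =>
          measurable_pi_apply i (ht (i + 1))
      have hset : {x : ℕ → E | ∀ i < N + 1, x i ∈ t i} =
          (fun x : ℕ → E => (x 0, fun n => x (n + 1))) ⁻¹'
            (t 0 ×ˢ {x | ∀ i < N, x i ∈ t (i + 1)}) := by
        ext x
        simp only [Set.mem_ofPred_eq, Set.mem_preimage, Set.mem_prod]
        constructor
        · exact fun hx => ⟨hx 0 (by omega), fun i hi => hx (i + 1) (by omega)⟩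
        · rintro ⟨h0, h1⟩ i hi
          cases i with
          | zero => exact h0
          | succ i => exact h1 i (by omega)
      rw [hset, ← Measure.map_apply (by fun_prop) ((ht 0).prod hms), h, Measure.prod_prod,
        ih _ fun i => ht (i + 1), Finset.prod_range_succ', mul_comm]
  classical
  refine Measure.eq_infinitePi _ fun s t ht => ?_
  obtain ⟨N, hN⟩ := s.exists_nat_subset_range
  have h1 := key N (fun i => if i ∈ s then t i else Set.univ) (fun i => by
    split_ifs
    · exact ht i
    · exact MeasurableSet.univ)
  have h2 : {x : ℕ → E | ∀ i < N, x i ∈ if i ∈ s then t i else Set.univ} = Set.pi s t := by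
    ext x
    simp only [Set.mem_ofPred_eq, Set.mem_pi, Finset.mem_coe]
    constructor
    · intro hx i hi
      simpa [hi] using hx i (Finset.mem_range.1 (hN hi))
    · intro hx i _
      split_ifs with hi
      · exact hx i hi
      · trivial
  rw [h2] at h1
  rw [h1]
  rw [← Finset.prod_subset hN (f := fun i => ρ₀ (if i ∈ s then t i else Set.univ))]
  · exact Finset.prod_congr rfl fun i hi => by simp [hi]
  · intro i _ hi
    simp [hi]

theorem measure_eq_tsum_inter_preimage {α ι : Type*} [MeasurableSpace α] [Countable ι]
    [MeasurableSpace ι] [MeasurableSingletonClass ι] (μ : Measure α) {c : α → ι}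
    (hc : Measurable c) {S : Set α} (hS : MeasurableSet S) :
    μ S = ∑' j, μ (S ∩ c ⁻¹' {j}) := by
  rw [← measure_iUnion]
  · congr 1
    ext x
    simp
  · intro i j hij
    refine Set.disjoint_left.2 fun x hx hx' => hij ?_
    exact hx.2.symm.trans hx'.2
  · exact fun j => hS.inter (hc (measurableSet_singleton j))

open CadlagPath

variable {μ : Measure CadlagPath} [IsProbabilityMeasure μ]

omit [IsProbabilityMeasure μ] in
theorem IsLevyLaw.measurePreserving (hμ : IsLevyLaw μ) (s : ℝ≥0) :
    MeasurePreserving (shift s) μ μ := ⟨measurable_shift s, hμ.map_shift s⟩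

omit [IsProbabilityMeasure μ] in
theorem IsLevyLaw.measure_stop_inter_shift (hμ : IsLevyLaw μ) (s : ℝ≥0) {U V : Set CadlagPath}
    (hU : MeasurableSet U) (hV : MeasurableSet V) :
    μ (stopAt s ⁻¹' U ∩ shift s ⁻¹' V) = μ (stopAt s ⁻¹' U) * μ V := by
  rw [(indepFun_iff_measure_inter_preimage_eq_mul.1 (hμ.indep s)) U V hU hV,
    (hμ.measurePreserving s).measure_preimage hV.nullMeasurableSet]

/-- The probability of no jump up to time `s`. -/
def survival (μ : Measure CadlagPath) (s : ℝ≥0) : ℝ≥0∞ := μ {f | jumpNum f.1 s = 0}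

theorem measurableSet_jumpNum_eq_zero (s : ℝ≥0) :
    MeasurableSet {f : CadlagPath | jumpNum f.1 s = 0} :=
  measurable_jumpNum s (measurableSet_singleton 0)

-- Loss of memory: having no jump up to `s + t` is an event of the stopped path intersected with an
-- event of the independent restarted path.
omit [IsProbabilityMeasure μ] in
theorem IsLevyLaw.survival_add (hμ : IsLevyLaw μ) (s t : ℝ≥0) :
    survival μ (s + t) = survival μ s * survival μ t := by
  have h := hμ.measure_stop_inter_shift s (measurableSet_jumpNum_eq_zero s)
    (measurableSet_jumpNum_eq_zero t)
  have h1 : stopAt s ⁻¹' {f : CadlagPath | jumpNum f.1 s = 0} =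
      {f : CadlagPath | jumpNum f.1 s = 0} := by
    ext f
    simp only [Set.mem_preimage, Set.mem_ofPred_eq, stopAt, f.2.jumpNum_stopPath, min_self]
  have h2 : {f : CadlagPath | jumpNum f.1 (s + t) = 0} =
      {f : CadlagPath | jumpNum f.1 s = 0} ∩ shift s ⁻¹' {f : CadlagPath | jumpNum f.1 t = 0} := by
    ext f
    simp only [Set.mem_ofPred_eq, Set.mem_inter_iff, Set.mem_preimage, shift, f.2.jumpNum_add,
      add_eq_zero]
  rw [h1, ← h2] at h
  exact h

theorem IsLevyLaw.survival_nat (hμ : IsLevyLaw μ) (n : ℕ) :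
    survival μ n = survival μ 1 ^ n := by
  induction n with
  | zero => simp [survival, jumpNum_zero]
  | succ n ih => rw [Nat.cast_succ, hμ.survival_add, ih, pow_succ]

/-- The expected number of jumps in `(0, 1]`. -/
def jumpRate (μ : Measure CadlagPath) : ℝ≥0∞ := ∫⁻ f, ((jumpNum f.1 1 : ℕ∞) : ℝ≥0∞) ∂μ

theorem measurable_jumpNum_ennreal (t : ℝ≥0) :
    Measurable fun f : CadlagPath => ((jumpNum f.1 t : ℕ∞) : ℝ≥0∞) :=
  (Measurable.of_discrete (f := ((↑) : ℕ∞ → ℝ≥0∞))).comp (measurable_jumpNum t)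

theorem survival_one_lt_one (hr : jumpRate μ ≠ 0) : survival μ 1 < 1 := by
  refine lt_of_le_of_ne prob_le_one fun h => hr ?_
  have : ∀ᵐ f ∂μ, jumpNum f.1 1 = 0 :=
    (prob_compl_eq_zero_iff (measurableSet_jumpNum_eq_zero 1)).2 h
  rw [jumpRate, lintegral_congr_ae (g := fun _ => 0)]
  · simp
  · filter_upwards [this] with f hf
    simp [hf]

/-- A finite rate gives finitely many jumps in each unit interval. A nonzero rate gives `survival μ
1 < 1`, so the probability of no jump up to `n` decays geometrically; this is applied after each
integer time. -/
theorem IsLevyLaw.ae_regular (hμ : IsLevyLaw μ) (hr : jumpRate μ ≠ 0) (hr' : jumpRate μ ≠ ⊤) :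
    ∀ᵐ f ∂μ, IsRegular f.1 := by
  have h1 : ∀ᵐ f ∂μ, ∀ n : ℕ, jumpNum (shift n f).1 1 < ⊤ := by
    rw [ae_all_iff]
    intro n
    refine (hμ.measurePreserving n).quasiMeasurePreserving.ae
      (p := fun f : CadlagPath => jumpNum f.1 1 < ⊤) ?_
    filter_upwards [ae_lt_top (measurable_jumpNum_ennreal 1) hr'] with f hf
    simpa using hf
  have h2 : ∀ᵐ f ∂μ, ∀ n : ℕ, ∃ t, jumpNum (shift n f).1 t ≠ 0 := by
    rw [ae_all_iff]
    intro n
    refine (hμ.measurePreserving n).quasiMeasurePreserving.ae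
      (p := fun f : CadlagPath => ∃ t, jumpNum f.1 t ≠ 0) ?_
    rw [ae_iff]
    refine le_antisymm (ge_of_tendsto' (ENNReal.tendsto_pow_atTop_nhds_zero_of_lt_one
      (survival_one_lt_one hr)) fun n => ?_) zero_le
    rw [← hμ.survival_nat]
    refine measure_mono fun f hf => ?_
    simp only [Set.mem_ofPred_eq, not_exists, not_not] at hf
    exact hf n
  filter_upwards [h1, h2] with f hf1 hf2
  constructor
  · rw [finiteActivity_iff]
    intro n
    induction n with
    | zero => simp [jumpNum_zero]
    | succ n ih =>
      rw [Nat.cast_succ, f.2.jumpNum_add]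
      exact WithTop.add_lt_top.2 ⟨ih, hf1 n⟩
  · intro n
    induction n with
    | zero => exact ⟨0, by simp⟩
    | succ n ih =>
      obtain ⟨t, ht⟩ := ih
      obtain ⟨k, hk⟩ := exists_nat_ge t
      obtain ⟨u, hu⟩ := hf2 k
      refine ⟨k + u, ?_⟩
      rw [f.2.jumpNum_add]
      push_cast
      exact add_le_add (ht.trans (jumpNum_mono _ hk)) (Order.one_le_iff_pos.2 (pos_iff_ne_zero.2 hu))

/-- The waiting times and sizes of the successive jumps. -/
def jumpSeq (f : ℝ≥0 → ℝ) (n : ℕ) : ℝ≥0 × ℝ :=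
  (arrival (n + 1) f - arrival n f, mark (n + 1) f)

theorem measurable_jumpSeq : Measurable fun f : CadlagPath => jumpSeq f.1 :=
  measurable_pi_iff.2 fun n =>
    ((measurable_arrival (n + 1)).sub (measurable_arrival n)).prodMk (measurable_mark (n + 1))

theorem jumpSeq_zero (f : ℝ≥0 → ℝ) : jumpSeq f 0 = (arrival 1 f, mark 1 f) := by
  simp [jumpSeq, arrival_zero]

/-- The first arrival, rounded up on the grid of mesh `1 / (k + 1)`. -/
def gridIndex (k : ℕ) (f : ℝ≥0 → ℝ) : ℕ := ⌈((k : ℝ≥0) + 1) * arrival 1 f⌉₊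

theorem measurable_gridIndex (k : ℕ) : Measurable fun f : CadlagPath => gridIndex k f.1 :=
  Nat.measurable_ceil.comp ((measurable_arrival 1).const_mul _)

/-- The `j`th point of the grid of mesh `1 / (k + 1)`. -/
def gridTime (k j : ℕ) : ℝ≥0 := (j : ℝ≥0) / (k + 1)

/-- The path restarted at the first grid point after the first jump. -/
def gridRestart (k : ℕ) (f : CadlagPath) : CadlagPath :=
  shift (gridTime k (gridIndex k f.1)) f

theorem measurable_gridRestart (k : ℕ) : Measurable (gridRestart k) := by
  have h1 : Measurable fun p : CadlagPath × ℕ => shift (gridTime k p.2) p.1 :=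
    measurable_from_prod_countable_left fun n => measurable_shift (gridTime k n)
  exact h1.comp (f := fun f : CadlagPath => (f, gridIndex k f.1))
    (measurable_id.prodMk (measurable_gridIndex k))

/-- The first jump, rounded up to the grid, behaves like a stopping time. If it comes after the grid
point, the stopped path has index `0` by convention, whence the condition `j ≠ 0`. -/
theorem IsRegular.stop_gridIndex {f : ℝ≥0 → ℝ} (hc : IsCadlag f) (hf : IsRegular f) (k j : ℕ)
    (hj : j ≠ 0) (A : Set (ℝ≥0 × ℝ)) :
    (jumpSeq (stopPath (gridTime k j) f) 0 ∈ A ∧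
      gridIndex k (stopPath (gridTime k j) f) = j) ↔
    (jumpSeq f 0 ∈ A ∧ gridIndex k f = j) := by
  rw [jumpSeq_zero, jumpSeq_zero, gridIndex, gridIndex]
  by_cases h : 1 ≤ jumpCount f (gridTime k j)
  · rw [hf.arrival_stopPath hc h, hf.mark_stopPath hc h]
  · have h' := not_le.1 h
    rw [hf.arrival_stopPath_eq_zero hc h']
    rw [← hf.lt_arrival_iff, gridTime, div_lt_iff₀ (by positivity), mul_comm] at h'
    have h2 : j < ⌈((k : ℝ≥0) + 1) * arrival 1 f⌉₊ := Nat.lt_ceil.2 h'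
    constructor
    · rintro ⟨-, h3⟩
      simp at h3
      exact absurd h3.symm hj
    · rintro ⟨-, h3⟩
      exact absurd h3 h2.ne'

/-- Strong Markov property at a time with countably many values: on each value of the grid index the
restart happens at a deterministic time, where stopped and restarted paths are independent. -/
theorem IsLevyLaw.map_gridRestart (hμ : IsLevyLaw μ) (hreg : ∀ᵐ f ∂μ, IsRegular f.1) (k : ℕ) :
    μ.map (fun f => (jumpSeq f.1 0, jumpSeq (gridRestart k f).1)) =
      (μ.map (fun f => jumpSeq f.1 0)).prod (μ.map (fun f => jumpSeq f.1)) := by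
  have hm0 : Measurable fun f : CadlagPath => jumpSeq f.1 0 :=
    (measurable_pi_apply 0).comp measurable_jumpSeq
  have hm1 := measurable_jumpSeq
  have hm2 : Measurable fun f : CadlagPath => jumpSeq (gridRestart k f).1 :=
    measurable_jumpSeq.comp (measurable_gridRestart k)
  have := Measure.isProbabilityMeasure_map (μ := μ) hm0.aemeasurable
  have := Measure.isProbabilityMeasure_map (μ := μ) hm1.aemeasurable
  symm
  refine Measure.prod_eq fun A B hA hB => ?_
  rw [Measure.map_apply (hm0.prodMk hm2) (hA.prod hB), Measure.map_apply hm0 hA,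
    Measure.map_apply hm1 hB]
  rw [measure_eq_tsum_inter_preimage μ (measurable_gridIndex k) (hm0 hA),
    measure_eq_tsum_inter_preimage μ (measurable_gridIndex k) ((hm0.prodMk hm2) (hA.prod hB)),
    ← ENNReal.tsum_mul_right]
  refine tsum_congr fun j => ?_
  rcases eq_or_ne j 0 with rfl | hj
  -- Index `0` is negligible because the first jump time is almost surely positive.
  · have h0 : μ ((fun f : CadlagPath => gridIndex k f.1) ⁻¹' {0}) = 0 := by
      refine measure_eq_zero_iff_ae_notMem.2 ?_
      filter_upwards [hreg] with f hf h
      have h2 : ((k : ℝ≥0) + 1) * arrival 1 f.1 ≤ 0 := by simpa [gridIndex] using h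
      have h3 : (0 : ℝ≥0) < arrival 1 f.1 := by
        have := hf.arrival_strictMono Nat.zero_lt_one
        simpa [arrival_zero] using this
      exact absurd h2 (not_le.2 (by positivity))
    rw [measure_mono_null Set.inter_subset_right h0, measure_mono_null Set.inter_subset_right h0,
      zero_mul]
  · set s : ℝ≥0 := gridTime k j with hs
    have hU : MeasurableSet ((fun f : CadlagPath => jumpSeq f.1 0) ⁻¹' A ∩
        (fun f : CadlagPath => gridIndex k f.1) ⁻¹' {j}) :=
      (hm0 hA).inter (measurable_gridIndex k (measurableSet_singleton j))
    have h := hμ.measure_stop_inter_shift s hU (hm1 hB)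
    have e1 : μ (stopAt s ⁻¹' ((fun f : CadlagPath => jumpSeq f.1 0) ⁻¹' A ∩
        (fun f : CadlagPath => gridIndex k f.1) ⁻¹' {j})) =
        μ ((fun f : CadlagPath => jumpSeq f.1 0) ⁻¹' A ∩
        (fun f : CadlagPath => gridIndex k f.1) ⁻¹' {j}) := by
      refine measure_congr ?_
      filter_upwards [hreg] with f hf
      exact propext (hf.stop_gridIndex f.2 k j hj A)
    have e2 : μ (stopAt s ⁻¹' ((fun f : CadlagPath => jumpSeq f.1 0) ⁻¹' A ∩
        (fun f : CadlagPath => gridIndex k f.1) ⁻¹' {j}) ∩ shift s ⁻¹'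
          ((fun f : CadlagPath => jumpSeq f.1) ⁻¹' B)) =
        μ ((fun f => (jumpSeq f.1 0, jumpSeq (gridRestart k f).1)) ⁻¹' A ×ˢ B ∩
          (fun f : CadlagPath => gridIndex k f.1) ⁻¹' {j}) := by
      refine measure_congr ?_
      filter_upwards [hreg] with f hf
      refine propext ?_
      have h1 := hf.stop_gridIndex f.2 k j hj A
      constructor
      · rintro ⟨h2, h3⟩
        obtain ⟨h4, h5⟩ := h1.1 h2
        refine ⟨⟨h4, ?_⟩, h5⟩
        change jumpSeq (shift (gridTime k (gridIndex k f.1)) f).1 ∈ B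
        rw [h5]
        exact h3
      · rintro ⟨⟨h4, h3⟩, h5⟩
        refine ⟨h1.2 ⟨h4, h5⟩, ?_⟩
        change jumpSeq (shift (gridTime k (gridIndex k f.1)) f).1 ∈ B at h3
        rw [show gridIndex k f.1 = j from h5] at h3
        exact h3
    rw [← e1, ← e2, h]

/-- The grid times tend to the first jump from the right and eventually precede the second one. From
then on only the first waiting time of the restarted path depends on `k`, and it converges. -/
theorem IsRegular.tendsto_gridRestart {f : CadlagPath} (hf : IsRegular f.1) :
    Tendsto (fun k => jumpSeq (gridRestart k f).1) atTop (𝓝 fun n => jumpSeq f.1 (n + 1)) := by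
  set a := arrival 1 f.1 with ha
  set u : ℕ → ℝ≥0 := fun k => gridTime k (gridIndex k f.1) with hu
  have hle : ∀ k, a ≤ u k := fun k => by
    simp only [hu, gridTime, gridIndex]
    rw [le_div_iff₀ (by positivity), mul_comm]
    exact Nat.le_ceil _
  have hlim : Tendsto u atTop (𝓝 a) := by
    rw [← NNReal.tendsto_coe]
    have h1 : Tendsto (fun k : ℕ => (a : ℝ) + 1 / ((k : ℝ) + 1)) atTop (𝓝 (a + 0)) :=
      tendsto_const_nhds.add tendsto_one_div_add_atTop_nhds_zero_nat
    rw [add_zero] at h1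
    refine tendsto_of_tendsto_of_tendsto_of_le_of_le tendsto_const_nhds h1 (fun k => hle k)
      (fun k => ?_)
    simp only [hu, gridTime, gridIndex]
    push_cast
    rw [div_le_iff₀ (by positivity), add_mul (a : ℝ), one_div_mul_cancel (by positivity)]
    have := (Nat.ceil_lt_add_one (zero_le (a := ((k : ℝ≥0) + 1) * a))).le
    rw [mul_comm (a : ℝ)]
    exact_mod_cast this
  have hcount : ∀ᶠ k in atTop, jumpCount f.1 (u k) = 1 := by
    have hlt : a < arrival 2 f.1 := hf.arrival_strictMono (by norm_num : 1 < 2)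
    filter_upwards [hlim.eventually_lt_const hlt] with k hk
    exact (hf.jumpCount_eq_iff 1 (u k)).2 ⟨hle k, hk⟩
  have hmark : ∀ k, jumpCount f.1 (u k) = 1 → ∀ n,
      mark (n + 1) (gridRestart k f).1 = mark (n + 2) f.1 := fun k hk n => by
    have := hf.mark_shiftPath f.2 (u k) (Nat.succ_ne_zero n)
    rwa [hk, add_comm] at this
  have harr : ∀ k, jumpCount f.1 (u k) = 1 → ∀ n,
      u k + arrival (n + 1) (gridRestart k f).1 = arrival (n + 2) f.1 := fun k hk n => by
    have := hf.arrival_shiftPath f.2 (u k) (Nat.succ_ne_zero n)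
    rwa [hk, add_comm 1] at this
  rw [tendsto_pi_nhds]
  intro n
  cases n with
  | zero =>
    have h1 : Tendsto (fun k => (arrival 2 f.1 - u k, mark 2 f.1)) atTop
        (𝓝 (arrival 2 f.1 - a, mark 2 f.1)) :=
      (tendsto_const_nhds.sub hlim).prodMk_nhds tendsto_const_nhds
    refine h1.congr' ?_
    filter_upwards [hcount] with k hk
    rw [jumpSeq_zero, ← harr k hk 0, hmark k hk 0, add_tsub_cancel_left]
  | succ n =>
    refine tendsto_const_nhds.congr' ?_
    filter_upwards [hcount] with k hk
    rw [jumpSeq, jumpSeq, ← harr k hk (n + 1), ← harr k hk n, hmark k hk (n + 1),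
      add_tsub_add_eq_tsub_left]

/-- Tested against a bounded continuous function, the joint law of the first pair and the restarted
sequence is a product not depending on `k`; letting `k → ∞` transfers the product form to the true
tail. -/
theorem IsLevyLaw.map_jumpSeq (hμ : IsLevyLaw μ) (hreg : ∀ᵐ f ∂μ, IsRegular f.1) :
    μ.map (fun f => jumpSeq f.1) =
      Measure.infinitePi (fun _ => μ.map (fun f => jumpSeq f.1 0)) := by
  have hm0 : Measurable fun f : CadlagPath => jumpSeq f.1 0 :=
    (measurable_pi_apply 0).comp measurable_jumpSeq
  have hm1 := measurable_jumpSeq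
  have hm2 : ∀ k, Measurable fun f : CadlagPath => jumpSeq (gridRestart k f).1 := fun k =>
    measurable_jumpSeq.comp (measurable_gridRestart k)
  have hm3 : Measurable fun x : ℕ → ℝ≥0 × ℝ => (x 0, fun n => x (n + 1)) := by fun_prop
  have := Measure.isProbabilityMeasure_map (μ := μ) hm0.aemeasurable
  have := Measure.isProbabilityMeasure_map (μ := μ) hm1.aemeasurable
  have := Measure.isProbabilityMeasure_map (μ := μ) (hm3.comp hm1).aemeasurable
  refine eq_infinitePi_of_map_head_tail ?_
  rw [Measure.map_map hm3 hm1]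
  refine ext_of_forall_integral_eq_of_IsFiniteMeasure fun φ => ?_
  rw [integral_map (hm3.comp hm1).aemeasurable φ.continuous.aestronglyMeasurable]
  have hlim : Tendsto (fun k => ∫ f, φ (jumpSeq f.1 0, jumpSeq (gridRestart k f).1) ∂μ) atTop
      (𝓝 (∫ f, φ (((fun x : ℕ → ℝ≥0 × ℝ => (x 0, fun n => x (n + 1))) ∘
        fun f : CadlagPath => jumpSeq f.1) f) ∂μ)) := by
    refine tendsto_integral_of_dominated_convergence (fun _ => ‖φ‖) (fun k => ?_)
      (integrable_const _) (fun k => ae_of_all _ fun f => φ.norm_coe_le_norm _) ?_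
    · exact (φ.continuous.measurable.comp (hm0.prodMk (hm2 k))).aestronglyMeasurable
    · filter_upwards [hreg] with f hf
      exact (φ.continuous.tendsto _).comp (tendsto_const_nhds.prodMk_nhds hf.tendsto_gridRestart)
  refine tendsto_nhds_unique hlim (tendsto_const_nhds.congr fun k => ?_)
  rw [← hμ.map_gridRestart hreg k, integral_map (hm0.prodMk (hm2 k)).aemeasurable
    φ.continuous.aestronglyMeasurable]

theorem indepFun_prodMk_of_indepFun {Ω E F G : Type*} [MeasurableSpace Ω] [MeasurableSpace E]
    [MeasurableSpace F] [MeasurableSpace G] {P : Measure Ω} [IsProbabilityMeasure P]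
    {X : Ω → E} {Y : Ω → F} {W : Ω → G} (hX : Measurable X) (hY : Measurable Y) (hW : Measurable W)
    (h1 : IndepFun X (fun ω => (Y ω, W ω)) P) (h2 : IndepFun Y W P) :
    IndepFun (fun ω => (X ω, Y ω)) W P := by
  have h3 : IndepFun X Y P := h1.comp (φ := id) measurable_id measurable_fst
  rw [indepFun_iff_map_prod_eq_prod_map_map hX.aemeasurable (hY.prodMk hW).aemeasurable] at h1
  rw [indepFun_iff_map_prod_eq_prod_map_map hY.aemeasurable hW.aemeasurable] at h2
  rw [indepFun_iff_map_prod_eq_prod_map_map hX.aemeasurable hY.aemeasurable] at h3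
  rw [indepFun_iff_map_prod_eq_prod_map_map (hX.prodMk hY).aemeasurable hW.aemeasurable, h3]
  have := Measure.isProbabilityMeasure_map (μ := P) hX.aemeasurable
  have := Measure.isProbabilityMeasure_map (μ := P) hY.aemeasurable
  have := Measure.isProbabilityMeasure_map (μ := P) hW.aemeasurable
  rw [h2, ← Measure.prodAssoc_prod] at h1
  have h4 := congrArg (Measure.map MeasurableEquiv.prodAssoc.symm) h1
  rw [Measure.map_map (by fun_prop) (by fun_prop), Measure.map_map (by fun_prop) (by fun_prop)] at h4
  simp only [Function.comp_def, MeasurableEquiv.symm_apply_apply, Measure.map_id'] at h4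
  exact h4

/-! ### Independence of jump times and jump sizes; the expected number of jumps of given size -/

open CadlagPath

variable {μ : Measure CadlagPath} [IsProbabilityMeasure μ]

theorem IsRegular.jumpNum_eq_zero_iff {f : ℝ≥0 → ℝ} (hf : IsRegular f) (s : ℝ≥0) :
    jumpNum f s = 0 ↔ s < arrival 1 f := by
  rw [hf.finite.jumpNum_eq, hf.lt_arrival_iff, Nat.cast_eq_zero]
  omega

omit [IsProbabilityMeasure μ] in
theorem survival_eq (hreg : ∀ᵐ f ∂μ, IsRegular f.1) (s : ℝ≥0) :
    survival μ s = μ {f | s < arrival 1 f.1} := by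
  refine measure_congr ?_
  filter_upwards [hreg] with f hf
  exact propext (hf.jumpNum_eq_zero_iff s)

/-- On the event of no jump up to `s` the first jump size is that of the path restarted at `s`,
which is independent of this event and has the original law. Such events generate the σ-algebra of
the first jump time. -/
theorem IsLevyLaw.indepFun_arrival_mark (hμ : IsLevyLaw μ) (hreg : ∀ᵐ f ∂μ, IsRegular f.1) :
    IndepFun (fun f : CadlagPath => arrival 1 f.1) (fun f => mark 1 f.1) μ := by
  have hma := measurable_arrival 1
  have hmm := measurable_mark 1
  rw [IndepFun_iff_Indep]
  refine IndepSets.indep (p1 := {U | ∃ s, U = {f : CadlagPath | s < arrival 1 f.1}})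
    (p2 := {V | ∃ A, MeasurableSet A ∧ (fun f : CadlagPath => mark 1 f.1) ⁻¹' A = V})
    hma.comap_le hmm.comap_le ?_ ?_ ?_ ?_ ?_
  · rintro _ ⟨s, rfl⟩ _ ⟨t, rfl⟩ -
    exact ⟨max s t, by ext f; simp⟩
  · rintro _ ⟨A, hA, rfl⟩ _ ⟨B, hB, rfl⟩ -
    exact ⟨A ∩ B, hA.inter hB, rfl⟩
  · rw [BorelSpace.measurable_eq (α := ℝ≥0), borel_eq_generateFrom_Ioi,
      MeasurableSpace.comap_generateFrom]
    congr 1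
    ext U
    constructor
    · rintro ⟨_, ⟨s, rfl⟩, rfl⟩
      exact ⟨s, rfl⟩
    · rintro ⟨s, rfl⟩
      exact ⟨_, ⟨s, rfl⟩, rfl⟩
  · exact (@MeasurableSpace.generateFrom_measurableSet _ (MeasurableSpace.comap
      (fun f : CadlagPath => mark 1 f.1) inferInstance)).symm
  · rw [IndepSets_iff]
    rintro _ _ ⟨s, rfl⟩ ⟨A, hA, rfl⟩
    have h := hμ.measure_stop_inter_shift s (measurableSet_jumpNum_eq_zero s) (hmm hA)
    have h1 : stopAt s ⁻¹' {f : CadlagPath | jumpNum f.1 s = 0} =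
        {f : CadlagPath | jumpNum f.1 s = 0} := by
      ext f
      simp only [Set.mem_preimage, Set.mem_ofPred_eq, stopAt, f.2.jumpNum_stopPath, min_self]
    rw [h1] at h
    rw [← survival_eq hreg, survival, ← h]
    refine measure_congr ?_
    filter_upwards [hreg] with f hf
    refine propext ?_
    change (s < arrival 1 f.1 ∧ mark 1 f.1 ∈ A) ↔
      (jumpNum f.1 s = 0 ∧ mark 1 (shiftPath s f.1) ∈ A)
    rw [← hf.jumpNum_eq_zero_iff s]
    refine and_congr_right fun h0 => ?_
    have h2 := hf.mark_shiftPath f.2 s one_ne_zero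
    rw [hf.finite.jumpNum_eq, Nat.cast_eq_zero] at h0
    rw [h0, zero_add] at h2
    rw [h2]

theorem IsLevyLaw.iIndepFun_jumpSeq (hμ : IsLevyLaw μ) (hreg : ∀ᵐ f ∂μ, IsRegular f.1) :
    iIndepFun (fun n (f : CadlagPath) => jumpSeq f.1 n) μ := by
  have hm : ∀ n, Measurable fun f : CadlagPath => jumpSeq f.1 n := fun n =>
    (measurable_pi_apply n).comp measurable_jumpSeq
  have := Measure.isProbabilityMeasure_map (μ := μ) (hm 0).aemeasurable
  rw [iIndepFun_iff_map_fun_eq_infinitePi_map hm]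
  have h := hμ.map_jumpSeq hreg
  have h2 : ∀ n, μ.map (fun f : CadlagPath => jumpSeq f.1 n) =
      μ.map (fun f : CadlagPath => jumpSeq f.1 0) := fun n => by
    rw [← Measure.infinitePi_map_eval (fun _ : ℕ => μ.map (fun f : CadlagPath => jumpSeq f.1 0)) n,
      ← h, Measure.map_map (measurable_pi_apply n) measurable_jumpSeq]
    rfl
  simp_rw [h2]
  exact h

theorem IsLevyLaw.identDistrib_jumpSeq (hμ : IsLevyLaw μ) (hreg : ∀ᵐ f ∂μ, IsRegular f.1) (n : ℕ) :
    IdentDistrib (fun f : CadlagPath => jumpSeq f.1 n) (fun f => jumpSeq f.1 0) μ μ := by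
  have hm : ∀ n, Measurable fun f : CadlagPath => jumpSeq f.1 n := fun n =>
    (measurable_pi_apply n).comp measurable_jumpSeq
  have := Measure.isProbabilityMeasure_map (μ := μ) (hm 0).aemeasurable
  refine ⟨(hm n).aemeasurable, (hm 0).aemeasurable, ?_⟩
  rw [← Measure.infinitePi_map_eval (fun _ : ℕ => μ.map (fun f : CadlagPath => jumpSeq f.1 0)) n,
    ← hμ.map_jumpSeq hreg, Measure.map_map (measurable_pi_apply n) measurable_jumpSeq]
  rfl

theorem IsRegular.sum_waits {f : ℝ≥0 → ℝ} (hf : IsRegular f) (n : ℕ) :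
    ∑ i ∈ Finset.range n, (jumpSeq f i).1 = arrival n f := by
  induction n with
  | zero => simp [arrival_zero]
  | succ n ih =>
    rw [Finset.sum_range_succ, ih, jumpSeq]
    exact add_tsub_cancel_of_le (hf.arrival_strictMono (Nat.lt_succ_self n)).le

/-- The size of a jump is independent of the time at which it occurs. -/
theorem IsLevyLaw.indepFun_arrival_mark_succ (hμ : IsLevyLaw μ) (hreg : ∀ᵐ f ∂μ, IsRegular f.1)
    (n : ℕ) : IndepFun (fun f : CadlagPath => arrival (n + 1) f.1) (fun f => mark (n + 1) f.1) μ := by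
  have hm : ∀ n, Measurable fun f : CadlagPath => jumpSeq f.1 n := fun n =>
    (measurable_pi_apply n).comp measurable_jumpSeq
  -- The earlier waiting times are independent of the last pair, and within that pair the entries
  -- are independent; together they yield the independence of their sum from the last jump size.
  have h1 : IndepFun (fun f : CadlagPath => ∑ i ∈ Finset.range n, (jumpSeq f.1 i).1)
      (fun f => ((jumpSeq f.1 n).1, (jumpSeq f.1 n).2)) μ := by
    have h := (hμ.iIndepFun_jumpSeq hreg).indepFun_finset (Finset.range n) {n} (by simp) hm
    have hφ : Measurable fun x : Finset.range n → ℝ≥0 × ℝ => ∑ i, (x i).1 := by fun_prop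
    have hψ : Measurable fun x : ({n} : Finset ℕ) → ℝ≥0 × ℝ =>
        x ⟨n, Finset.mem_singleton_self n⟩ := measurable_pi_apply _
    have h' := h.comp hφ hψ
    refine h'.congr (ae_of_all _ fun f => ?_) (ae_of_all _ fun f => rfl)
    simp only [Function.comp]
    exact Finset.sum_coe_sort (Finset.range n) (fun i => (jumpSeq f.1 i).1)
  have h2 : IndepFun (fun f : CadlagPath => (jumpSeq f.1 n).1) (fun f => (jumpSeq f.1 n).2) μ := by
    refine indepFun_of_identDistrib_pair (hμ.indepFun_arrival_mark hreg) ?_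
    have h3 := (hμ.identDistrib_jumpSeq hreg n).symm
    simp only [jumpSeq_zero] at h3
    exact h3
  have h3 := indepFun_prodMk_of_indepFun (Finset.measurable_sum _ fun i _ => (hm i).fst)
    (hm n).fst (hm n).snd h1 h2
  refine (h3.comp (measurable_fst.add measurable_snd) measurable_id).congr ?_
    (ae_of_all _ fun f => rfl)
  filter_upwards [hreg] with f hf
  rw [← hf.sum_waits (n + 1), Finset.sum_range_succ]
  rfl

theorem IsRegular.encard_jumps_eq {f : ℝ≥0 → ℝ} (hf : IsRegular f) (A : Set ℝ) (hA : (0 : ℝ) ∉ A) :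
    (({s ∈ Set.Ioc (0 : ℝ≥0) 1 | jump f s ∈ A}.encard : ℕ∞) : ℝ≥0∞) =
      ∑' n, Set.indicator {n : ℕ | arrival (n + 1) f ≤ 1 ∧ mark (n + 1) f ∈ A} 1 n := by
  have : {s ∈ Set.Ioc (0 : ℝ≥0) 1 | jump f s ∈ A} =
      (fun n => arrival (n + 1) f) '' {n : ℕ | arrival (n + 1) f ≤ 1 ∧ mark (n + 1) f ∈ A} := by
    ext s
    constructor
    · rintro ⟨hs, hsA⟩
      have hj : jump f s ≠ 0 := fun h => hA (h ▸ hsA)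
      have hs' : s ∈ jumpSet f 1 := ⟨hs.1, hs.2, hj⟩
      rw [hf.jumpSet_eq] at hs'
      obtain ⟨n, hn, rfl⟩ := hs'
      obtain ⟨n, rfl⟩ := Nat.exists_eq_succ_of_ne_zero (Nat.one_le_iff_ne_zero.1 hn.1)
      exact ⟨n, ⟨hs.2, hsA⟩, rfl⟩
    · rintro ⟨n, ⟨h1, h2⟩, rfl⟩
      exact ⟨⟨pos_of_jump_ne_zero (hf.mark_ne_zero n.succ_ne_zero), h1⟩, h2⟩
  have hinj : Function.Injective fun n => arrival (n + 1) f := fun a b hab =>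
    Nat.succ_injective (hf.arrival_strictMono.injective hab)
  rw [this, hinj.encard_image, ← tsum_subtype]
  simp

/-- By independence of time and size, the expected count factors into `∑ P(Γ_{n+1} ≤ 1)` and the law
of a jump. The choice `A = {0}ᶜ` identifies the series with the jump rate. -/
theorem IsLevyLaw.lintegral_jumps (hμ : IsLevyLaw μ) (hreg : ∀ᵐ f ∂μ, IsRegular f.1)
    {A : Set ℝ} (hAm : MeasurableSet A) (hA : (0 : ℝ) ∉ A) :
    ∫⁻ f, (({s ∈ Set.Ioc (0 : ℝ≥0) 1 | jump f.1 s ∈ A}.encard : ℕ∞) : ℝ≥0∞) ∂μ =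
      jumpRate μ * μ.map (fun f => mark 1 f.1) A := by
  have key : ∀ B : Set ℝ, MeasurableSet B → (0 : ℝ) ∉ B →
      ∫⁻ f, (({s ∈ Set.Ioc (0 : ℝ≥0) 1 | jump f.1 s ∈ B}.encard : ℕ∞) : ℝ≥0∞) ∂μ =
        (∑' n : ℕ, μ {f | arrival (n + 1) f.1 ≤ 1}) * μ.map (fun f => mark 1 f.1) B := by
    intro B hBm hB
    rw [lintegral_congr_ae (g := fun f : CadlagPath => ∑' n,
      Set.indicator {f : CadlagPath | arrival (n + 1) f.1 ≤ 1 ∧ mark (n + 1) f.1 ∈ B} 1 f)]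
    · have hms : ∀ n, MeasurableSet
          {f : CadlagPath | arrival (n + 1) f.1 ≤ 1 ∧ mark (n + 1) f.1 ∈ B} := fun n =>
        (measurable_arrival (n + 1) measurableSet_Iic).inter (measurable_mark (n + 1) hBm)
      rw [lintegral_tsum fun n => (measurable_one.indicator (hms n)).aemeasurable,
        ← ENNReal.tsum_mul_right]
      refine tsum_congr fun n => ?_
      rw [lintegral_indicator_one (hms n)]
      have h1 := indepFun_iff_measure_inter_preimage_eq_mul.1
        (hμ.indepFun_arrival_mark_succ hreg n) (Set.Iic 1) B measurableSet_Iic hBm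
      have h2 : μ ((fun f : CadlagPath => mark (n + 1) f.1) ⁻¹' B) =
          μ.map (fun f : CadlagPath => mark 1 f.1) B := by
        have h3 := ((hμ.identDistrib_jumpSeq hreg n).comp measurable_snd).map_eq
        rw [← Measure.map_apply (measurable_mark (n + 1)) hBm]
        simpa [Function.comp_def, jumpSeq] using congrArg (fun ρ => ρ B) h3
      rw [← h2]
      exact h1
    · filter_upwards [hreg] with f hf
      rw [hf.encard_jumps_eq B hB]
      rfl
  have h0 : μ.map (fun f : CadlagPath => mark 1 f.1) {0}ᶜ = 1 := by
    have := Measure.isProbabilityMeasure_map (μ := μ) (measurable_mark 1).aemeasurable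
    rw [prob_compl_eq_one_iff (measurableSet_singleton 0),
      Measure.map_apply (measurable_mark 1) (measurableSet_singleton 0)]
    refine measure_eq_zero_iff_ae_notMem.2 ?_
    filter_upwards [hreg] with f hf
    exact hf.mark_ne_zero one_ne_zero
  have hr := key {0}ᶜ (measurableSet_singleton 0).compl (by simp)
  rw [h0, mul_one] at hr
  rw [key A hAm hA, ← hr, jumpRate]
  congr 1
  refine lintegral_congr fun f => ?_
  have : {s ∈ Set.Ioc (0 : ℝ≥0) 1 | jump f.1 s ∈ ({0}ᶜ : Set ℝ)} = jumpSet f.1 1 := by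
    ext s
    simp [jumpSet, and_assoc]
  rw [this, jumpNum]

/-! ### Jump rate and mean waiting time -/

open CadlagPath

variable {μ : Measure CadlagPath} [IsProbabilityMeasure μ]

/-- The expected number of jumps in `(0, t]`. -/
def meanCount (μ : Measure CadlagPath) (t : ℝ≥0) : ℝ≥0∞ :=
  ∫⁻ f, ((jumpNum f.1 t : ℕ∞) : ℝ≥0∞) ∂μ

omit [IsProbabilityMeasure μ] in
theorem IsLevyLaw.meanCount_add (hμ : IsLevyLaw μ) (s t : ℝ≥0) :
    meanCount μ (s + t) = meanCount μ s + meanCount μ t := by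
  have h1 : ∀ f : CadlagPath, ((jumpNum f.1 (s + t) : ℕ∞) : ℝ≥0∞) =
      ((jumpNum f.1 s : ℕ∞) : ℝ≥0∞) + ((jumpNum (shift s f).1 t : ℕ∞) : ℝ≥0∞) := fun f => by
    rw [f.2.jumpNum_add, ENat.toENNReal_add]
    rfl
  simp only [meanCount, h1]
  rw [lintegral_add_left (measurable_jumpNum_ennreal s),
    (hμ.measurePreserving s).lintegral_comp (measurable_jumpNum_ennreal t)]

omit [IsProbabilityMeasure μ] in
theorem IsLevyLaw.meanCount_nat_mul (hμ : IsLevyLaw μ) (n : ℕ) (t : ℝ≥0) :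
    meanCount μ (n * t) = n * meanCount μ t := by
  induction n with
  | zero => simp [meanCount, jumpNum_zero]
  | succ n ih => rw [Nat.cast_succ, add_one_mul, hμ.meanCount_add, ih, Nat.cast_succ, add_one_mul]

/-- Markov's inequality: the probability of at least one jump is at most the expected number of
jumps. -/
theorem one_le_survival_add (t : ℝ≥0) : 1 ≤ survival μ t + meanCount μ t := by
  have hm := measurableSet_jumpNum_eq_zero t
  rw [← measure_univ (μ := μ), ← measure_add_measure_compl hm, survival, meanCount]
  gcongr
  rw [← lintegral_indicator_one hm.compl]
  refine lintegral_mono fun f => ?_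
  by_cases h : jumpNum f.1 t = 0
  · simp [h]
  · rw [Set.indicator_of_mem (by exact h), Pi.one_apply]
    have : (1 : ℕ∞) ≤ jumpNum f.1 t := Order.one_le_iff_pos.2 (pos_iff_ne_zero.2 h)
    calc (1 : ℝ≥0∞) = ((1 : ℕ∞) : ℝ≥0∞) := by simp
      _ ≤ _ := ENat.toENNReal_le.2 this

omit [IsProbabilityMeasure μ] in
theorem IsLevyLaw.meanCount_inv (hμ : IsLevyLaw μ) (k : ℕ) :
    ((k + 1 : ℕ) : ℝ≥0∞) * meanCount μ (1 / ((k : ℝ≥0) + 1)) = jumpRate μ := by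
  rw [← hμ.meanCount_nat_mul]
  have : ((k + 1 : ℕ) : ℝ≥0) * (1 / ((k : ℝ≥0) + 1)) = 1 := by
    push_cast
    field_simp
  rw [this]
  rfl

omit [IsProbabilityMeasure μ] in
theorem IsLevyLaw.tendsto_meanCount (hμ : IsLevyLaw μ) (hr' : jumpRate μ ≠ ⊤) :
    Tendsto (fun k : ℕ => meanCount μ (1 / ((k : ℝ≥0) + 1))) atTop (𝓝 0) := by
  have h : ∀ k : ℕ, meanCount μ (1 / ((k : ℝ≥0) + 1)) = jumpRate μ * ((k + 1 : ℕ) : ℝ≥0∞)⁻¹ := by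
    intro k
    rw [← hμ.meanCount_inv k, mul_comm, ← mul_assoc, ENNReal.inv_mul_cancel (by simp) (by simp),
      one_mul]
  simp_rw [h]
  have h2 := (tendsto_add_atTop_iff_nat 1).2 ENNReal.tendsto_inv_nat_nhds_zero
  have h3 := ENNReal.Tendsto.const_mul h2 (Or.inr hr')
  rwa [mul_zero] at h3

/-- The expected waiting time for the first jump. -/
def meanWait (μ : Measure CadlagPath) : ℝ≥0∞ := ∫⁻ f, ((arrival 1 f.1 : ℝ≥0) : ℝ≥0∞) ∂μ

/-- The tail of the waiting time at integers is geometric, so its mean is bounded by a geometric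
series. -/
theorem IsLevyLaw.meanWait_ne_top (hμ : IsLevyLaw μ) (hreg : ∀ᵐ f ∂μ, IsRegular f.1)
    (hr : jumpRate μ ≠ 0) : meanWait μ ≠ ⊤ := by
  have hle : meanWait μ ≤ ∑' j : ℕ, survival μ 1 ^ j := by
    simp_rw [← hμ.survival_nat, survival_eq hreg]
    have hms : ∀ j : ℕ, MeasurableSet {f : CadlagPath | (j : ℝ≥0) < arrival 1 f.1} := fun j =>
      measurable_arrival 1 measurableSet_Ioi
    simp_rw [← lintegral_indicator_one (hms _)]
    rw [← lintegral_tsum fun n => (measurable_one.indicator (hms n)).aemeasurable]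
    refine lintegral_mono fun f => ?_
    calc ((arrival 1 f.1 : ℝ≥0) : ℝ≥0∞) ≤ (⌈arrival 1 f.1⌉₊ : ℝ≥0∞) := by
          exact_mod_cast Nat.le_ceil _
      _ = ∑ j ∈ Finset.range ⌈arrival 1 f.1⌉₊,
            Set.indicator {f : CadlagPath | (j : ℝ≥0) < arrival 1 f.1} 1 f := by
          rw [Finset.sum_congr rfl (g := fun _ => (1 : ℝ≥0∞))]
          · simp
          · intro j hj
            rw [Set.indicator_of_mem]
            · rfl
            · exact Nat.lt_ceil.1 (Finset.mem_range.1 hj)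
      _ ≤ _ := ENNReal.sum_le_tsum _
  refine ne_top_of_le_ne_top ?_ hle
  rw [ENNReal.tsum_geometric]
  exact ENNReal.inv_ne_top.2 (tsub_pos_of_lt (survival_one_lt_one hr)).ne'

-- Decompose `T = min(T, s) + 1_{T > s} T'`, where `T'` is the first waiting time of the path
-- restarted at `s`, independent of the event `T > s`.
omit [IsProbabilityMeasure μ] in
theorem IsLevyLaw.meanWait_eq (hμ : IsLevyLaw μ) (hreg : ∀ᵐ f ∂μ, IsRegular f.1) (s : ℝ≥0) :
    meanWait μ = ∫⁻ f, ((min (arrival 1 f.1) s : ℝ≥0) : ℝ≥0∞) ∂μ + survival μ s * meanWait μ := by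
  have hma := measurable_arrival 1
  have hms := measurableSet_jumpNum_eq_zero s
  have h0 : meanWait μ = ∫⁻ f, (((min (arrival 1 f.1) s : ℝ≥0) : ℝ≥0∞) +
      (Set.indicator {f : CadlagPath | jumpNum f.1 s = 0} (1 : CadlagPath → ℝ≥0∞) (stopAt s f)) *
        ((arrival 1 (shift s f).1 : ℝ≥0) : ℝ≥0∞)) ∂μ := by
    refine lintegral_congr_ae ?_
    filter_upwards [hreg] with f hf
    by_cases h : jumpNum f.1 s = 0
    · rw [Set.indicator_of_mem (by simpa [stopAt, f.2.jumpNum_stopPath] using h)]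
      have h1 := hf.arrival_shiftPath f.2 s one_ne_zero
      have h2 := h
      rw [hf.finite.jumpNum_eq, Nat.cast_eq_zero] at h2
      rw [h2, zero_add] at h1
      rw [min_eq_right ((hf.jumpNum_eq_zero_iff s).1 h).le, Pi.one_apply, one_mul, ← h1,
        ENNReal.coe_add]
      rfl
    · rw [Set.indicator_of_notMem (by simpa [stopAt, f.2.jumpNum_stopPath] using h), zero_mul,
        add_zero, min_eq_left]
      exact not_lt.1 fun h' => h ((hf.jumpNum_eq_zero_iff s).2 h')
  have hmw : Measurable fun f : CadlagPath => ((arrival 1 f.1 : ℝ≥0) : ℝ≥0∞) := hma.coe_nnreal_ennreal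
  have hms1 : Measurable (Set.indicator {f : CadlagPath | jumpNum f.1 s = 0}
      (1 : CadlagPath → ℝ≥0∞)) := measurable_one.indicator hms
  rw [lintegral_add_left (hma.min measurable_const).coe_nnreal_ennreal] at h0
  have h1 := lintegral_mul_eq_lintegral_mul_lintegral_of_indepFun''
    (hms1.comp (measurable_stopAt s)).aemeasurable (hmw.comp (measurable_shift s)).aemeasurable
    ((hμ.indep s).comp hms1 hmw)
  simp only [Function.comp] at h1
  rw [h1, (hμ.measurePreserving s).lintegral_comp hmw] at h0
  have h2 : ∫⁻ f, (Set.indicator {f : CadlagPath | jumpNum f.1 s = 0}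
      (1 : CadlagPath → ℝ≥0∞) (stopAt s f)) ∂μ = survival μ s := by
    rw [survival, ← lintegral_indicator_one hms]
    refine lintegral_congr fun f => ?_
    refine Set.indicator_eq_indicator ?_ rfl
    simp [stopAt, f.2.jumpNum_stopPath]
  rw [h2] at h0
  exact h0

/-- The mean waiting time is at least the inverse of the jump rate. -/
theorem IsLevyLaw.one_le_jumpRate_mul_meanWait (hμ : IsLevyLaw μ)
    (hreg : ∀ᵐ f ∂μ, IsRegular f.1) (hr : jumpRate μ ≠ 0) (hr' : jumpRate μ ≠ ⊤) :
    1 ≤ jumpRate μ * meanWait μ := by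
  have hE := hμ.meanWait_ne_top hreg hr
  -- For `δ = 1 / (k + 1)`, `E min(T, δ) = (1 - P(T > δ)) E T ≤ E N(δ) · E T`, while `E min(T, δ) ≥
  -- δ P(T > δ)`. Multiplication by `k + 1` gives `P(T > δ) ≤ r E T`, and `P(T > δ) ≥ 1 - E N(δ)`,
  -- where `E N(δ)` vanishes in the limit.
  have key : ∀ k : ℕ, 1 ≤ jumpRate μ * meanWait μ + meanCount μ (1 / ((k : ℝ≥0) + 1)) := by
    intro k
    set δ : ℝ≥0 := 1 / ((k : ℝ≥0) + 1) with hδ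
    have h1 := hμ.meanWait_eq hreg δ
    set a := ∫⁻ f, ((min (arrival 1 f.1) δ : ℝ≥0) : ℝ≥0∞) ∂μ with ha
    have hg : survival μ δ ≤ 1 := prob_le_one
    have h2 : a ≤ meanCount μ δ * meanWait μ := by
      have hfin : survival μ δ * meanWait μ ≠ ⊤ :=
        ENNReal.mul_ne_top (ne_top_of_le_ne_top ENNReal.one_ne_top hg) hE
      have h3 : meanWait μ - survival μ δ * meanWait μ = a :=
        ENNReal.sub_eq_of_eq_add hfin h1
      rw [← h3]
      nth_rewrite 1 [← one_mul (meanWait μ)]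
      rw [← ENNReal.sub_mul fun _ _ => hE]
      gcongr
      exact tsub_le_iff_left.2 (one_le_survival_add δ)
    have h4 : (δ : ℝ≥0∞) * survival μ δ ≤ a := by
      have hms : MeasurableSet {f : CadlagPath | δ < arrival 1 f.1} :=
        measurable_arrival 1 measurableSet_Ioi
      rw [survival_eq hreg, ← lintegral_indicator_one hms,
        ← lintegral_const_mul _ (measurable_one.indicator hms)]
      refine lintegral_mono fun f => ?_
      by_cases h : δ < arrival 1 f.1
      · rw [min_eq_right h.le]
        simp [h]
      · simp [h]
    have h5 : survival μ δ ≤ jumpRate μ * meanWait μ := by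
      rw [← hμ.meanCount_inv k, mul_assoc]
      calc survival μ δ = ((k + 1 : ℕ) : ℝ≥0∞) * (δ * survival μ δ) := by
            rw [← mul_assoc]
            have : ((k + 1 : ℕ) : ℝ≥0∞) * (δ : ℝ≥0∞) = 1 := by
              have h6 : ((k + 1 : ℕ) : ℝ≥0) * δ = 1 := by
                rw [hδ]
                push_cast
                field_simp
              exact_mod_cast h6
            rw [this, one_mul]
        _ ≤ _ := mul_le_mul_right (h4.trans h2) _
    exact (one_le_survival_add δ).trans (by gcongr)
  have hlim := (tendsto_const_nhds (x := jumpRate μ * meanWait μ)).add (hμ.tendsto_meanCount hr')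
  rw [add_zero] at hlim
  exact ge_of_tendsto' hlim key

/-! ### The time elapsed since the last jump -/

/-- The time elapsed at time `t` since the last jump. -/
def age (t : ℝ≥0) (f : ℝ≥0 → ℝ) : ℝ≥0 := t - arrival (jumpCount f t) f

theorem measurable_arrival_nat : Measurable fun p : CadlagPath × ℕ => arrival p.2 p.1.1 :=
  measurable_from_prod_countable_left fun n => measurable_arrival n

theorem measurable_age (t : ℝ≥0) : Measurable fun f : CadlagPath => age t f.1 :=
  measurable_const.sub (measurable_arrival_nat.comp (f := fun f : CadlagPath => (f, jumpCount f.1 t))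
    (measurable_id.prodMk (measurable_jumpCount t)))

theorem IsRegular.le_age_iff {f : ℝ≥0 → ℝ} (hc : IsCadlag f) (hf : IsRegular f) {x t : ℝ≥0}
    (hx : x ≤ t) : x ≤ age t f ↔ jumpNum (Cogarch.shiftPath (t - x) f) x = 0 := by
  have ha : arrival (jumpCount f t) f ≤ t := (hf.arrival_le_iff _ _).2 le_rfl
  rw [age, le_tsub_iff_left ha, ← le_tsub_iff_right hx, hf.arrival_le_iff,
    (hf.shiftPath hc _).finite.jumpNum_eq, Nat.cast_eq_zero]
  have := hf.jumpCount_add hc (t - x) x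
  rw [tsub_add_cancel_of_le hx] at this
  omega

/-- The first jump time has no positive atom: `P(T ≥ x) ≤ P(T > x - δ) ≤ P(T > x) + E N(δ)`, and the
last term tends to `0`. -/
theorem IsLevyLaw.measure_le_arrival (hμ : IsLevyLaw μ) (hreg : ∀ᵐ f ∂μ, IsRegular f.1)
    (hr' : jumpRate μ ≠ ⊤) (x : ℝ≥0) : μ {f | x ≤ arrival 1 f.1} = survival μ x := by
  rcases eq_or_ne x 0 with rfl | hx
  · simp [survival, jumpNum_zero]
  refine le_antisymm ?_ ?_
  · have hlim := (tendsto_const_nhds (x := survival μ x)).add (hμ.tendsto_meanCount hr')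
    rw [add_zero] at hlim
    refine ge_of_tendsto hlim ?_
    have h1 : Tendsto (fun k : ℕ => 1 / ((k : ℝ≥0) + 1)) atTop (𝓝 0) :=
      tendsto_one_div_add_atTop_nhds_zero_nat
    filter_upwards [h1.eventually_lt_const (pos_iff_ne_zero.2 hx)] with k hk
    set δ := 1 / ((k : ℝ≥0) + 1) with hδ
    calc μ {f | x ≤ arrival 1 f.1} ≤ survival μ (x - δ) := by
          rw [survival_eq hreg]
          refine measure_mono fun f (hf : x ≤ _) => ?_
          exact (tsub_lt_self (pos_iff_ne_zero.2 hx) (by positivity)).trans_le hf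
      _ ≤ survival μ (x - δ) * (survival μ δ + meanCount μ δ) :=
          le_mul_of_one_le_right' (one_le_survival_add δ)
      _ = survival μ x + survival μ (x - δ) * meanCount μ δ := by
          rw [mul_add, ← hμ.survival_add, tsub_add_cancel_of_le hk.le]
      _ ≤ survival μ x + meanCount μ δ := by
          gcongr
          exact mul_le_of_le_one_left' prob_le_one
  · rw [survival_eq hreg]
    exact measure_mono fun f (hf : x < _) => hf.le

/-- For `x ≤ t`, the elapsed time is at least `x` exactly when there is no jump in `(t - x, t]`. By
stationarity this has the probability of no jump in `(0, x]`. For `x > t` both events are empty. -/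
theorem IsLevyLaw.map_age (hμ : IsLevyLaw μ) (hreg : ∀ᵐ f ∂μ, IsRegular f.1)
    (hr' : jumpRate μ ≠ ⊤) (t : ℝ≥0) :
    μ.map (fun f => age t f.1) = μ.map (fun f => min (arrival 1 f.1) t) := by
  have hm2 : Measurable fun f : CadlagPath => min (arrival 1 f.1) t :=
    (measurable_arrival 1).min measurable_const
  have := Measure.isProbabilityMeasure_map (μ := μ) (measurable_age t).aemeasurable
  refine Measure.ext_of_Ici _ _ fun x => ?_
  rw [Measure.map_apply (measurable_age t) measurableSet_Ici, Measure.map_apply hm2 measurableSet_Ici]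
  by_cases hx : x ≤ t
  · have e1 : μ ((fun f : CadlagPath => age t f.1) ⁻¹' Set.Ici x) = survival μ x := by
      rw [survival, ← (hμ.measurePreserving (t - x)).measure_preimage
        (measurableSet_jumpNum_eq_zero x).nullMeasurableSet]
      refine measure_congr ?_
      filter_upwards [hreg] with f hf
      exact propext (hf.le_age_iff f.2 hx)
    rw [e1, ← hμ.measure_le_arrival hreg hr' x]
    congr 1
    ext f
    simp [hx]
  · congr 1
    ext f
    simp only [Set.mem_preimage, Set.mem_Ici, le_min_iff, hx, and_false, iff_false]
    exact fun h => hx (h.trans tsub_le_self)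

/-- With a jump in `(u, t]`, the last jump before `t` is already visible to the path restarted at
`u`. This makes the elapsed time a function of the path after `u` only. -/
theorem IsRegular.age_shiftPath {f : ℝ≥0 → ℝ} (hc : IsCadlag f) (hf : IsRegular f) {u t : ℝ≥0}
    (hut : u ≤ t) (h : jumpCount f u < jumpCount f t) :
    age (t - u) (Cogarch.shiftPath u f) = age t f := by
  have h1 := hf.jumpCount_add hc u (t - u)
  rw [add_tsub_cancel_of_le hut] at h1
  have h2 := hf.arrival_shiftPath hc u (n := jumpCount (Cogarch.shiftPath u f) (t - u)) (by omega)
  rw [← h1] at h2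
  rw [age, age, ← h2, tsub_tsub]

/-! ### The matrix exponential -/

section MatrixExp

open scoped Matrix.Norms.Operator

variable {q : ℕ}

theorem continuous_exp_smul (B : Matrix (Fin q) (Fin q) ℝ) :
    Continuous fun s : ℝ => NormedSpace.exp (s • B) :=
  continuous_iff_continuousAt.2 fun s => (hasDerivAt_exp_smul_const B s).continuousAt

theorem hasDerivAt_exp_mulVec (B : Matrix (Fin q) (Fin q) ℝ) (v : Fin q → ℝ) (s : ℝ) :
    HasDerivAt (fun s : ℝ => NormedSpace.exp (s • B) *ᵥ v)
      (B *ᵥ (NormedSpace.exp (s • B) *ᵥ v)) s := by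
  let ev : Matrix (Fin q) (Fin q) ℝ →ₗ[ℝ] (Fin q → ℝ) :=
    { toFun := fun M => M *ᵥ v
      map_add' := fun M M' => Matrix.add_mulVec M M' v
      map_smul' := fun c M => Matrix.smul_mulVec c M v }
  have h := (LinearMap.toContinuousLinearMap ev).hasFDerivAt.comp_hasDerivAt s
    (hasDerivAt_exp_smul_const' B s)
  exact h.congr_deriv (Matrix.mulVec_mulVec v B _).symm

end MatrixExp

/-- Solutions of the integrated linear equation are given by the matrix exponential. -/
theorem eq_exp_mulVec_of_integral_eq {q : ℕ} (B : Matrix (Fin q) (Fin q) ℝ) {u : ℝ → Fin q → ℝ}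
    {a b : ℝ} (hab : a ≤ b) (hu : ContinuousOn u (Set.Icc a b))
    (h : ∀ t ∈ Set.Icc a b, u t = u a + ∫ s in a..t, B *ᵥ u s) :
    ∀ t ∈ Set.Icc a b, u t = NormedSpace.exp ((t - a) • B) *ᵥ u a := by
  -- Freezing `u` outside `[a, b]` makes the integrand continuous on the whole line, so the
  -- fundamental theorem of calculus applies at the end points too.
  set w : ℝ → Fin q → ℝ := fun s => B *ᵥ u (Set.projIcc a b hab s) with hw
  have hwc : Continuous w := by
    have h1 : Continuous fun s : ℝ => u (Set.projIcc a b hab s) :=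
      (continuousOn_iff_continuous_domRestrict.1 hu).comp continuous_projIcc
    exact Continuous.matrix_mulVec continuous_const h1
  have h2 : ∀ t ∈ Set.Icc a b, u t = u a + ∫ s in a..t, w s := by
    intro t ht
    rw [h t ht]
    congr 1
    refine intervalIntegral.integral_congr fun s hs => ?_
    rw [Set.uIcc_of_le ht.1] at hs
    simp only [hw]
    rw [Set.projIcc_of_mem hab ⟨hs.1, hs.2.trans ht.2⟩]
  have hder : ∀ t ∈ Set.Ico a b, HasDerivWithinAt u (B *ᵥ u t) (Set.Ici t) t := by
    intro t ht
    have h3 : HasDerivAt (fun t => u a + ∫ s in a..t, w s) (w t) t :=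
      (hwc.integral_hasStrictDerivAt a t).hasDerivAt.const_add _
    have h4 : w t = B *ᵥ u t := by
      simp only [hw]
      rw [Set.projIcc_of_mem hab ⟨ht.1, ht.2.le⟩]
    rw [h4] at h3
    refine h3.hasDerivWithinAt.congr_of_eventuallyEq ?_ (h2 t ⟨ht.1, ht.2.le⟩)
    filter_upwards [Ico_mem_nhdsGE ht.2] with s hs
    exact h2 s ⟨ht.1.trans hs.1, hs.2.le⟩
  have hflow : ∀ t, HasDerivAt (fun t => NormedSpace.exp ((t - a) • B) *ᵥ u a)
      (B *ᵥ (NormedSpace.exp ((t - a) • B) *ᵥ u a)) t := fun t =>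
    HasDerivAt.comp_sub_const t a (hasDerivAt_exp_mulVec B (u a) (t - a))
  intro t ht
  refine ODE_solution_unique_of_mem_Icc_right (v := fun _ x => B *ᵥ x) (s := fun _ => Set.univ)
    (K := ‖LinearMap.toContinuousLinearMap B.mulVecLin‖₊)
    (fun t _ => (LinearMap.toContinuousLinearMap B.mulVecLin).lipschitz.lipschitzOnWith) hu
    hder (fun _ _ => trivial) (fun s _ => (hflow s).continuousAt.continuousWithinAt)
    (fun s _ => (hflow s).hasDerivWithinAt) (fun _ _ => trivial) ?_ ht
  simp

/-! ### Integrability of cadlag paths -/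

/-- One-sided limits give local boundedness at every point; compactness of `[0, t]` makes it
uniform. -/
theorem IsCadlag.exists_norm_le {E : Type*} [NormedAddCommGroup E] {y : ℝ≥0 → E}
    (hy : IsCadlag y) (t : ℝ≥0) : ∃ M, ∀ s ≤ t, ‖y s‖ ≤ M := by
  have h : ∃ M, ∀ s ∈ Set.Icc 0 t, ‖y s‖ ≤ M := by
    refine isCompact_Icc.induction_on (p := fun S => ∃ M, ∀ s ∈ S, ‖y s‖ ≤ M) ⟨0, by simp⟩ ?_ ?_ ?_
    · rintro S S' hS ⟨M, hM⟩
      exact ⟨M, fun s hs => hM s (hS hs)⟩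
    · rintro S S' ⟨M, hM⟩ ⟨M', hM'⟩
      exact ⟨max M M', fun s hs => hs.elim (fun h => (hM s h).trans (le_max_left _ _))
        fun h => (hM' s h).trans (le_max_right _ _)⟩
    · intro x _
      have h1 : ∀ᶠ s in 𝓝[<] x, ‖y s‖ ≤ max (‖Function.leftLim y x‖ + 1) (‖y x‖ + 1) := by
        filter_upwards [(hy.tendsto_leftLim x).norm.eventually_lt_const (lt_add_one _)] with s hs
        exact hs.le.trans (le_max_left _ _)
      have h2 : ∀ᶠ s in 𝓝[≥] x, ‖y s‖ ≤ max (‖Function.leftLim y x‖ + 1) (‖y x‖ + 1) := by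
        filter_upwards [(hy.continuousWithinAt_Ici x).tendsto.norm.eventually_lt_const
          (lt_add_one _)] with s hs
        exact hs.le.trans (le_max_right _ _)
      have h3 : ∀ᶠ s in 𝓝 x, ‖y s‖ ≤ max (‖Function.leftLim y x‖ + 1) (‖y x‖ + 1) := by
        rw [← nhdsLT_sup_nhdsGE]
        exact Filter.mem_sup.2 ⟨h1, h2⟩
      exact ⟨_, mem_nhdsWithin_of_mem_nhds h3, _, fun s hs => hs⟩
  obtain ⟨M, hM⟩ := h
  exact ⟨M, fun s hs => hM s ⟨zero_le, hs⟩⟩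

theorem IsCadlag.measurable {E : Type*} [NormedAddCommGroup E] [MeasurableSpace E] [BorelSpace E]
    {y : ℝ≥0 → E} (hy : IsCadlag y) : Measurable y := by
  refine measurable_of_tendsto_metrizable (f := fun (k : ℕ) (t : ℝ≥0) =>
    y (((⌊t * (k + 1)⌋₊ + 1 : ℕ) : ℝ≥0) / (k + 1))) (fun k => ?_) (tendsto_pi_nhds.2 fun t => ?_)
  · have h2 : Measurable fun t : ℝ≥0 => ⌊t * (k + 1)⌋₊ + 1 :=
      (Nat.measurable_floor.comp (measurable_id.mul_const _)).add_const 1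
    exact (measurable_from_nat (f := fun n : ℕ => y ((n : ℝ≥0) / (k + 1)))).comp h2
  · exact (hy.continuousWithinAt_Ici t).tendsto.comp (tendsto_grid_above t)

theorem IsCadlag.measurable_leftLim {E : Type*} [NormedAddCommGroup E] [MeasurableSpace E]
    [BorelSpace E] {y : ℝ≥0 → E} (hy : IsCadlag y) : Measurable (Function.leftLim y) := by
  refine measurable_of_tendsto_metrizable (f := fun (k : ℕ) (t : ℝ≥0) =>
    y (t - 1 / ((k : ℝ≥0) + 1))) (fun k => ?_) (tendsto_pi_nhds.2 fun t => ?_)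
  · exact hy.measurable.comp (measurable_id.sub_const _)
  · rcases eq_or_ne t 0 with rfl | ht
    · simp [leftLim_eq_of_isBot (f := y) (fun _ => zero_le : IsBot (0 : ℝ≥0))]
    · exact (hy.tendsto_leftLim t).comp (tendsto_grid_below ht)

theorem IsCadlag.norm_leftLim_le {E : Type*} [NormedAddCommGroup E] {y : ℝ≥0 → E}
    (hy : IsCadlag y) {t : ℝ≥0} {M : ℝ} (hM : ∀ s ≤ t, ‖y s‖ ≤ M) :
    ‖Function.leftLim y t‖ ≤ M := by
  rcases eq_or_ne t 0 with rfl | ht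
  · rw [leftLim_eq_of_isBot (f := y) (fun _ => zero_le : IsBot (0 : ℝ≥0))]
    exact hM 0 le_rfl
  · have := nhdsLT_neBot_of_pos (pos_iff_ne_zero.2 ht)
    refine le_of_tendsto (hy.tendsto_leftLim t).norm ?_
    filter_upwards [self_mem_nhdsWithin] with s hs
    exact hM s (le_of_lt hs)

theorem IsCadlag.intervalIntegrable_mulVec_leftLim {q : ℕ} (B : Matrix (Fin q) (Fin q) ℝ)
    {y : ℝ≥0 → Fin q → ℝ} (hy : IsCadlag y) (a b : ℝ) :
    IntervalIntegrable (fun s : ℝ => B *ᵥ Function.leftLim y s.toNNReal) volume a b := by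
  obtain ⟨M, hM⟩ := hy.exists_norm_le (max a b).toNNReal
  have hBc := (LinearMap.toContinuousLinearMap B.mulVecLin).continuous
  have hmeas : Measurable fun s : ℝ => B *ᵥ Function.leftLim y s.toNNReal :=
    hBc.measurable.comp (hy.measurable_leftLim.comp measurable_real_toNNReal)
  refine intervalIntegrable_const (c := ‖LinearMap.toContinuousLinearMap B.mulVecLin‖ * M) |>.mono_fun
    hmeas.aestronglyMeasurable ?_
  refine (ae_restrict_mem measurableSet_uIoc).mono fun s hs => ?_
  have hs' : s ≤ max a b := by
    rw [Set.uIoc, Set.mem_Ioc] at hs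
    exact hs.2
  have h1 : ‖Function.leftLim y s.toNNReal‖ ≤ M :=
    hy.norm_leftLim_le fun u hu => hM u (hu.trans (Real.toNNReal_le_toNNReal hs'))
  calc ‖B *ᵥ Function.leftLim y s.toNNReal‖ ≤ ‖LinearMap.toContinuousLinearMap B.mulVecLin‖ *
        ‖Function.leftLim y s.toNNReal‖ :=
        (LinearMap.toContinuousLinearMap B.mulVecLin).le_opNorm _
    _ ≤ ‖LinearMap.toContinuousLinearMap B.mulVecLin‖ * M := by gcongr
    _ ≤ _ := le_abs_self _

/-! ### The state process between and at the jumps -/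

theorem IsRegular.jumpIntegral_eq {f : ℝ≥0 → ℝ} (hf : IsRegular f) (g : ℝ≥0 → ℝ) (t : ℝ≥0) :
    jumpIntegral g f t = ∑ i ∈ Finset.Icc 1 (jumpCount f t),
      Function.leftLim g (arrival i f) * mark i f ^ 2 :=
  hf.tsum_jumps (g := fun s => Function.leftLim g s * jump f s ^ 2) (fun s hs => by simp [hs]) t

section StatePath

variable {q : ℕ} {α β : ℕ → ℝ} {f : ℝ≥0 → ℝ} {y : ℝ≥0 → Fin q → ℝ}

/-- The integrated state equation for a single path. -/
def SolvesStateEq (α β : ℕ → ℝ) (f : ℝ≥0 → ℝ) (y : ℝ≥0 → Fin q → ℝ) : Prop :=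
  ∀ t : ℝ≥0, y t = y 0
    + (∫ s in (0 : ℝ)..(t : ℝ), matB q β *ᵥ Function.leftLim y s.toNNReal)
    + jumpIntegral (fun u => α 0 + vecA q α ⬝ᵥ y u) f t • vecE q

theorem SolvesStateEq.sub_eq (hsde : SolvesStateEq α β f y) (hy : IsCadlag y) (s t : ℝ≥0) :
    y t = y s + (∫ r in (s : ℝ)..(t : ℝ), matB q β *ᵥ Function.leftLim y r.toNNReal)
      + (jumpIntegral (fun u => α 0 + vecA q α ⬝ᵥ y u) f t
        - jumpIntegral (fun u => α 0 + vecA q α ⬝ᵥ y u) f s) • vecE q := by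
  have hint := hy.intervalIntegrable_mulVec_leftLim (matB q β)
  rw [← intervalIntegral.integral_interval_sub_left (hint 0 t) (hint 0 s), sub_smul, hsde t, hsde s]
  abel

variable (hf : IsRegular f) (hy : IsCadlag y) (hsde : SolvesStateEq α β f y)

include hf hy hsde

theorem SolvesStateEq.eq_add_integral {n : ℕ} {t : ℝ≥0} (h1 : arrival n f ≤ t)
    (h2 : t < arrival (n + 1) f) :
    y t = y (arrival n f) +
      ∫ r in (arrival n f : ℝ)..(t : ℝ), matB q β *ᵥ Function.leftLim y r.toNNReal := by
  have ha : jumpCount f (arrival n f) = n := (hf.jumpCount_eq_iff _ _).2 ⟨le_rfl, h1.trans_lt h2⟩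
  have ht : jumpCount f t = n := (hf.jumpCount_eq_iff _ _).2 ⟨h1, h2⟩
  have h := hsde.sub_eq hy (arrival n f) t
  rwa [hf.jumpIntegral_eq, hf.jumpIntegral_eq, ha, ht, sub_self, zero_smul, add_zero] at h

/-- Strictly between jumps the state is a constant plus a primitive, hence continuous. This allows
the left limit in the integrand to be replaced by the state, leaving a genuine linear ODE. -/
theorem SolvesStateEq.leftLim_eq {n : ℕ} {t : ℝ≥0} (h1 : arrival n f < t)
    (h2 : t < arrival (n + 1) f) : Function.leftLim y t = y t := by
  refine ContinuousWithinAt.leftLim_eq (ContinuousAt.continuousWithinAt ?_)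
  have hc := intervalIntegral.continuous_primitive
    (hy.intervalIntegrable_mulVec_leftLim (matB q β)) (arrival n f : ℝ)
  have hc2 : Continuous fun r : ℝ≥0 => y (arrival n f) +
      ∫ r in (arrival n f : ℝ)..(r : ℝ), matB q β *ᵥ Function.leftLim y r.toNNReal :=
    continuous_const.add (hc.comp NNReal.continuous_coe)
  refine hc2.continuousAt.congr ?_
  filter_upwards [Ioo_mem_nhds h1 h2] with s hs
  exact (hsde.eq_add_integral hf hy hs.1.le hs.2).symm

theorem SolvesStateEq.flow {n : ℕ} {t : ℝ≥0} (h1 : arrival n f ≤ t)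
    (h2 : t < arrival (n + 1) f) :
    y t = NormedSpace.exp (((t : ℝ) - arrival n f) • matB q β) *ᵥ y (arrival n f) := by
  set a := arrival n f with ha
  have hu : ∀ s ∈ Set.Icc (a : ℝ) t, y s.toNNReal = y a +
      ∫ r in (a : ℝ)..s, matB q β *ᵥ Function.leftLim y r.toNNReal := by
    intro s hs
    have hs0 : (0 : ℝ) ≤ s := a.2.trans hs.1
    lift s to ℝ≥0 using hs0
    rw [Real.toNNReal_coe]
    exact hsde.eq_add_integral hf hy (NNReal.coe_le_coe.1 hs.1) ((NNReal.coe_le_coe.1 hs.2).trans_lt h2)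
  have hc := intervalIntegral.continuous_primitive
    (hy.intervalIntegrable_mulVec_leftLim (matB q β)) (a : ℝ)
  have h := eq_exp_mulVec_of_integral_eq (matB q β) (u := fun s => y s.toNNReal)
    (NNReal.coe_le_coe.2 h1) ((continuous_const.add hc).continuousOn.congr hu) (fun s hs => by
      simp only [Real.toNNReal_coe]
      rw [hu s hs]
      congr 1
      -- The integral runs over `(a, s]`, so a jump of the state at the left end point `a` does not
      -- interfere.
      refine intervalIntegral.integral_congr_ae (ae_of_all _ fun r hr => ?_)
      rw [Set.uIoc_of_le hs.1] at hr
      have hr0 : (0 : ℝ) ≤ r := a.2.trans hr.1.le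
      have hr1 := hr.1
      have hr2 := hr.2.trans hs.2
      lift r to ℝ≥0 using hr0
      rw [Real.toNNReal_coe, hsde.leftLim_eq hf hy (NNReal.coe_lt_coe.1 hr1)
        ((NNReal.coe_le_coe.1 hr2).trans_lt h2)]) t ⟨NNReal.coe_le_coe.2 h1, le_rfl⟩
  simpa using h

/-- Let `t` increase to the jump time in the equation between `t` and that time: the drift integral
vanishes and the jump integral contributes the single last term. -/
theorem SolvesStateEq.jump_eq (n : ℕ) :
    y (arrival (n + 1) f) = Function.leftLim y (arrival (n + 1) f) +
      ((α 0 + vecA q α ⬝ᵥ Function.leftLim y (arrival (n + 1) f)) * mark (n + 1) f ^ 2) • vecE q := by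
  set b := arrival (n + 1) f with hb
  have hab : arrival n f < b := hf.arrival_strictMono (Nat.lt_succ_self n)
  have hb0 : 0 < b := zero_le.trans_lt hab
  have := nhdsLT_neBot_of_pos hb0
  set g : ℝ≥0 → ℝ := fun u => α 0 + vecA q α ⬝ᵥ y u with hg
  have hgl : Function.leftLim g b = α 0 + vecA q α ⬝ᵥ Function.leftLim y b := by
    refine leftLim_eq_of_tendsto ?_
    refine tendsto_const_nhds.add ?_
    exact ((continuous_const.dotProduct continuous_id).tendsto _).comp (hy.tendsto_leftLim b)
  have hc := intervalIntegral.continuous_primitive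
    (hy.intervalIntegrable_mulVec_leftLim (matB q β)) (b : ℝ)
  have hlim : Tendsto (fun t : ℝ≥0 => y t + (-∫ r in (b : ℝ)..(t : ℝ),
      matB q β *ᵥ Function.leftLim y r.toNNReal) + (Function.leftLim g b * mark (n + 1) f ^ 2) • vecE q)
      (𝓝[<] b) (𝓝 (Function.leftLim y b + (-∫ r in (b : ℝ)..(b : ℝ),
      matB q β *ᵥ Function.leftLim y r.toNNReal) +
        (Function.leftLim g b * mark (n + 1) f ^ 2) • vecE q)) := by
    refine ((hy.tendsto_leftLim b).add (Tendsto.neg ?_)).add tendsto_const_nhds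
    exact ((hc.comp NNReal.continuous_coe).tendsto b).mono_left nhdsWithin_le_nhds
  rw [intervalIntegral.integral_same, neg_zero, add_zero, hgl] at hlim
  refine tendsto_nhds_unique (tendsto_const_nhds.congr' ?_) hlim
  filter_upwards [Ioo_mem_nhdsLT hab] with t ht
  have h := hsde.sub_eq hy t b
  rw [intervalIntegral.integral_symm] at h
  rw [h]
  congr 2
  have hcb : jumpCount f b = n + 1 :=
    (hf.jumpCount_eq_iff _ _).2 ⟨le_rfl, hf.arrival_strictMono (Nat.lt_succ_self (n + 1))⟩
  have hct : jumpCount f t = n := (hf.jumpCount_eq_iff _ _).2 ⟨ht.1.le, ht.2⟩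
  rw [hf.jumpIntegral_eq, hf.jumpIntegral_eq, hcb, hct, Finset.sum_Icc_succ_top (by omega),
    add_sub_cancel_left, ← hb, hgl]

theorem SolvesStateEq.recursion (n : ℕ) :
    y (jumpTime f (n + 1)) = seqC q α β f (n + 1) *ᵥ y (jumpTime f n) + seqD q α f (n + 1) := by
  rw [hf.jumpTime_eq_arrival, hf.jumpTime_eq_arrival, hsde.jump_eq hf hy]
  have hab : arrival n f < arrival (n + 1) f := hf.arrival_strictMono (Nat.lt_succ_self n)
  have := nhdsLT_neBot_of_pos (zero_le.trans_lt hab)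
  have hl : Function.leftLim y (arrival (n + 1) f) =
      NormedSpace.exp ((((arrival (n + 1) f : ℝ≥0) : ℝ) - arrival n f) • matB q β) *ᵥ
        y (arrival n f) := by
    refine leftLim_eq_of_tendsto ?_
    have hc : Continuous fun t : ℝ≥0 =>
        NormedSpace.exp (((t : ℝ) - arrival n f) • matB q β) *ᵥ y (arrival n f) :=
      Continuous.matrix_mulVec ((continuous_exp_smul (matB q β)).comp
        (NNReal.continuous_coe.sub continuous_const)) continuous_const
    refine ((hc.tendsto _).mono_left nhdsWithin_le_nhds).congr' ?_
    filter_upwards [Ioo_mem_nhdsLT hab] with t ht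
    exact (hsde.flow hf hy ht.1.le ht.2).symm
  rw [hl, seqC, seqD, coefC, coefD, waitTime, sqJump, hf.jumpTime_eq_arrival, Nat.add_sub_cancel,
    hf.jumpTime_eq_arrival, ← Matrix.mulVec_mulVec, Matrix.add_mulVec, Matrix.one_mulVec,
    Matrix.smul_mulVec, matEA, Matrix.vecMulVec_mulVec, add_assoc, mark]
  congr 1
  ext i
  simp only [Pi.add_apply, Pi.smul_apply, smul_eq_mul, MulOpposite.smul_eq_mul_unop,
    MulOpposite.unop_op]
  ring

end StatePath

/-! ### Iterating a random affine recursion -/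

section Affine

variable {q : ℕ} (C : ℕ → Matrix (Fin q) (Fin q) ℝ) (D : ℕ → Fin q → ℝ)

theorem descProd_succ (n k : ℕ) : descProd C (n + 1) (k + 1) = C (n + 1) * descProd C n k := by
  rw [descProd, descProd, List.range_succ_eq_map, List.map_cons, List.prod_cons, List.map_map]
  congr 3
  ext j : 1
  simp

theorem ascProd_succ (k : ℕ) : ascProd C (k + 1) = ascProd C k * C (k + 1) := by
  simp [ascProd, List.range_succ]

theorem ascProd_succ' (k : ℕ) : ascProd C (k + 1) = C 1 * ascProd (fun i => C (i + 1)) k := by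
  simp [ascProd, List.range_succ_eq_map, Function.comp_def]

theorem forwardSum_zero (v : Fin q → ℝ) : forwardSum C D 0 v = v := by
  simp [forwardSum, descProd]

theorem forwardSum_succ (n : ℕ) (v : Fin q → ℝ) :
    forwardSum C D (n + 1) v = C (n + 1) *ᵥ forwardSum C D n v + D (n + 1) := by
  cases n with
  | zero => simp [forwardSum, descProd, add_comm]
  | succ n =>
    simp only [forwardSum, descProd_succ, ← Matrix.mulVec_mulVec]
    simp only [Nat.add_sub_cancel, ne_eq, Nat.succ_ne_zero, not_false_eq_true, if_true]
    rw [Finset.sum_range_succ', Matrix.mulVec_add, Matrix.mulVec_add, Matrix.mulVec_sum]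
    have h0 : descProd C (n + 1) 0 = 1 := by simp [descProd]
    have h1 : ∀ i, descProd C (n + 1) (i + 1) = C (n + 1) * descProd C n i := descProd_succ C n
    simp only [h1, h0, Matrix.one_mulVec, Matrix.mulVec_mulVec, Nat.sub_zero, Nat.add_sub_add_right,
      show n + 1 + 1 - 1 = n + 1 from rfl]
    abel

theorem eq_forwardSum {x : ℕ → Fin q → ℝ} (h : ∀ n, x (n + 1) = C (n + 1) *ᵥ x n + D (n + 1))
    (n : ℕ) : x n = forwardSum C D n (x 0) := by
  induction n with
  | zero => rw [forwardSum_zero]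
  | succ n ih => rw [h, ih, forwardSum_succ]

end Affine

/-! ### Natural matrix norms -/

section NatNorm

variable {q : ℕ} (r : ℝ≥0∞) [hr : Fact (1 ≤ r)]

theorem norm_toLp_mulVec_le (M : Matrix (Fin q) (Fin q) ℂ) (v : Fin q → ℂ) :
    ‖WithLp.toLp r (M *ᵥ v)‖ ≤ natNorm r M * ‖WithLp.toLp r v‖ := by
  have := (LinearMap.toContinuousLinearMap (Matrix.toLpLin r r M)).le_opNorm (WithLp.toLp r v)
  simpa [natNorm, Matrix.toLpLin_apply] using this

theorem natNorm_le {M : Matrix (Fin q) (Fin q) ℂ} {b : ℝ} (hb : 0 ≤ b)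
    (h : ∀ v : Fin q → ℂ, ‖WithLp.toLp r (M *ᵥ v)‖ ≤ b * ‖WithLp.toLp r v‖) : natNorm r M ≤ b := by
  refine ContinuousLinearMap.opNorm_le_bound _ hb fun v => ?_
  have := h v.ofLp
  simpa [Matrix.toLpLin_apply] using this

theorem natNorm_nonneg (M : Matrix (Fin q) (Fin q) ℂ) : 0 ≤ natNorm r M := norm_nonneg _

theorem natNorm_one_le : natNorm r (1 : Matrix (Fin q) (Fin q) ℂ) ≤ 1 :=
  natNorm_le r zero_le_one fun v => by simp

theorem natNorm_mul_le (M M' : Matrix (Fin q) (Fin q) ℂ) :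
    natNorm r (M * M') ≤ natNorm r M * natNorm r M' := by
  refine natNorm_le r (mul_nonneg (natNorm_nonneg r _) (natNorm_nonneg r _)) fun v => ?_
  rw [← Matrix.mulVec_mulVec, mul_assoc]
  exact (norm_toLp_mulVec_le r M _).trans
    (mul_le_mul_of_nonneg_left (norm_toLp_mulVec_le r M' v) (natNorm_nonneg r _))

theorem natNorm_add_le (M M' : Matrix (Fin q) (Fin q) ℂ) :
    natNorm r (M + M') ≤ natNorm r M + natNorm r M' := by
  refine natNorm_le r (add_nonneg (natNorm_nonneg r _) (natNorm_nonneg r _)) fun v => ?_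
  rw [Matrix.add_mulVec, add_mul, WithLp.toLp_add]
  exact (norm_add_le _ _).trans
    (add_le_add (norm_toLp_mulVec_le r M _) (norm_toLp_mulVec_le r M' v))

theorem natNorm_smul_le (z : ℂ) (M : Matrix (Fin q) (Fin q) ℂ) :
    natNorm r (z • M) ≤ ‖z‖ * natNorm r M := by
  refine natNorm_le r (mul_nonneg (norm_nonneg _) (natNorm_nonneg r _)) fun v => ?_
  rw [Matrix.smul_mulVec, WithLp.toLp_smul, norm_smul, mul_assoc]
  exact mul_le_mul_of_nonneg_left (norm_toLp_mulVec_le r M _) (norm_nonneg _)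

theorem eq_zero_of_natNorm_eq_zero {M : Matrix (Fin q) (Fin q) ℂ} (h : natNorm r M = 0) :
    M = 0 := by
  ext i j
  have h1 := norm_toLp_mulVec_le r M (Pi.single j 1)
  rw [h, zero_mul, norm_le_zero_iff] at h1
  have h2 : M *ᵥ Pi.single j 1 = 0 := by simpa using h1
  have := congrFun h2 i
  simpa using this

/-- The `L^r`-norm is monotone in the moduli of the coordinates, for every `r` including `∞`. -/
theorem natNorm_diagonal_le {d : Fin q → ℂ} {b : ℝ} (hb : 0 ≤ b) (h : ∀ i, ‖d i‖ ≤ b) :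
    natNorm r (Matrix.diagonal d) ≤ b := by
  refine natNorm_le r hb fun v => ?_
  have hv : ∀ i, ‖(Matrix.diagonal d *ᵥ v) i‖ ≤ ‖(b : ℂ) * v i‖ := fun i => by
    rw [Matrix.mulVec_diagonal, norm_mul, norm_mul, Complex.norm_real, Real.norm_of_nonneg hb]
    exact mul_le_mul_of_nonneg_right (h i) (norm_nonneg _)
  have key : ‖WithLp.toLp r (Matrix.diagonal d *ᵥ v)‖ ≤ ‖WithLp.toLp r ((b : ℂ) • v)‖ := by
    rcases eq_or_ne r ⊤ with rfl | htop
    · simp only [PiLp.norm_toLp]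
      exact (pi_norm_le_iff_of_nonneg (norm_nonneg _)).2 fun i =>
        (hv i).trans (norm_le_pi_norm ((b : ℂ) • v) i)
    · have h0 : 0 < r.toReal :=
        ENNReal.toReal_pos (zero_lt_one.trans_le hr.out).ne' htop
      rw [PiLp.norm_eq_sum h0, PiLp.norm_eq_sum h0]
      gcongr with i
      exact hv i
  rw [WithLp.toLp_smul, norm_smul, Complex.norm_real, Real.norm_of_nonneg hb] at key
  exact key

end NatNorm

/-! ### Complexification and diagonalisation -/

section ToC

variable {q : ℕ}

theorem toC_eq (M : Matrix (Fin q) (Fin q) ℝ) : toC M = (algebraMap ℝ ℂ).mapMatrix M := rfl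

theorem toC_mul (M M' : Matrix (Fin q) (Fin q) ℝ) : toC (M * M') = toC M * toC M' := by
  simp only [toC_eq, map_mul]

theorem toC_add (M M' : Matrix (Fin q) (Fin q) ℝ) : toC (M + M') = toC M + toC M' := by
  simp only [toC_eq, map_add]

theorem toC_one : toC (1 : Matrix (Fin q) (Fin q) ℝ) = 1 := by
  simp only [toC_eq, map_one]

theorem toC_smul (t : ℝ) (M : Matrix (Fin q) (Fin q) ℝ) : toC (t • M) = (t : ℂ) • toC M := by
  ext i j
  simp [toC]

theorem toC_mulVec (M : Matrix (Fin q) (Fin q) ℝ) (v : Fin q → ℝ) :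
    (fun i => ((M *ᵥ v) i : ℂ)) = toC M *ᵥ fun i => (v i : ℂ) := by
  ext i
  simp [toC, Matrix.mulVec, dotProduct]

open scoped Matrix.Norms.Operator in
theorem toC_exp (M : Matrix (Fin q) (Fin q) ℝ) :
    toC (NormedSpace.exp M) = NormedSpace.exp (toC M) := by
  refine NormedSpace.map_exp (algebraMap ℝ ℂ).mapMatrix ?_ M
  exact continuous_id.matrix_map Complex.continuous_ofReal

/-- All norms on `ℂ^q` are equivalent and conjugation by `S` costs a fixed factor, so `K` depends on
`S` and `r` but not on `M`. -/
theorem exists_norm_mulVec_le (r : ℝ≥0∞) [Fact (1 ≤ r)] {S : Matrix (Fin q) (Fin q) ℂ}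
    (hS : IsUnit S.det) : ∃ K : ℝ, 0 < K ∧ ∀ (M : Matrix (Fin q) (Fin q) ℝ) (v : Fin q → ℝ),
      ‖M *ᵥ v‖ ≤ K * natNorm r (S⁻¹ * toC M * S) * ‖v‖ := by
  let e := (PiLp.continuousLinearEquiv r ℂ (fun _ : Fin q => ℂ))
  set a := ‖(e : PiLp r (fun _ : Fin q => ℂ) →L[ℂ] (Fin q → ℂ))‖
  set b := ‖(e.symm : (Fin q → ℂ) →L[ℂ] PiLp r (fun _ : Fin q => ℂ))‖
  have hv : ∀ v : Fin q → ℝ, ‖(fun i => (v i : ℂ))‖ = ‖v‖ := fun v => by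
    simp [Pi.norm_def]
  have ha : ∀ w : Fin q → ℂ, ‖w‖ ≤ a * ‖WithLp.toLp r w‖ := fun w =>
    (e : PiLp r (fun _ : Fin q => ℂ) →L[ℂ] (Fin q → ℂ)).le_opNorm (WithLp.toLp r w)
  have hb : ∀ w : Fin q → ℂ, ‖WithLp.toLp r w‖ ≤ b * ‖w‖ := fun w =>
    (e.symm : (Fin q → ℂ) →L[ℂ] PiLp r (fun _ : Fin q => ℂ)).le_opNorm w
  have ha0 : 0 ≤ a := norm_nonneg _
  have hb0 : 0 ≤ b := norm_nonneg _
  -- The summand `1` only ensures that the constant is positive.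
  refine ⟨a * natNorm r S * natNorm r S⁻¹ * b + 1, ?_, fun M v => ?_⟩
  · have := natNorm_nonneg r S
    have := natNorm_nonneg r S⁻¹
    positivity
  · have h1 := natNorm_nonneg r S
    have h2 := natNorm_nonneg r S⁻¹
    have h3 := natNorm_nonneg r (S⁻¹ * toC M * S)
    have h4 := norm_nonneg v
    have hM : toC M = S * (S⁻¹ * toC M * S) * S⁻¹ := by
      rw [← mul_assoc, ← mul_assoc, Matrix.mul_nonsing_inv _ hS, one_mul, mul_assoc,
        Matrix.mul_nonsing_inv _ hS, mul_one]
    have h5 : natNorm r (toC M) ≤ natNorm r S * natNorm r (S⁻¹ * toC M * S) * natNorm r S⁻¹ := by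
      conv_lhs => rw [hM]
      refine (natNorm_mul_le r _ _).trans (mul_le_mul_of_nonneg_right ?_ h2)
      exact natNorm_mul_le r _ _
    calc ‖M *ᵥ v‖ = ‖toC M *ᵥ fun i => (v i : ℂ)‖ := by rw [← hv, toC_mulVec]
      _ ≤ a * (natNorm r (toC M) * (b * ‖v‖)) := by
        refine (ha _).trans (mul_le_mul_of_nonneg_left ?_ ha0)
        refine (norm_toLp_mulVec_le r _ _).trans
          (mul_le_mul_of_nonneg_left ?_ (natNorm_nonneg r _))
        rw [← hv v]
        exact hb _
      _ ≤ a * ((natNorm r S * natNorm r (S⁻¹ * toC M * S) * natNorm r S⁻¹) * (b * ‖v‖)) := by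
        gcongr
      _ ≤ _ := by nlinarith [mul_nonneg h3 h4]

/-- The diagonal entries of a diagonalisation have real part at most `maxRe`. -/
theorem re_diag_le_maxRe {B : Matrix (Fin q) (Fin q) ℝ} {S : Matrix (Fin q) (Fin q) ℂ}
    (hS : IsUnit S.det) (hdiag : (S⁻¹ * toC B * S).IsDiag) (i : Fin q) :
    ((S⁻¹ * toC B * S).diag i).re ≤ maxRe B := by
  have hfin : (spectrum ℂ (toC B)).Finite := by
    rw [← Matrix.spectrum_toLin']
    exact Module.End.finite_spectrum _
  refine le_csSup (hfin.image _).bddAbove ⟨_, ?_, rfl⟩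
  have hSu : IsUnit S := (Matrix.isUnit_iff_isUnit_det S).2 hS
  obtain ⟨u, hu⟩ := hSu
  have hinv : S⁻¹ = ((u⁻¹ : (Matrix (Fin q) (Fin q) ℂ)ˣ) : Matrix (Fin q) (Fin q) ℂ) := by
    rw [← hu, Matrix.coe_units_inv]
  have h1 : spectrum ℂ (S⁻¹ * toC B * S) = spectrum ℂ (toC B) := by
    rw [hinv, ← hu, spectrum.units_conjugate']
  rw [← h1]
  have h2 : spectrum ℂ (S⁻¹ * toC B * S) = Set.range (S⁻¹ * toC B * S).diag := by
    conv_lhs => rw [← hdiag.diagonal_diag]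
    rw [spectrum_diagonal]
  rw [h2]
  exact ⟨i, rfl⟩

end ToC

/-! ### A gauge adapted to the stationarity condition -/

/-- A submultiplicative gauge under which the recurrence coefficients contract on average. -/
structure IsContractive (q : ℕ) (α β : ℕ → ℝ) (c lam K : ℝ)
    (ρ : Matrix (Fin q) (Fin q) ℝ → ℝ) : Prop where
  c_pos : 0 < c
  lam_neg : lam < 0
  K_pos : 0 < K
  nonneg : ∀ M, 0 ≤ ρ M
  one_le : ρ 1 ≤ 1
  mul_le : ∀ M M', ρ (M * M') ≤ ρ M * ρ M'
  mulVec_le : ∀ M v, ‖M *ᵥ v‖ ≤ K * ρ M * ‖v‖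
  exp_le : ∀ t, 0 ≤ t → ρ (NormedSpace.exp (t • matB q β)) ≤ Real.exp (lam * t)
  jump_le : ∀ z, 0 ≤ z → ρ (1 + z • matEA q α) ≤ 1 + c * z

/-- The entry in row `q` and column `p` is `α_p`. Nonvanishing is needed for `c > 0`, and `c` later
serves as a divisor. -/
theorem matEA_ne_zero {p q : ℕ} {α β : ℕ → ℝ} (h : IsParam p q α β) : matEA q α ≠ 0 := by
  intro h0
  have hp := h.one_le_p
  have hpq := h.p_le_q
  have := congrFun (congrFun h0 ⟨q - 1, by omega⟩) ⟨p - 1, by omega⟩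
  simp only [matEA, Matrix.vecMulVec_apply, vecE, vecA, Matrix.zero_apply] at this
  rw [if_pos (by omega), one_mul, Nat.sub_add_cancel hp] at this
  exact h.alpha_p_ne this

/-- The gauge is `ρ(M) = ‖S⁻¹ M S‖_r`: it sees `e^{Bt}` as a diagonal matrix with entries of modulus
at most `e^{λ t}`. Negativity of `λ` is automatic, since a nonnegative integral lies below `-λ`. -/
theorem StationarityCondition.exists_isContractive {p q : ℕ} {α β : ℕ → ℝ} {ν : Measure ℝ}
    (hparam : IsParam p q α β) (h : StationarityCondition q α β ν) :
    ∃ c lam K ρ, IsContractive q α β c lam K ρ ∧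
      Integrable (fun y : ℝ => Real.log (1 + c * y ^ 2)) ν ∧
      ∫ y, Real.log (1 + c * y ^ 2) ∂ν < -lam := by
  obtain ⟨-, r, hr, S, hS, hdiag, hint, hlt⟩ := h
  set B := matB q β with hB
  set c := natNorm r (S⁻¹ * toC (matEA q α) * S) with hc
  obtain ⟨K, hK, hKv⟩ := exists_norm_mulVec_le r hS
  have hSS : S * S⁻¹ = 1 := Matrix.mul_nonsing_inv _ hS
  have hSS' : S⁻¹ * S = 1 := Matrix.nonsing_inv_mul _ hS
  have hc0 : 0 < c := by
    refine (natNorm_nonneg r _).lt_of_ne fun h0 => matEA_ne_zero hparam ?_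
    have h1 := eq_zero_of_natNorm_eq_zero r h0.symm
    have h2 : toC (matEA q α) = 0 := by
      calc toC (matEA q α) = S * (S⁻¹ * toC (matEA q α) * S) * S⁻¹ := by
            rw [← mul_assoc, ← mul_assoc, hSS, one_mul, mul_assoc, hSS, mul_one]
        _ = 0 := by rw [h1, mul_zero, zero_mul]
    ext i j
    have := congrFun (congrFun h2 i) j
    simpa [toC] using this
  refine ⟨c, maxRe B, K, fun M => natNorm r (S⁻¹ * toC M * S), ⟨hc0, ?_, hK,
    fun M => natNorm_nonneg r _, ?_, fun M M' => ?_, hKv, fun t ht => ?_, fun z hz => ?_⟩, hint, hlt⟩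
  · have : 0 ≤ ∫ y, Real.log (1 + c * y ^ 2) ∂ν :=
      integral_nonneg fun y => Real.log_nonneg (by nlinarith [sq_nonneg y])
    linarith
  · simp only [toC_one, mul_one, hSS']
    exact natNorm_one_le r
  · have : S⁻¹ * toC (M * M') * S = S⁻¹ * toC M * S * (S⁻¹ * toC M' * S) := by
      rw [toC_mul]
      simp only [mul_assoc]
      rw [← mul_assoc S S⁻¹, hSS, one_mul]
    simp only [this]
    exact natNorm_mul_le r _ _
  · rw [toC_exp, toC_smul, ← Matrix.exp_conj' _ _ ((Matrix.isUnit_iff_isUnit_det S).2 hS),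
      Matrix.mul_smul, Matrix.smul_mul, ← hdiag.diagonal_diag, ← Matrix.diagonal_smul,
      Matrix.exp_diagonal]
    refine natNorm_diagonal_le r (Real.exp_pos _).le fun i => ?_
    rw [Pi.coe_exp, ← Complex.exp_eq_exp_ℂ, Complex.norm_exp]
    refine Real.exp_le_exp.2 ?_
    rw [Pi.smul_apply, smul_eq_mul, Complex.re_ofReal_mul, mul_comm]
    exact mul_le_mul_of_nonneg_right (re_diag_le_maxRe hS hdiag i) ht
  · have : S⁻¹ * toC (1 + z • matEA q α) * S = 1 + (z : ℂ) • (S⁻¹ * toC (matEA q α) * S) := by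
      rw [toC_add, toC_one, toC_smul, mul_add, add_mul, mul_one, hSS', Matrix.mul_smul,
        Matrix.smul_mul]
    simp only [this]
    refine (natNorm_add_le r _ _).trans (add_le_add (natNorm_one_le r) ?_)
    refine (natNorm_smul_le r _ _).trans ?_
    rw [Complex.norm_real, Real.norm_of_nonneg hz, mul_comm]

section

variable {q : ℕ} {α β : ℕ → ℝ} {c lam K : ℝ} {ρ : Matrix (Fin q) (Fin q) ℝ → ℝ}

theorem IsContractive.coefC_le (h : IsContractive q α β c lam K ρ) {t z : ℝ} (ht : 0 ≤ t)
    (hz : 0 ≤ z) : ρ (coefC q α β t z) ≤ Real.exp (Real.log (1 + c * z) + lam * t) := by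
  have h0 : 0 < 1 + c * z := by have := mul_nonneg h.c_pos.le hz; linarith
  rw [Real.exp_add, Real.exp_log h0]
  refine (h.mul_le _ _).trans ?_
  exact mul_le_mul (h.jump_le z hz) (h.exp_le t ht) (h.nonneg _) h0.le

theorem IsContractive.norm_exp_mulVec_le (h : IsContractive q α β c lam K ρ) {t : ℝ} (ht : 0 ≤ t)
    (v : Fin q → ℝ) : ‖NormedSpace.exp (t • matB q β) *ᵥ v‖ ≤ K * ‖v‖ := by
  refine (h.mulVec_le _ v).trans (mul_le_mul_of_nonneg_right ?_ (norm_nonneg _))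
  refine mul_le_of_le_one_right h.K_pos.le ((h.exp_le t ht).trans ?_)
  exact Real.exp_le_one_iff.2 (mul_nonpos_of_nonpos_of_nonneg h.lam_neg.le ht)

theorem IsContractive.ascProd_le (h : IsContractive q α β c lam K ρ) {t z : ℕ → ℝ}
    (ht : ∀ i, 0 ≤ t i) (hz : ∀ i, 0 ≤ z i) (k : ℕ) :
    ρ (ascProd (fun i => coefC q α β (t i) (z i)) k) ≤
      Real.exp (∑ i ∈ Finset.range k, (Real.log (1 + c * z (i + 1)) + lam * t (i + 1))) := by
  induction k with
  | zero => simpa [ascProd] using h.one_le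
  | succ k ih =>
    rw [ascProd_succ, Finset.sum_range_succ, Real.exp_add]
    exact (h.mul_le _ _).trans (mul_le_mul ih (h.coefC_le (ht _) (hz _)) (h.nonneg _)
      (Real.exp_pos _).le)

end

/-! ### The product measure on sequences -/

section Sequences

variable {E : Type*}

/-- The sequence starting with `a` and continuing with `x`. -/
def consSeq (a : E) (x : ℕ → E) : ℕ → E
  | 0 => a
  | n + 1 => x n

/-- The sequence without its first term. -/
def tailSeq (x : ℕ → E) : ℕ → E := fun n => x (n + 1)

variable [MeasurableSpace E]

theorem measurable_tailSeq : Measurable (tailSeq : (ℕ → E) → ℕ → E) :=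
  measurable_pi_lambda _ fun n => measurable_pi_apply (n + 1)

theorem measurable_consSeq : Measurable fun p : E × (ℕ → E) => consSeq p.1 p.2 := by
  refine measurable_pi_lambda _ fun n => ?_
  cases n with
  | zero => exact measurable_fst
  | succ n => exact (measurable_pi_apply n).comp measurable_snd

variable (κ : Measure E) [IsProbabilityMeasure κ]

theorem map_consSeq : (κ.prod (Measure.infinitePi fun _ : ℕ => κ)).map
    (fun p => consSeq p.1 p.2) = Measure.infinitePi fun _ => κ := by
  classical
  refine Measure.eq_infinitePi _ fun s t ht => ?_
  obtain ⟨N, hN⟩ := s.exists_nat_subset_range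
  set t' : ℕ → Set E := fun i => if i ∈ s then t i else Set.univ with ht'
  have hms : ∀ i, MeasurableSet (t' i) := fun i => by
    simp only [ht']
    split_ifs
    · exact ht i
    · exact MeasurableSet.univ
  have hpre : (fun p : E × (ℕ → E) => consSeq p.1 p.2) ⁻¹' Set.pi s t =
      t' 0 ×ˢ Set.pi (Finset.range N) (fun i => t' (i + 1)) := by
    ext ⟨a, x⟩
    simp only [Set.mem_preimage, Set.mem_pi, Finset.mem_coe, Set.mem_prod, ht']
    constructor
    · intro h
      refine ⟨?_, fun i _ => ?_⟩
      · split_ifs with h0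
        · exact h 0 h0
        · trivial
      · split_ifs with hi
        · exact h (i + 1) hi
        · trivial
    · rintro ⟨h0, h1⟩ i hi
      cases i with
      | zero => simpa [hi, consSeq] using h0
      | succ i =>
        have := h1 i (Finset.mem_range.2 (by have := Finset.mem_range.1 (hN hi); omega))
        simpa [hi, consSeq] using this
  rw [Measure.map_apply measurable_consSeq (MeasurableSet.pi s.countable_toSet fun i _ => ht i),
    hpre, Measure.prod_prod, Measure.infinitePi_pi _ (fun i _ => hms (i + 1)), mul_comm,
    ← Finset.prod_range_succ' (fun i => κ (t' i)) N]
  rw [← Finset.prod_subset (hN.trans (Finset.range_mono (Nat.le_succ N)))]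
  · exact Finset.prod_congr rfl fun i hi => by simp [ht', hi]
  · intro i _ hi
    simp [ht', hi]

theorem map_head_tail : (Measure.infinitePi fun _ : ℕ => κ).map (fun x => (x 0, tailSeq x)) =
    κ.prod (Measure.infinitePi fun _ => κ) := by
  conv_lhs => rw [← map_consSeq]
  rw [Measure.map_map ((measurable_pi_apply 0).prodMk measurable_tailSeq) measurable_consSeq]
  exact Measure.map_id

theorem measurePreserving_tailSeq : MeasurePreserving tailSeq
    (Measure.infinitePi fun _ : ℕ => κ) (Measure.infinitePi fun _ => κ) :=
  ⟨measurable_tailSeq, Measure.map_infinitePi_infinitePi_of_inj (P := fun _ : ℕ => κ)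
    (f := fun n => n + 1) fun _ _ h => Nat.succ_injective h⟩

end Sequences

/-! ### The affine maps of the recursion -/

section Step

variable (q : ℕ) (α β : ℕ → ℝ)

/-- The coefficient `C` as a function of waiting time and jump. -/
def stepC (a : ℝ≥0 × ℝ) : Matrix (Fin q) (Fin q) ℝ := coefC q α β a.1 (a.2 ^ 2)

/-- The coefficient `D` as a function of waiting time and jump. -/
def stepD (a : ℝ≥0 × ℝ) : Fin q → ℝ := coefD q α (a.2 ^ 2)

/-- The sequence `(C_i)` built from a sequence of waiting times and jumps. -/
def driveC (x : ℕ → ℝ≥0 × ℝ) (i : ℕ) : Matrix (Fin q) (Fin q) ℝ := stepC q α β (x (i - 1))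

/-- The sequence `(D_i)` built from a sequence of waiting times and jumps. -/
def driveD (x : ℕ → ℝ≥0 × ℝ) (i : ℕ) : Fin q → ℝ := stepD q α (x (i - 1))

/-- One step of the recursion. -/
def step (a : ℝ≥0 × ℝ) (v : Fin q → ℝ) : Fin q → ℝ := stepC q α β a *ᵥ v + stepD q α a

variable {q α β}

theorem continuous_exp_mulVec :
    Continuous fun p : ℝ × (Fin q → ℝ) => NormedSpace.exp (p.1 • matB q β) *ᵥ p.2 :=
  ((continuous_exp_smul (matB q β)).comp continuous_fst).matrix_mulVec continuous_snd

theorem continuous_one_add_smul_mulVec :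
    Continuous fun p : ℝ × (Fin q → ℝ) => (1 + p.1 • matEA q α) *ᵥ p.2 :=
  (continuous_const.add (continuous_fst.smul continuous_const)).matrix_mulVec continuous_snd

theorem continuous_coefD : Continuous (coefD q α) :=
  (continuous_const.mul continuous_id).smul continuous_const

theorem continuous_coefC_mulVec :
    Continuous fun p : (ℝ × ℝ) × (Fin q → ℝ) => coefC q α β p.1.1 p.1.2 *ᵥ p.2 := by
  have h : (fun p : (ℝ × ℝ) × (Fin q → ℝ) => coefC q α β p.1.1 p.1.2 *ᵥ p.2) =
      fun p => (1 + p.1.2 • matEA q α) *ᵥ (NormedSpace.exp (p.1.1 • matB q β) *ᵥ p.2) := by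
    ext p : 1
    rw [coefC, Matrix.mulVec_mulVec]
  rw [h]
  exact continuous_one_add_smul_mulVec.comp (continuous_fst.snd.prodMk
    (continuous_exp_mulVec.comp (continuous_fst.fst.prodMk continuous_snd)))

theorem continuous_step :
    Continuous fun p : (ℝ≥0 × ℝ) × (Fin q → ℝ) => step q α β p.1 p.2 := by
  have h2 : Continuous fun p : (ℝ≥0 × ℝ) × (Fin q → ℝ) => p.1.2 ^ 2 := continuous_fst.snd.pow 2
  exact (continuous_coefC_mulVec.comp
    (((NNReal.continuous_coe.comp continuous_fst.fst).prodMk h2).prodMk continuous_snd)).add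
    (continuous_coefD.comp h2)

theorem backwardSum_eq (C : ℕ → Matrix (Fin q) (Fin q) ℝ) (D : ℕ → Fin q → ℝ) (n : ℕ)
    (v : Fin q → ℝ) : backwardSum C D n v =
      ∑ i ∈ Finset.range n, ascProd C i *ᵥ D (i + 1) + ascProd C n *ᵥ v := by
  rw [backwardSum]
  congr 1
  cases n with
  | zero => simp
  | succ n =>
    rw [Finset.sum_range_succ', add_comm]
    simp only [ne_eq, Nat.succ_ne_zero, not_false_eq_true, if_true, Nat.add_sub_cancel]
    congr 1
    · rw [Finset.range_eq_Ico, Finset.sum_Ico_add' (fun i => ascProd C i *ᵥ D (i + 1)) 0 n 1,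
        zero_add]
      rfl
    · simp [ascProd]

theorem backwardSum_zero (C : ℕ → Matrix (Fin q) (Fin q) ℝ) (D : ℕ → Fin q → ℝ) (v : Fin q → ℝ) :
    backwardSum C D 0 v = v := by
  simp [backwardSum_eq, ascProd]

theorem backwardSum_succ (C : ℕ → Matrix (Fin q) (Fin q) ℝ) (D : ℕ → Fin q → ℝ) (n : ℕ)
    (v : Fin q → ℝ) : backwardSum C D (n + 1) v =
      C 1 *ᵥ backwardSum (fun i => C (i + 1)) (fun i => D (i + 1)) n v + D 1 := by
  rw [backwardSum_eq, backwardSum_eq, Finset.sum_range_succ', Matrix.mulVec_add, Matrix.mulVec_sum,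
    ascProd_succ']
  simp only [ascProd_succ', Matrix.mulVec_mulVec]
  simp only [ascProd, List.range_zero, List.map_nil, List.prod_nil, Matrix.one_mulVec, zero_add]
  abel

variable (q α β) in
/-- The backward iterates of the recursion driven by a sequence of waiting times and jumps. -/
def backIter (x : ℕ → ℝ≥0 × ℝ) (n : ℕ) (v : Fin q → ℝ) : Fin q → ℝ :=
  backwardSum (driveC q α β x) (driveD q α x) n v

theorem backIter_zero (x : ℕ → ℝ≥0 × ℝ) (v : Fin q → ℝ) : backIter q α β x 0 v = v :=
  backwardSum_zero _ _ _

theorem backIter_succ (x : ℕ → ℝ≥0 × ℝ) (n : ℕ) (v : Fin q → ℝ) :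
    backIter q α β x (n + 1) v = step q α β (x 0) (backIter q α β (tailSeq x) n v) := by
  rw [backIter, backwardSum_succ, step]
  rfl

theorem measurable_step :
    Measurable fun p : (ℝ≥0 × ℝ) × (Fin q → ℝ) => step q α β p.1 p.2 :=
  continuous_step.measurable

theorem measurable_backIter (n : ℕ) :
    Measurable fun p : (ℕ → ℝ≥0 × ℝ) × (Fin q → ℝ) => backIter q α β p.1 n p.2 := by
  induction n with
  | zero => simpa only [backIter_zero] using measurable_snd
  | succ n ih =>
    simp only [backIter_succ]
    have h1 : Measurable fun p : (ℕ → ℝ≥0 × ℝ) × (Fin q → ℝ) => (tailSeq p.1, p.2) :=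
      (measurable_tailSeq.comp measurable_fst).prodMk measurable_snd
    have h0 : Measurable fun p : (ℕ → ℝ≥0 × ℝ) × (Fin q → ℝ) => p.1 0 :=
      (measurable_pi_apply 0).comp measurable_fst
    have h2 := h0.prodMk (ih.comp h1)
    have h3 := (measurable_step (q := q) (α := α) (β := β)).comp h2
    exact h3

end Step

/-! ### Convergence of the backward iterates -/

section Perpetuity

variable {q : ℕ} {α β : ℕ → ℝ} {c lam K : ℝ} {ρ : Matrix (Fin q) (Fin q) ℝ → ℝ}

/-- From `α₀ z ≤ (α₀ / c)(1 + c z)`, the logarithmic moment that controls the matrices also controls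
the inhomogeneity; no further moment condition is required. -/
theorem IsContractive.norm_coefD_le (h : IsContractive q α β c lam K ρ) (hα : 0 < α 0) {z : ℝ}
    (hz : 0 ≤ z) : ‖coefD q α z‖ ≤ α 0 / c * Real.exp (Real.log (1 + c * z)) := by
  have hcz := mul_nonneg h.c_pos.le hz
  rw [Real.exp_log (by linarith), coefD, norm_smul, Real.norm_of_nonneg (mul_nonneg hα.le hz)]
  have he : ‖vecE q‖ ≤ 1 := (pi_norm_le_iff_of_nonneg zero_le_one).2 fun i => by
    rw [vecE]; split_ifs <;> simp
  have h1 : α 0 * z * ‖vecE q‖ ≤ α 0 * z :=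
    mul_le_of_le_one_right (mul_nonneg hα.le hz) he
  refine h1.trans ?_
  have h2 := h.c_pos
  rw [div_mul_eq_mul_div, le_div_iff₀ h2]
  nlinarith

/-- Products contracting at a linear rate, with subexponential inhomogeneities, give an absolutely
convergent series. -/
theorem IsContractive.summable (h : IsContractive q α β c lam K ρ) (hα : 0 < α 0)
    {x : ℕ → ℝ≥0 × ℝ} {m m' : ℝ} (hm : m < 0)
    (h1 : Tendsto (fun n : ℕ => (∑ i ∈ Finset.range n,
      (Real.log (1 + c * (x i).2 ^ 2) + lam * (x i).1)) / n) atTop (𝓝 m))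
    (h2 : Tendsto (fun n : ℕ => (∑ i ∈ Finset.range n,
      Real.log (1 + c * (x i).2 ^ 2)) / n) atTop (𝓝 m')) :
    Summable (fun i => ‖ascProd (driveC q α β x) i *ᵥ driveD q α x (i + 1)‖) ∧
      ∀ v, Tendsto (fun n => ascProd (driveC q α β x) n *ᵥ v) atTop (𝓝 0) := by
  set S : ℕ → ℝ := fun n => ∑ i ∈ Finset.range n,
    (Real.log (1 + c * (x i).2 ^ 2) + lam * (x i).1) with hS
  set U : ℕ → ℝ := fun n => ∑ i ∈ Finset.range n, Real.log (1 + c * (x i).2 ^ 2) with hU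
  have hρ : ∀ n, ρ (ascProd (driveC q α β x) n) ≤ Real.exp (S n) := fun n => by
    have := h.ascProd_le (t := fun i => ((x (i - 1)).1 : ℝ)) (z := fun i => (x (i - 1)).2 ^ 2)
      (fun i => (x (i - 1)).1.2) (fun i => sq_nonneg _) n
    simp only [Nat.add_sub_cancel] at this
    exact this
  have e1 : ∀ᶠ n : ℕ in atTop, S n ≤ m / 2 * n := by
    filter_upwards [h1.eventually (gt_mem_nhds (show m < m / 2 by linarith)),
      eventually_gt_atTop 0] with n hn h0
    have h0' : (0 : ℝ) < n := by exact_mod_cast h0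
    exact ((div_lt_iff₀ h0').1 hn).le
  -- A convergent sequence of averages forces the individual terms to be `o(n)`: each is recovered
  -- from two consecutive averages.
  have e2 : Tendsto (fun n : ℕ => Real.log (1 + c * (x n).2 ^ 2) / n) atTop (𝓝 0) := by
    have h3 : Tendsto (fun n : ℕ => U (n + 1) / ((n + 1 : ℕ) : ℝ) * (((n : ℝ) + 1) / n) - U n / n)
        atTop (𝓝 (m' * 1 - m')) := by
      refine ((h2.comp (tendsto_add_atTop_nat 1)).mul ?_).sub h2
      have := (tendsto_natCast_div_add_atTop (1 : ℝ)).inv₀ one_ne_zero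
      rw [inv_one] at this
      exact this.congr fun n => by rw [inv_div]
    rw [mul_one, sub_self] at h3
    refine h3.congr' ?_
    filter_upwards [eventually_gt_atTop 0] with n h0
    have h0' : (n : ℝ) ≠ 0 := by exact_mod_cast h0.ne'
    have h0'' : (n : ℝ) + 1 ≠ 0 := by positivity
    simp only [hU]
    rw [Finset.sum_range_succ]
    push_cast
    field_simp
    ring
  -- The rate `m / 2` of the product and the growth `-m / 4` of the inhomogeneity leave the negative
  -- exponent `m / 4`.
  have e3 : ∀ᶠ n : ℕ in atTop, Real.log (1 + c * (x n).2 ^ 2) ≤ -m / 4 * n := by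
    filter_upwards [e2.eventually (gt_mem_nhds (show (0 : ℝ) < -m / 4 by linarith)),
      eventually_gt_atTop 0] with n hn h0
    have h0' : (0 : ℝ) < n := by exact_mod_cast h0
    exact ((div_lt_iff₀ h0').1 hn).le
  have hexp : ∀ a : ℝ, a < 0 → Summable fun n : ℕ => Real.exp (a * n) := fun a ha => by
    have := Real.summable_exp_nat_mul_of_ge (c := a) ha (f := fun n => (n : ℝ)) fun n => le_rfl
    exact this
  have hK := h.K_pos
  constructor
  · refine Summable.of_norm_bounded_eventually_nat
      (g := fun n : ℕ => K * (α 0 / c) * Real.exp (m / 4 * n)) ((hexp _ (by linarith)).mul_left _) ?_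
    filter_upwards [e1, e3] with n hn1 hn2
    rw [norm_norm]
    have hD : ‖driveD q α x (n + 1)‖ ≤ α 0 / c * Real.exp (-m / 4 * n) :=
      (h.norm_coefD_le hα (sq_nonneg _)).trans
        (mul_le_mul_of_nonneg_left (Real.exp_le_exp.2 hn2) (div_pos hα h.c_pos).le)
    calc _ ≤ K * ρ (ascProd (driveC q α β x) n) * ‖driveD q α x (n + 1)‖ := h.mulVec_le _ _
      _ ≤ K * Real.exp (m / 2 * n) * (α 0 / c * Real.exp (-m / 4 * n)) := by
        refine mul_le_mul (mul_le_mul_of_nonneg_left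
          ((hρ n).trans (Real.exp_le_exp.2 hn1)) hK.le) hD (norm_nonneg _) (by positivity)
      _ = _ := by
        rw [show m / 4 * (n : ℝ) = m / 2 * n + -m / 4 * n by ring, Real.exp_add]
        ring
  · intro v
    refine squeeze_zero_norm' (a := fun n : ℕ => K * Real.exp (m / 2 * n) * ‖v‖) ?_ ?_
    · filter_upwards [e1] with n hn
      refine (h.mulVec_le _ v).trans (mul_le_mul_of_nonneg_right ?_ (norm_nonneg _))
      exact mul_le_mul_of_nonneg_left ((hρ n).trans (Real.exp_le_exp.2 hn)) hK.le
    · have := (((hexp (m / 2) (by linarith)).tendsto_atTop_zero).const_mul K).mul_const ‖v‖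
      simpa using this

end Perpetuity

/-! ### Perpetuities -/

section Law

variable (q : ℕ) (α β : ℕ → ℝ)

/-- `S` is the sum of the series of backward iterates driven by an i.i.d. sequence with common
law `κ`, the series being absolutely convergent and the products of coefficients tending to `0`. -/
structure IsPerpetuity (κ : Measure (ℝ≥0 × ℝ)) [IsProbabilityMeasure κ]
    (S : (ℕ → ℝ≥0 × ℝ) → Fin q → ℝ) : Prop where
  measurable : Measurable S
  ae_summable : ∀ᵐ x ∂(Measure.infinitePi fun _ : ℕ => κ),
    Summable (fun i => ‖ascProd (driveC q α β x) i *ᵥ driveD q α x (i + 1)‖)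
  ae_hasSum : ∀ᵐ x ∂(Measure.infinitePi fun _ : ℕ => κ),
    HasSum (fun i => ascProd (driveC q α β x) i *ᵥ driveD q α x (i + 1)) (S x)
  ae_tendsto : ∀ᵐ x ∂(Measure.infinitePi fun _ : ℕ => κ), ∀ v,
    Tendsto (fun n => backIter q α β x n v) atTop (𝓝 (S x))

/-- The law of `C X + D` with `X` of law `m` independent of `(C, D)`. -/
def stepLaw (κ : Measure (ℝ≥0 × ℝ)) (m : Measure (Fin q → ℝ)) : Measure (Fin q → ℝ) :=
  (κ.prod m).map fun p => step q α β p.1 p.2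

/-- The law of `e^{BT} X` with `X` of law `m` independent of `T`. -/
def expLaw (τ : Measure ℝ≥0) (m : Measure (Fin q → ℝ)) : Measure (Fin q → ℝ) :=
  (τ.prod m).map fun p => NormedSpace.exp ((p.1 : ℝ) • matB q β) *ᵥ p.2

/-- The law of `(I + Z e a') X + α₀ Z e` with `X` of law `m` independent of `Z`. -/
def jumpLaw (ζ : Measure ℝ) (m : Measure (Fin q → ℝ)) : Measure (Fin q → ℝ) :=
  (ζ.prod m).map fun p => (1 + p.1 ^ 2 • matEA q α) *ᵥ p.2 + coefD q α (p.1 ^ 2)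

/-- The law of `Q X + R` with `X` of law `m` independent of `(Q, R)`. -/
def reverseLaw (κ : Measure (ℝ≥0 × ℝ)) (m : Measure (Fin q → ℝ)) : Measure (Fin q → ℝ) :=
  (κ.prod m).map fun p => coefQ q α β p.1.1 (p.1.2 ^ 2) *ᵥ p.2 + coefR q α β p.1.1 (p.1.2 ^ 2)

variable {q α β}

theorem measurable_exp_mulVec :
    Measurable fun p : ℝ≥0 × (Fin q → ℝ) => NormedSpace.exp ((p.1 : ℝ) • matB q β) *ᵥ p.2 := by
  have h := (continuous_exp_mulVec (q := q) (β := β)).comp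
    ((NNReal.continuous_coe.comp continuous_fst).prodMk
      (continuous_snd : Continuous fun p : ℝ≥0 × (Fin q → ℝ) => p.2))
  exact h.measurable

theorem measurable_jump_affine : Measurable fun p : ℝ × (Fin q → ℝ) =>
    (1 + p.1 ^ 2 • matEA q α) *ᵥ p.2 + coefD q α (p.1 ^ 2) := by
  have h2 : Continuous fun p : ℝ × (Fin q → ℝ) => p.1 ^ 2 := continuous_fst.pow 2
  have h := ((continuous_one_add_smul_mulVec (q := q) (α := α)).comp
    (h2.prodMk continuous_snd)).add ((continuous_coefD (α := α)).comp h2)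
  exact h.measurable

instance (κ : Measure (ℝ≥0 × ℝ)) [IsProbabilityMeasure κ] (m : Measure (Fin q → ℝ))
    [IsProbabilityMeasure m] : IsProbabilityMeasure (stepLaw q α β κ m) :=
  Measure.isProbabilityMeasure_map measurable_step.aemeasurable

instance (τ : Measure ℝ≥0) [IsProbabilityMeasure τ] (m : Measure (Fin q → ℝ))
    [IsProbabilityMeasure m] : IsProbabilityMeasure (expLaw q β τ m) :=
  Measure.isProbabilityMeasure_map measurable_exp_mulVec.aemeasurable

instance (ζ : Measure ℝ) [IsProbabilityMeasure ζ] (m : Measure (Fin q → ℝ))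
    [IsProbabilityMeasure m] : IsProbabilityMeasure (jumpLaw q α ζ m) :=
  Measure.isProbabilityMeasure_map measurable_jump_affine.aemeasurable

/-- With waiting time and jump independent, one step of the recursion is first the flow and then an
independent jump. -/
theorem stepLaw_prod (τ : Measure ℝ≥0) [IsProbabilityMeasure τ] (ζ : Measure ℝ)
    [IsProbabilityMeasure ζ] (m : Measure (Fin q → ℝ)) [IsProbabilityMeasure m] :
    stepLaw q α β (τ.prod ζ) m = jumpLaw q α ζ (expLaw q β τ m) := by
  have h1 : (τ.prod ζ).prod m = ((ζ.prod (τ.prod m)).map MeasurableEquiv.prodAssoc.symm).map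
      (Prod.map Prod.swap id) := by
    rw [(measurePreserving_prodAssoc ζ τ m).symm.map_eq, ← Measure.map_prod_map _ _
      measurable_swap measurable_id, Measure.prod_swap, Measure.map_id]
  have h2 : ζ.prod (expLaw q β τ m) = (ζ.prod (τ.prod m)).map
      (Prod.map id fun p => NormedSpace.exp ((p.1 : ℝ) • matB q β) *ᵥ p.2) := by
    rw [← Measure.map_prod_map _ _ measurable_id measurable_exp_mulVec, Measure.map_id]
    rfl
  rw [stepLaw, jumpLaw, h1, h2, Measure.map_map measurable_step
    (measurable_swap.prodMap measurable_id), Measure.map_map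
    (measurable_step.comp (measurable_swap.prodMap measurable_id)) (MeasurableEquiv.measurable _),
    Measure.map_map measurable_jump_affine (measurable_id.prodMap measurable_exp_mulVec)]
  congr 1
  ext p : 1
  simp [step, stepC, stepD, coefC, MeasurableEquiv.prodAssoc]

/-- The same two independent operations in the opposite order: first the jump, then the flow. -/
theorem reverseLaw_prod (τ : Measure ℝ≥0) [IsProbabilityMeasure τ] (ζ : Measure ℝ)
    [IsProbabilityMeasure ζ] (m : Measure (Fin q → ℝ)) [IsProbabilityMeasure m] :
    reverseLaw q α β (τ.prod ζ) m = expLaw q β τ (jumpLaw q α ζ m) := by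
  have h2 : τ.prod (jumpLaw q α ζ m) = (τ.prod (ζ.prod m)).map
      (Prod.map id fun p => (1 + p.1 ^ 2 • matEA q α) *ᵥ p.2 + coefD q α (p.1 ^ 2)) := by
    rw [← Measure.map_prod_map _ _ measurable_id measurable_jump_affine, Measure.map_id]
    rfl
  rw [reverseLaw, expLaw, h2, Measure.map_map measurable_exp_mulVec
    (measurable_id.prodMap measurable_jump_affine), ← (measurePreserving_prodAssoc τ ζ m).map_eq,
    Measure.map_map (measurable_exp_mulVec.comp (measurable_id.prodMap measurable_jump_affine))
      (MeasurableEquiv.measurable _)]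
  congr 1
  ext p : 1
  simp [coefQ, coefR, coefD, MeasurableEquiv.prodAssoc, Matrix.mulVec_add, Matrix.mulVec_smul]

/-- Backward iterates started from a fixed law keep this law. -/
theorem map_backIter_of_stepLaw_eq {κ : Measure (ℝ≥0 × ℝ)} [IsProbabilityMeasure κ]
    {m : Measure (Fin q → ℝ)} [IsProbabilityMeasure m] (hm : stepLaw q α β κ m = m) (n : ℕ) :
    ((Measure.infinitePi fun _ : ℕ => κ).prod m).map (fun p => backIter q α β p.1 n p.2) = m := by
  induction n with
  | zero =>
    simp only [backIter_zero]
    rw [show (fun p : (ℕ → ℝ≥0 × ℝ) × (Fin q → ℝ) => p.2) = Prod.snd from rfl, Measure.map_snd_prod]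
    simp
  | succ n ih =>
    set I := Measure.infinitePi fun _ : ℕ => κ
    have h1 : κ.prod m = (κ.prod (I.prod m)).map
        (Prod.map id fun p => backIter q α β p.1 n p.2) := by
      rw [← Measure.map_prod_map _ _ measurable_id (measurable_backIter n), Measure.map_id, ih]
    have h2 : κ.prod (I.prod m) = (I.prod m).map (fun p => (p.1 0, (tailSeq p.1, p.2))) := by
      rw [← (measurePreserving_prodAssoc κ I m).map_eq, ← map_head_tail κ]
      conv_lhs => rw [← Measure.map_id (μ := m)]
      rw [Measure.map_prod_map _ _ ((measurable_pi_apply 0).prodMk measurable_tailSeq)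
        measurable_id, Measure.map_map (MeasurableEquiv.measurable _)
        (((measurable_pi_apply 0).prodMk measurable_tailSeq).prodMap measurable_id)]
      rfl
    have hm0 : Measurable fun p : (ℕ → ℝ≥0 × ℝ) × (Fin q → ℝ) => p.1 0 :=
      (measurable_pi_apply 0).comp measurable_fst
    have hm1 : Measurable fun p : (ℕ → ℝ≥0 × ℝ) × (Fin q → ℝ) => (p.1 0, (tailSeq p.1, p.2)) :=
      hm0.prodMk ((measurable_tailSeq.comp measurable_fst).prodMk measurable_snd)
    have hm2 : Measurable (Prod.map (id : ℝ≥0 × ℝ → ℝ≥0 × ℝ)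
        fun p : (ℕ → ℝ≥0 × ℝ) × (Fin q → ℝ) => backIter q α β p.1 n p.2) :=
      measurable_id.prodMap (measurable_backIter n)
    conv_rhs => rw [← hm, stepLaw, h1, h2]
    rw [Measure.map_map hm2 hm1, Measure.map_map measurable_step (hm2.comp hm1)]
    congr 1
    ext p : 1
    rw [backIter_succ]
    rfl

namespace IsPerpetuity

variable {κ : Measure (ℝ≥0 × ℝ)} [IsProbabilityMeasure κ] {S : (ℕ → ℝ≥0 × ℝ) → Fin q → ℝ}
  (hS : IsPerpetuity q α β κ S)

include hS

theorem isProbabilityMeasure :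
    IsProbabilityMeasure ((Measure.infinitePi fun _ : ℕ => κ).map S) :=
  Measure.isProbabilityMeasure_map hS.measurable.aemeasurable

/-- Pass to the limit in `backIter_succ`, using continuity of a single step; the tail sequence also
satisfies the almost sure convergence, being i.i.d. with the same law. -/
theorem ae_eq_step : ∀ᵐ x ∂(Measure.infinitePi fun _ : ℕ => κ),
    S x = step q α β (x 0) (S (tailSeq x)) := by
  filter_upwards [hS.ae_tendsto, (measurePreserving_tailSeq κ).quasiMeasurePreserving.ae
    hS.ae_tendsto] with x hx hx'
  have h1 := (hx 0).comp (tendsto_add_atTop_nat 1)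
  have h2 : Tendsto (fun n => step q α β (x 0) (backIter q α β (tailSeq x) n 0)) atTop
      (𝓝 (step q α β (x 0) (S (tailSeq x)))) := by
    have hc : Continuous fun v => step q α β (x 0) v := by
      have := (continuous_step (q := q) (α := α) (β := β)).comp
        (continuous_const.prodMk continuous_id : Continuous fun v : Fin q → ℝ => (x 0, v))
      exact this
    exact (hc.tendsto _).comp (hx' 0)
  refine tendsto_nhds_unique h1 (h2.congr fun n => ?_)
  rw [Function.comp_apply, backIter_succ]

theorem stepLaw_map : stepLaw q α β κ ((Measure.infinitePi fun _ : ℕ => κ).map S) =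
    (Measure.infinitePi fun _ : ℕ => κ).map S := by
  have h1 : κ.prod ((Measure.infinitePi fun _ : ℕ => κ).map S) =
      (Measure.infinitePi fun _ : ℕ => κ).map (fun x => (x 0, S (tailSeq x))) := by
    have := Measure.map_prod_map κ (Measure.infinitePi fun _ : ℕ => κ) measurable_id hS.measurable
    rw [Measure.map_id] at this
    rw [this, ← map_head_tail κ, Measure.map_map (measurable_id.prodMap hS.measurable)
      ((measurable_pi_apply 0).prodMk measurable_tailSeq)]
    rfl
  have h2 : Measurable fun x : ℕ → ℝ≥0 × ℝ => (x 0, S (tailSeq x)) :=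
    (measurable_pi_apply 0).prodMk (hS.measurable.comp measurable_tailSeq)
  rw [stepLaw, h1, Measure.map_map measurable_step h2]
  exact Measure.map_congr (hS.ae_eq_step.mono fun x hx => hx.symm)

/-- Started from `m`, every backward iterate has law `m`; yet the iterates converge almost surely to
a limit that does not depend on the starting point. -/
theorem eq_map_of_stepLaw_eq {m : Measure (Fin q → ℝ)} [IsProbabilityMeasure m]
    (hm : stepLaw q α β κ m = m) : m = (Measure.infinitePi fun _ : ℕ => κ).map S := by
  have := hS.isProbabilityMeasure
  refine ext_of_forall_integral_eq_of_IsFiniteMeasure fun φ => ?_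
  have h1 : ∀ n, ∫ v, φ v ∂m = ∫ p, φ (backIter q α β p.1 n p.2)
      ∂((Measure.infinitePi fun _ : ℕ => κ).prod m) := fun n => by
    rw [← integral_map (measurable_backIter n).aemeasurable φ.continuous.aestronglyMeasurable,
      map_backIter_of_stepLaw_eq hm]
  have h2 : Tendsto (fun n => ∫ p, φ (backIter q α β p.1 n p.2)
      ∂((Measure.infinitePi fun _ : ℕ => κ).prod m)) atTop
      (𝓝 (∫ p : (ℕ → ℝ≥0 × ℝ) × (Fin q → ℝ), φ (S p.1)
        ∂((Measure.infinitePi fun _ : ℕ => κ).prod m))) := by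
    refine tendsto_integral_of_dominated_convergence (fun _ => ‖φ‖) (fun n => ?_)
      (integrable_const _) (fun n => ae_of_all _ fun p => φ.norm_coe_le_norm _) ?_
    · exact (φ.continuous.measurable.comp (measurable_backIter n)).aestronglyMeasurable
    · have := Measure.quasiMeasurePreserving_fst (μ := Measure.infinitePi fun _ : ℕ => κ) (ν := m)
      filter_upwards [this.ae hS.ae_tendsto] with p hp
      exact (φ.continuous.tendsto _).comp (hp p.2)
  rw [tendsto_nhds_unique (tendsto_const_nhds.congr h1) h2,
    integral_map hS.measurable.aemeasurable φ.continuous.aestronglyMeasurable]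
  have h3 : (Measure.infinitePi fun _ : ℕ => κ) =
      ((Measure.infinitePi fun _ : ℕ => κ).prod m).map Prod.fst := by
    rw [Measure.map_fst_prod]; simp
  conv_rhs => rw [h3]
  rw [integral_map measurable_fst.aemeasurable]
  exact (φ.continuous.measurable.comp hS.measurable).aestronglyMeasurable

end IsPerpetuity

/-- Write `J` for the jump and `E` for the flow acting on laws. If `E J m = m` then `J m` is fixed
by `J E`, hence is the law of the perpetuity, and `m = E (J m)`. Conversely `E` maps a fixed law of
`J E` to one of `E J`. -/
theorem IsPerpetuity.reverseLaw_eq_iff {τ : Measure ℝ≥0} [IsProbabilityMeasure τ] {ζ : Measure ℝ}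
    [IsProbabilityMeasure ζ] {S : (ℕ → ℝ≥0 × ℝ) → Fin q → ℝ}
    (hS : IsPerpetuity q α β (τ.prod ζ) S) {m : Measure (Fin q → ℝ)} [IsProbabilityMeasure m] :
    reverseLaw q α β (τ.prod ζ) m = m ↔
      m = expLaw q β τ ((Measure.infinitePi fun _ : ℕ => τ.prod ζ).map S) := by
  have := hS.isProbabilityMeasure
  constructor
  · intro h
    have h1 : stepLaw q α β (τ.prod ζ) (jumpLaw q α ζ m) = jumpLaw q α ζ m := by
      rw [stepLaw_prod, ← reverseLaw_prod, h]
    rw [← hS.eq_map_of_stepLaw_eq h1, ← reverseLaw_prod, h]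
  · rintro rfl
    rw [reverseLaw_prod, ← stepLaw_prod, hS.stepLaw_map]

/-- The strong law is used twice: for the full exponents, whose mean is negative, and for the
logarithms alone, whose finite mean makes the inhomogeneities subexponential. -/
theorem IsContractive.exists_isPerpetuity {c lam K : ℝ} {ρ : Matrix (Fin q) (Fin q) ℝ → ℝ}
    (h : IsContractive q α β c lam K ρ) (hα : 0 < α 0) {κ : Measure (ℝ≥0 × ℝ)}
    [IsProbabilityMeasure κ] (h1 : Integrable (fun a => Real.log (1 + c * a.2 ^ 2)) κ)
    (h2 : Integrable (fun a => (a.1 : ℝ)) κ)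
    (h3 : ∫ a, (Real.log (1 + c * a.2 ^ 2) + lam * a.1) ∂κ < 0) :
    ∃ S, IsPerpetuity q α β κ S := by
  set I := Measure.infinitePi fun _ : ℕ => κ
  have slln : ∀ g : ℝ≥0 × ℝ → ℝ, Measurable g → Integrable g κ → ∀ᵐ x ∂I,
      Tendsto (fun n : ℕ => (∑ i ∈ Finset.range n, g (x i)) / n) atTop (𝓝 (∫ a, g a ∂κ)) := by
    intro g hg hgi
    have hmap : ∀ i, I.map (fun x => x i) = κ := fun i => Measure.infinitePi_map_eval _ i
    have hg' : Integrable (fun x : ℕ → ℝ≥0 × ℝ => g (x 0)) I := by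
      have : Integrable g (I.map fun x => x 0) := by rwa [hmap]
      exact this.comp_measurable (measurable_pi_apply 0)
    have hindep : iIndepFun (fun i (x : ℕ → ℝ≥0 × ℝ) => g (x i)) I :=
      iIndepFun_infinitePi fun _ => hg
    have := strong_law_ae_real (μ := I) (fun i x => g (x i)) hg'
      (fun i j hij => hindep.indepFun hij) (fun i =>
        ⟨(hg.comp (measurable_pi_apply i)).aemeasurable,
          (hg.comp (measurable_pi_apply 0)).aemeasurable, by
          have e : ∀ i, I.map (fun x => g (x i)) = κ.map g := fun i => by
            rw [← hmap i, Measure.map_map hg (measurable_pi_apply i)]; rfl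
          rw [e, e]⟩)
    have e2 : ∫ x, g (x 0) ∂I = ∫ a, g a ∂κ := by
      rw [← hmap 0, integral_map (measurable_pi_apply 0).aemeasurable hg.aestronglyMeasurable]
    rwa [e2] at this
  have hm1 : Measurable fun a : ℝ≥0 × ℝ => Real.log (1 + c * a.2 ^ 2) := by fun_prop
  have hm2 : Measurable fun a : ℝ≥0 × ℝ => Real.log (1 + c * a.2 ^ 2) + lam * a.1 := by fun_prop
  have hae : ∀ᵐ x ∂I, Summable (fun i => ‖ascProd (driveC q α β x) i *ᵥ driveD q α x (i + 1)‖) ∧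
      ∀ v, Tendsto (fun n => ascProd (driveC q α β x) n *ᵥ v) atTop (𝓝 0) := by
    filter_upwards [slln _ hm1 h1, slln _ hm2 (h1.add (h2.const_mul lam))] with x hx1 hx2
    exact h.summable hα h3 hx2 hx1
  have hback : ∀ x v n, backIter q α β x n v = ∑ i ∈ Finset.range n,
      ascProd (driveC q α β x) i *ᵥ driveD q α x (i + 1) + ascProd (driveC q α β x) n *ᵥ v :=
    fun x v n => backwardSum_eq _ _ _ _
  obtain ⟨S, hS, hS'⟩ := measurable_limit_of_tendsto_metrizable_ae (μ := I) (L := atTop)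
    (f := fun n x => backIter q α β x n 0) (fun n => by
      have : Measurable fun x : ℕ → ℝ≥0 × ℝ => (x, (0 : Fin q → ℝ)) :=
        measurable_id.prodMk measurable_const
      exact ((measurable_backIter n).comp this).aemeasurable) (by
      filter_upwards [hae] with x hx
      simp only [hback, Matrix.mulVec_zero, add_zero]
      exact ⟨_, hx.1.of_norm.hasSum.tendsto_sum_nat⟩)
  refine ⟨S, hS, hae.mono fun x hx => hx.1, ?_, ?_⟩
  · filter_upwards [hae, hS'] with x hx hx'
    simp only [hback, Matrix.mulVec_zero, add_zero] at hx'
    have := hx.1.of_norm.hasSum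
    rwa [← tendsto_nhds_unique hx' this.tendsto_sum_nat] at this
  · filter_upwards [hae, hS'] with x hx hx' v
    simp only [hback, Matrix.mulVec_zero, add_zero] at hx' ⊢
    simpa using hx'.add (hx.2 v)

end Law

/-! ### Reversing the first terms of an i.i.d. sequence -/

section Reversal

variable {q : ℕ} {α β : ℕ → ℝ}

/-- The involution of `ℕ` reversing `{0, …, n - 1}`. -/
def revIndex (n i : ℕ) : ℕ := if i < n then n - 1 - i else i

theorem revIndex_injective (n : ℕ) : Function.Injective (revIndex n) := by
  intro i j h
  simp only [revIndex] at h
  split_ifs at h <;> omega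

/-- The sequence with its first `n` terms in reversed order. -/
def revSeq {E : Type*} (n : ℕ) (x : ℕ → E) : ℕ → E := fun i => x (revIndex n i)

theorem measurePreserving_revSeq {E : Type*} [MeasurableSpace E] (κ : Measure E)
    [IsProbabilityMeasure κ] (n : ℕ) : MeasurePreserving (revSeq n)
    (Measure.infinitePi fun _ : ℕ => κ) (Measure.infinitePi fun _ => κ) :=
  ⟨measurable_pi_lambda _ fun _ => measurable_pi_apply _,
    Measure.map_infinitePi_infinitePi_of_inj (P := fun _ : ℕ => κ) (revIndex_injective n)⟩

/-- The time of the `n`th jump in terms of the waiting times. -/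
def partialTime (x : ℕ → ℝ≥0 × ℝ) (n : ℕ) : ℝ≥0 := ∑ i ∈ Finset.range n, (x i).1

theorem measurable_partialTime (n : ℕ) : Measurable fun x => partialTime x n :=
  Finset.measurable_fun_sum _ fun i _ => measurable_fst.comp (measurable_pi_apply i)

theorem partialTime_revSeq (x : ℕ → ℝ≥0 × ℝ) (n : ℕ) :
    partialTime (revSeq n x) n = partialTime x n := by
  rw [partialTime, partialTime, ← Finset.sum_range_reflect]
  refine Finset.sum_congr rfl fun i hi => ?_
  have := Finset.mem_range.1 hi
  rw [revSeq, revIndex, if_pos (by omega)]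
  congr 2
  omega

/-- The waiting time after the `n`th jump stays in place, so the event of exactly `n` jumps by time
`t` is invariant under the reversal. -/
theorem partialTime_revSeq_succ (x : ℕ → ℝ≥0 × ℝ) (n : ℕ) :
    partialTime (revSeq n x) (n + 1) = partialTime x (n + 1) := by
  have h : revSeq n x n = x n := by rw [revSeq, revIndex, if_neg (lt_irrefl n)]
  have := partialTime_revSeq x n
  simp only [partialTime] at this ⊢
  rw [Finset.sum_range_succ, Finset.sum_range_succ, this, h]

theorem backIter_congr {x y : ℕ → ℝ≥0 × ℝ} {n : ℕ} (h : ∀ i < n, x i = y i) (v : Fin q → ℝ) :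
    backIter q α β x n v = backIter q α β y n v := by
  induction n generalizing x y with
  | zero => rw [backIter_zero, backIter_zero]
  | succ n ih =>
    rw [backIter_succ, backIter_succ, h 0 (by omega), 
      ih (x := tailSeq x) (y := tailSeq y) fun i hi => h (i + 1) (by omega)]

variable (q α β) in
/-- The forward iterates of the recursion driven by a sequence of waiting times and jumps. -/
def fwdIter (x : ℕ → ℝ≥0 × ℝ) (n : ℕ) (v : Fin q → ℝ) : Fin q → ℝ :=
  forwardSum (driveC q α β x) (driveD q α x) n v

/-- The most recent pair acts outermost in the forward iterate; after reversal it stands first, and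
the first pair acts outermost in the backward iterate. -/
theorem fwdIter_eq (x : ℕ → ℝ≥0 × ℝ) (n : ℕ) (v : Fin q → ℝ) :
    fwdIter q α β x n v = backIter q α β (revSeq n x) n v := by
  induction n with
  | zero => rw [fwdIter, forwardSum_zero, backIter_zero]
  | succ n ih =>
    have h0 : revSeq (n + 1) x 0 = x n := by simp [revSeq, revIndex]
    rw [fwdIter, forwardSum_succ, backIter_succ, h0, step]
    congr 2
    refine ih.trans (backIter_congr (fun i hi => ?_) v)
    rw [tailSeq, revSeq, revSeq, revIndex, revIndex, if_pos hi, if_pos (by omega)]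
    congr 1
    omega

theorem measurable_fwdIter (n : ℕ) :
    Measurable fun p : (ℕ → ℝ≥0 × ℝ) × (Fin q → ℝ) => fwdIter q α β p.1 n p.2 := by
  simp only [fwdIter_eq]
  have h : Measurable fun p : (ℕ → ℝ≥0 × ℝ) × (Fin q → ℝ) => (revSeq n p.1, p.2) :=
    (Measurable.comp (g := revSeq n) (measurable_pi_lambda _ fun _ => measurable_pi_apply _)
      measurable_fst).prodMk measurable_snd
  have := (measurable_backIter (q := q) (α := α) (β := β) n).comp h
  exact this

/-- The value at time `t` after exactly `n` jumps has the same law when computed from the forward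
and from the backward iterate. -/
theorem measure_fwdIter_eq (κ : Measure (ℝ≥0 × ℝ)) [IsProbabilityMeasure κ]
    (m : Measure (Fin q → ℝ)) [IsProbabilityMeasure m] (t : ℝ≥0) (n : ℕ) {A : Set (Fin q → ℝ)}
    (hA : MeasurableSet A) :
    ((Measure.infinitePi fun _ : ℕ => κ).prod m) {p | partialTime p.1 n ≤ t ∧
      t < partialTime p.1 (n + 1) ∧ NormedSpace.exp (((t - partialTime p.1 n : ℝ≥0) : ℝ) • matB q β)
        *ᵥ fwdIter q α β p.1 n p.2 ∈ A} =
    ((Measure.infinitePi fun _ : ℕ => κ).prod m) {p | partialTime p.1 n ≤ t ∧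
      t < partialTime p.1 (n + 1) ∧ NormedSpace.exp (((t - partialTime p.1 n : ℝ≥0) : ℝ) • matB q β)
        *ᵥ backIter q α β p.1 n p.2 ∈ A} := by
  have hmp := (measurePreserving_revSeq κ n).prod (MeasurePreserving.id m)
  have hm1 : ∀ k, Measurable fun p : (ℕ → ℝ≥0 × ℝ) × (Fin q → ℝ) => partialTime p.1 k := fun k =>
    (measurable_partialTime k).comp measurable_fst
  have hm2 := (measurable_exp_mulVec (q := q) (β := β)).comp
    (((measurable_const (a := t)).sub (hm1 n)).prodMk (measurable_backIter (α := α) (β := β) n))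
  have hms : MeasurableSet {p : (ℕ → ℝ≥0 × ℝ) × (Fin q → ℝ) | partialTime p.1 n ≤ t ∧
      t < partialTime p.1 (n + 1) ∧ NormedSpace.exp (((t - partialTime p.1 n : ℝ≥0) : ℝ) • matB q β)
        *ᵥ backIter q α β p.1 n p.2 ∈ A} :=
    (measurableSet_le (hm1 n) measurable_const).inter
      ((measurableSet_lt measurable_const (hm1 (n + 1))).inter (hm2 hA))
  rw [← hmp.measure_preimage hms.nullMeasurableSet]
  congr 1
  ext p
  simp only [Set.mem_ofPred_eq, Set.mem_preimage, Prod.map_fst, Prod.map_snd, id,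
    partialTime_revSeq, partialTime_revSeq_succ, fwdIter_eq]

end Reversal

/-! ### The state process as a function of the driving path -/

section State

variable {q : ℕ} {α β : ℕ → ℝ}

variable (q α β) in
/-- The state at time `t` as a function of the driving path and the initial value. -/
def fwdState (t : ℝ≥0) (p : CadlagPath × (Fin q → ℝ)) : Fin q → ℝ :=
  NormedSpace.exp ((age t p.1.1 : ℝ) • matB q β) *ᵥ
    fwdIter q α β (jumpSeq p.1.1) (jumpCount p.1.1 t) p.2

variable (q α β) in
/-- The backward iterate at the number of jumps up to time `u`. -/
def backCount (u : ℝ≥0) (p : CadlagPath × (Fin q → ℝ)) : Fin q → ℝ :=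
  backIter q α β (jumpSeq p.1.1) (jumpCount p.1.1 u) p.2

variable (q α β) in
/-- The analogue of `fwdState` with the backward iterate. -/
def backState (t : ℝ≥0) (p : CadlagPath × (Fin q → ℝ)) : Fin q → ℝ :=
  NormedSpace.exp ((age t p.1.1 : ℝ) • matB q β) *ᵥ backCount q α β t p

theorem measurable_comp_jumpCount {G : ℕ → (ℕ → ℝ≥0 × ℝ) × (Fin q → ℝ) → Fin q → ℝ}
    (hG : ∀ n, Measurable (G n)) (t : ℝ≥0) :
    Measurable fun p : CadlagPath × (Fin q → ℝ) => G (jumpCount p.1.1 t) (jumpSeq p.1.1, p.2) := by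
  have h1 : Measurable fun r : (CadlagPath × (Fin q → ℝ)) × ℕ => G r.2 (jumpSeq r.1.1.1, r.1.2) := by
    refine measurable_from_prod_countable_left fun n => ?_
    have h : Measurable fun p : CadlagPath × (Fin q → ℝ) => (jumpSeq p.1.1, p.2) :=
      (measurable_jumpSeq.comp measurable_fst).prodMk measurable_snd
    have := (hG n).comp h
    exact this
  have h2 : Measurable fun p : CadlagPath × (Fin q → ℝ) => (p, jumpCount p.1.1 t) :=
    measurable_id.prodMk ((measurable_jumpCount t).comp measurable_fst)
  have := h1.comp h2
  exact this

theorem measurable_backCount (u : ℝ≥0) : Measurable (backCount q α β u) :=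
  measurable_comp_jumpCount (G := fun n p => backIter q α β p.1 n p.2)
    (fun n => measurable_backIter n) u

theorem measurable_backState (t : ℝ≥0) : Measurable (backState q α β t) := by
  have := (measurable_exp_mulVec (q := q) (β := β)).comp
    (((measurable_age t).comp measurable_fst).prodMk (measurable_backCount (α := α) (β := β) t))
  exact this

theorem measurable_fwdState (t : ℝ≥0) : Measurable (fwdState q α β t) := by
  have := (measurable_exp_mulVec (q := q) (β := β)).comp
    (((measurable_age t).comp measurable_fst).prodMk
      (measurable_comp_jumpCount (G := fun n p => fwdIter q α β p.1 n p.2)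
        (fun n => measurable_fwdIter n) t))
  exact this

/-- Split according to the number of jumps. On each piece everything is a function of the i.i.d.
pairs and of the independent starting value, so the reversal of finitely many pairs applies. -/
theorem IsLevyLaw.map_fwdState {μ : Measure CadlagPath} [IsProbabilityMeasure μ]
    (hμ : IsLevyLaw μ) (hreg : ∀ᵐ f ∂μ, IsRegular f.1) (m : Measure (Fin q → ℝ))
    [IsProbabilityMeasure m] (t : ℝ≥0) :
    (μ.prod m).map (fwdState q α β t) = (μ.prod m).map (backState q α β t) := by
  have hm0 : Measurable fun f : CadlagPath => jumpSeq f.1 0 :=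
    (measurable_pi_apply 0).comp measurable_jumpSeq
  have := Measure.isProbabilityMeasure_map (μ := μ) hm0.aemeasurable
  set κ := μ.map (fun f : CadlagPath => jumpSeq f.1 0) with hκ
  have hjoint : (μ.prod m).map (Prod.map (fun f : CadlagPath => jumpSeq f.1) id) =
      (Measure.infinitePi fun _ : ℕ => κ).prod m := by
    rw [← Measure.map_prod_map _ _ measurable_jumpSeq measurable_id, Measure.map_id,
      hμ.map_jumpSeq hreg]
  have hcnt : Measurable fun p : CadlagPath × (Fin q → ℝ) => jumpCount p.1.1 t :=
    (measurable_jumpCount t).comp measurable_fst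
  have key : ∀ (H : (ℕ → ℝ≥0 × ℝ) → ℕ → (Fin q → ℝ) → Fin q → ℝ)
      (_ : ∀ n, Measurable fun p : (ℕ → ℝ≥0 × ℝ) × (Fin q → ℝ) => H p.1 n p.2)
      (A : Set (Fin q → ℝ)) (_ : MeasurableSet A) (n : ℕ),
      (μ.prod m) ((fun p => NormedSpace.exp ((age t p.1.1 : ℝ) • matB q β) *ᵥ
        H (jumpSeq p.1.1) (jumpCount p.1.1 t) p.2) ⁻¹' A ∩ (fun p => jumpCount p.1.1 t) ⁻¹' {n}) =
      ((Measure.infinitePi fun _ : ℕ => κ).prod m) {p | partialTime p.1 n ≤ t ∧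
        t < partialTime p.1 (n + 1) ∧ NormedSpace.exp (((t - partialTime p.1 n : ℝ≥0) : ℝ) •
          matB q β) *ᵥ H p.1 n p.2 ∈ A} := by
    intro H hH A hA n
    have hm1 : ∀ k, Measurable fun p : (ℕ → ℝ≥0 × ℝ) × (Fin q → ℝ) => partialTime p.1 k :=
      fun k => (measurable_partialTime k).comp measurable_fst
    have hm2 := (measurable_exp_mulVec (q := q) (β := β)).comp
      (((measurable_const (a := t)).sub (hm1 n)).prodMk (hH n))
    have hms : MeasurableSet {p : (ℕ → ℝ≥0 × ℝ) × (Fin q → ℝ) | partialTime p.1 n ≤ t ∧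
        t < partialTime p.1 (n + 1) ∧ NormedSpace.exp (((t - partialTime p.1 n : ℝ≥0) : ℝ) •
          matB q β) *ᵥ H p.1 n p.2 ∈ A} :=
      (measurableSet_le (hm1 n) measurable_const).inter
        ((measurableSet_lt measurable_const (hm1 (n + 1))).inter (hm2 hA))
    rw [← hjoint, Measure.map_apply (measurable_jumpSeq.prodMap measurable_id) hms]
    refine measure_congr (Filter.eventuallyEq_set.2 ?_)
    have hq := Measure.quasiMeasurePreserving_fst (μ := μ) (ν := m)
    filter_upwards [hq.ae hreg] with p hp
    have h1 : ∀ n, partialTime (jumpSeq p.1.1) n = arrival n p.1.1 := hp.sum_waits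
    simp only [Set.mem_inter_iff, Set.mem_preimage, Set.mem_singleton_iff, Set.mem_ofPred_eq,
      Prod.map_fst, Prod.map_snd, id, h1]
    constructor
    · rintro ⟨h2, h3⟩
      obtain ⟨h4, h5⟩ := (hp.jumpCount_eq_iff _ _).1 h3
      rw [age, h3] at h2
      exact ⟨h4, h5, h2⟩
    · rintro ⟨h4, h5, h2⟩
      have h3 := (hp.jumpCount_eq_iff _ _).2 ⟨h4, h5⟩
      rw [age, h3]
      exact ⟨h2, rfl⟩
  ext A hA
  rw [Measure.map_apply (measurable_fwdState t) hA, Measure.map_apply (measurable_backState t) hA,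
    measure_eq_tsum_inter_preimage _ hcnt (measurable_fwdState t hA),
    measure_eq_tsum_inter_preimage _ hcnt (measurable_backState t hA)]
  refine tsum_congr fun n => ?_
  have e1 := key (fwdIter q α β) measurable_fwdIter A hA n
  have e2 := key (backIter q α β) measurable_backIter A hA n
  rw [measure_fwdIter_eq κ m t n hA] at e1
  exact e1.trans e2.symm

end State

/-! ### Convergence in distribution of the state process -/

section Limit

open CadlagPath

variable {q : ℕ} {α β : ℕ → ℝ} {μ : Measure CadlagPath} [IsProbabilityMeasure μ]
  {m : Measure (Fin q → ℝ)} [IsProbabilityMeasure m]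

theorem backCount_stopAt {f : CadlagPath} (hf : IsRegular f.1) (u : ℝ≥0) (v : Fin q → ℝ) :
    backCount q α β u (stopAt u f, v) = backCount q α β u (f, v) := by
  simp only [backCount, stopAt]
  rw [f.2.jumpCount_stopPath]
  refine backIter_congr (fun i hi => ?_) v
  rw [jumpSeq, jumpSeq, hf.arrival_stopPath f.2 hi, hf.arrival_stopPath f.2 hi.le,
    hf.mark_stopPath f.2 hi]

/-- The backward iterate at the count up to `u` depends only on the path stopped at `u` and on the
starting value, and both are jointly independent of the path after `u`. -/
theorem IsLevyLaw.indepFun_backCount_shift (hμ : IsLevyLaw μ) (hreg : ∀ᵐ f ∂μ, IsRegular f.1)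
    (u : ℝ≥0) : IndepFun (backCount q α β u) (fun p => shift u p.1) (μ.prod m) := by
  have h1 : IndepFun (fun p : CadlagPath × (Fin q → ℝ) => p.2)
      (fun p => (stopAt u p.1, shift u p.1)) (μ.prod m) := by
    have h := (indepFun_prod (μ := μ) (ν := m) (X := fun f => (stopAt u f, shift u f)) (Y := id)
      ((measurable_stopAt u).prodMk (measurable_shift u)) measurable_id).symm
    exact h
  have h2 : IndepFun (fun p : CadlagPath × (Fin q → ℝ) => stopAt u p.1) (fun p => shift u p.1)
      (μ.prod m) := by
    have h3 : (μ.prod m).map Prod.fst = μ := by rw [Measure.map_fst_prod]; simp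
    have h := hμ.indep u
    rw [indepFun_iff_measure_inter_preimage_eq_mul] at h ⊢
    intro A B hA hB
    have := h A B hA hB
    rw [← h3, Measure.map_apply measurable_fst ((measurable_stopAt u hA).inter (measurable_shift u hB)),
      Measure.map_apply measurable_fst (measurable_stopAt u hA),
      Measure.map_apply measurable_fst (measurable_shift u hB)] at this
    exact this
  have h3 := indepFun_prodMk_of_indepFun measurable_snd ((measurable_stopAt u).comp measurable_fst)
    ((measurable_shift u).comp measurable_fst) h1 h2
  have h4 := h3.comp (φ := fun r : (Fin q → ℝ) × CadlagPath => backCount q α β u (r.2, r.1))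
    (ψ := id) ((measurable_backCount u).comp (measurable_snd.prodMk measurable_fst)) measurable_id
  refine h4.congr ?_ (ae_eq_refl _)
  filter_upwards [(Measure.quasiMeasurePreserving_fst (μ := μ) (ν := m)).ae hreg] with p hp
  exact backCount_stopAt hp u p.2

/-- Independence and the law of the elapsed time allow the latter to be realised by a separate copy
of the path; this copy provides the independent `T` of the limit. -/
theorem IsLevyLaw.map_age_shift_backCount (hμ : IsLevyLaw μ) (hreg : ∀ᵐ f ∂μ, IsRegular f.1)
    (hr' : jumpRate μ ≠ ⊤) (u s : ℝ≥0) :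
    (μ.prod m).map (fun p => (age s (shift u p.1).1, backCount q α β u p)) =
      (μ.prod (μ.prod m)).map (fun r => (min (arrival 1 r.1.1) s, backCount q α β u r.2)) := by
  have hm1 : Measurable fun p : CadlagPath × (Fin q → ℝ) => age s (shift u p.1).1 :=
    (measurable_age s).comp ((measurable_shift u).comp measurable_fst)
  have hm2 : Measurable fun f : CadlagPath => min (arrival 1 f.1) s :=
    (measurable_arrival 1).min measurable_const
  have h := (hμ.indepFun_backCount_shift (α := α) (β := β) (m := m) hreg u).comp
    measurable_id (measurable_age s)
  have h2 : IndepFun (fun p : CadlagPath × (Fin q → ℝ) => age s (shift u p.1).1)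
      (backCount q α β u) (μ.prod m) := h.symm
  rw [indepFun_iff_map_prod_eq_prod_map_map hm1.aemeasurable
    (measurable_backCount u).aemeasurable] at h2
  have h3 : (μ.prod m).map (fun p => age s (shift u p.1).1) =
      μ.map (fun f => min (arrival 1 f.1) s) := by
    rw [← hμ.map_age hreg hr' s]
    have e1 : (μ.prod m).map Prod.fst = μ := by rw [Measure.map_fst_prod]; simp
    conv_rhs => rw [← hμ.map_shift u, ← e1]
    rw [Measure.map_map (measurable_shift u) measurable_fst,
      Measure.map_map (measurable_age s) ((measurable_shift u).comp measurable_fst)]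
    rfl
  rw [h2, h3, Measure.map_prod_map _ _ hm2 (measurable_backCount u)]
  rfl

/-- First `t → ∞` with `u` fixed, then `u → ∞`; the error has to vanish only in this iterated sense.
-/
theorem tendsto_of_double_limit {a : ℝ≥0 → ℝ} {I e : ℝ≥0 → ℝ≥0 → ℝ} {J e' : ℝ≥0 → ℝ} {l : ℝ}
    (hI : ∀ u, Tendsto (I u) atTop (𝓝 (J u))) (hJ : Tendsto J atTop (𝓝 l))
    (he : ∀ u, Tendsto (e u) atTop (𝓝 (e' u))) (he' : Tendsto e' atTop (𝓝 0))
    (h : ∀ u t, u ≤ t → |a t - I u t| ≤ e u t) : Tendsto a atTop (𝓝 l) := by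
  refine Metric.tendsto_nhds.2 fun ε hε => ?_
  have hε4 : 0 < ε / 4 := by linarith
  obtain ⟨u, hu1, hu2⟩ := ((Metric.tendsto_nhds.1 hJ _ hε4).and
    (he'.eventually (gt_mem_nhds hε4))).exists
  filter_upwards [Metric.tendsto_nhds.1 (hI u) _ hε4,
    (he u).eventually (gt_mem_nhds (show e' u < ε / 2 by linarith)), eventually_ge_atTop u]
    with t ht1 ht2 ht3
  rw [Real.dist_eq] at hu1 ht1 ⊢
  have h1 := h u t ht3
  rw [abs_lt] at *
  have h2 := abs_le.1 h1
  constructor <;> linarith [h2.1, h2.2, hu1.1, hu1.2, ht1.1, ht1.2]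

/-- The law of `Y_∞`. -/
theorem expLaw_eq_map {S : (ℕ → ℝ≥0 × ℝ) → Fin q → ℝ} (hSm : Measurable S)
    (β : ℕ → ℝ) : expLaw q β (μ.map fun f => arrival 1 f.1)
      ((μ.map fun f : CadlagPath => jumpSeq f.1).map S) =
      (μ.prod (μ.prod m)).map (fun r => NormedSpace.exp ((arrival 1 r.1.1 : ℝ) • matB q β) *ᵥ
        S (jumpSeq r.2.1.1)) := by
  have hm2 : Measurable fun p : CadlagPath × (Fin q → ℝ) => S (jumpSeq p.1.1) :=
    hSm.comp (measurable_jumpSeq.comp measurable_fst)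
  have e1 : (μ.map fun f : CadlagPath => jumpSeq f.1).map S =
      (μ.prod m).map (fun p => S (jumpSeq p.1.1)) := by
    have e1 : (μ.prod m).map Prod.fst = μ := by rw [Measure.map_fst_prod]; simp
    conv_lhs => rw [← e1]
    rw [Measure.map_map measurable_jumpSeq measurable_fst,
      Measure.map_map hSm (measurable_jumpSeq.comp measurable_fst)]
    rfl
  rw [e1, expLaw, Measure.map_prod_map _ _ (measurable_arrival 1) hm2,
    Measure.map_map measurable_exp_mulVec ((measurable_arrival 1).prodMap hm2)]
  rfl

/-- Compare the state at `t` with the one in which the backward iterate is frozen at `u` and the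
elapsed time is read off the path after `u`. If a jump occurs in `(u, t]` the elapsed times agree
and the error is Lipschitz in the change of the iterate, uniformly in the flow time by `hK`;
otherwise it is at most `b`. Frozen iterate and elapsed time are independent. -/
theorem IsLevyLaw.tendsto_integral_backState (hμ : IsLevyLaw μ) (hreg : ∀ᵐ f ∂μ, IsRegular f.1)
    (hr' : jumpRate μ ≠ ⊤) {κ : Measure (ℝ≥0 × ℝ)} [IsProbabilityMeasure κ]
    (hκ : μ.map (fun f => jumpSeq f.1) = Measure.infinitePi fun _ : ℕ => κ)
    {S : (ℕ → ℝ≥0 × ℝ) → Fin q → ℝ} (hS : IsPerpetuity q α β κ S) {K : ℝ} (hK0 : 0 ≤ K)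
    (hK : ∀ (s : ℝ≥0) (v : Fin q → ℝ), ‖NormedSpace.exp ((s : ℝ) • matB q β) *ᵥ v‖ ≤ K * ‖v‖)
    {h : (Fin q → ℝ) → ℝ} {b : ℝ} (hb : ∀ x y, dist (h x) (h y) ≤ b) {l : ℝ≥0}
    (hl : LipschitzWith l h) :
    Tendsto (fun t => ∫ p, h (backState q α β t p) ∂(μ.prod m)) atTop
      (𝓝 (∫ v, h v ∂(expLaw q β (μ.map fun f => arrival 1 f.1)
        ((μ.map fun f : CadlagPath => jumpSeq f.1).map S)))) := by
  have hb0 : 0 ≤ b := dist_nonneg.trans (hb 0 0)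
  have hhm : Measurable h := hl.continuous.measurable
  have hbound : ∀ x, ‖h x‖ ≤ ‖h 0‖ + b := fun x => by
    have h1 := hb x 0
    rw [dist_eq_norm] at h1
    have h2 := norm_sub_norm_le (h x) (h 0)
    linarith
  have hfst := Measure.quasiMeasurePreserving_fst (μ := μ) (ν := m)
  have hreg' : ∀ᵐ p ∂(μ.prod m), IsRegular p.1.1 := hfst.ae hreg
  have hconv : ∀ᵐ p ∂(μ.prod m), Tendsto (fun t => backCount q α β t p) atTop
      (𝓝 (S (jumpSeq p.1.1))) := by
    have h1 : ∀ᵐ f : CadlagPath ∂μ, ∀ v, Tendsto (fun n => backIter q α β (jumpSeq f.1) n v) atTop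
        (𝓝 (S (jumpSeq f.1))) := by
      have h2 := hS.ae_tendsto
      rw [← hκ] at h2
      exact ae_of_ae_map measurable_jumpSeq.aemeasurable h2
    filter_upwards [hfst.ae h1, hreg'] with p hp hp'
    exact (hp p.2).comp hp'.tendsto_jumpCount
  have hSm : Measurable fun p : CadlagPath × (Fin q → ℝ) => S (jumpSeq p.1.1) :=
    hS.measurable.comp (measurable_jumpSeq.comp measurable_fst)
  have hΦ := measurable_exp_mulVec (q := q) (β := β)
  have hΦc : ∀ s : ℝ≥0, Continuous fun v : Fin q → ℝ =>
      NormedSpace.exp ((s : ℝ) • matB q β) *ᵥ v := fun s =>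
    continuous_const.matrix_mulVec continuous_id
  have hm3 : ∀ u s, Measurable fun r : CadlagPath × (CadlagPath × (Fin q → ℝ)) =>
      (min (arrival 1 r.1.1) s, backCount q α β u r.2) := fun u s =>
    (((measurable_arrival 1).comp measurable_fst).min measurable_const).prodMk
      ((measurable_backCount u).comp measurable_snd)
  have hm4 : ∀ u, Measurable fun r : CadlagPath × (CadlagPath × (Fin q → ℝ)) =>
      (arrival 1 r.1.1, backCount q α β u r.2) := fun u =>
    ((measurable_arrival 1).comp measurable_fst).prodMk
      ((measurable_backCount u).comp measurable_snd)
  have hm5 : ∀ u s, Measurable fun p : CadlagPath × (Fin q → ℝ) =>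
      (age s (shift u p.1).1, backCount q α β u p) := fun u s =>
    ((measurable_age s).comp ((measurable_shift u).comp measurable_fst)).prodMk
      (measurable_backCount u)
  have hm6 : Measurable fun r : CadlagPath × (CadlagPath × (Fin q → ℝ)) =>
      (arrival 1 r.1.1, S (jumpSeq r.2.1.1)) :=
    ((measurable_arrival 1).comp measurable_fst).prodMk (hSm.comp measurable_snd)
  set H : ℝ≥0 × (Fin q → ℝ) → ℝ := fun r => h (NormedSpace.exp ((r.1 : ℝ) • matB q β) *ᵥ r.2)
    with hH
  have hHm : Measurable H := hhm.comp hΦ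
  have hE1 : ∀ t u, AEStronglyMeasurable (fun p : CadlagPath × (Fin q → ℝ) =>
      min b (l * (K * ‖backCount q α β t p - backCount q α β u p‖)) +
        if jumpCount p.1.1 t ≤ jumpCount p.1.1 u then b else 0) (μ.prod m) := by
    intro t u
    have hcount : ∀ t, Measurable fun p : CadlagPath × (Fin q → ℝ) => jumpCount p.1.1 t :=
      fun t => (measurable_jumpCount t).comp measurable_fst
    refine (Measurable.add ?_ (Measurable.ite (measurableSet_le (hcount t) (hcount u))
      measurable_const measurable_const)).aestronglyMeasurable
    exact measurable_const.min ((((measurable_backCount t).sub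
      (measurable_backCount u)).norm.const_mul K).const_mul (l : ℝ))
  have hE2 : ∀ t u (p : CadlagPath × (Fin q → ℝ)),
      ‖min b (l * (K * ‖backCount q α β t p - backCount q α β u p‖)) +
        if jumpCount p.1.1 t ≤ jumpCount p.1.1 u then b else 0‖ ≤ b + b := by
    intro t u p
    have h1 : 0 ≤ l * (K * ‖backCount q α β t p - backCount q α β u p‖) := by positivity
    have h2 : 0 ≤ min b (l * (K * ‖backCount q α β t p - backCount q α β u p‖)) := le_min hb0 h1
    have h3 : (0 : ℝ) ≤ if jumpCount p.1.1 t ≤ jumpCount p.1.1 u then b else 0 := by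
      split_ifs
      exacts [hb0, le_rfl]
    have h4 : (if jumpCount p.1.1 t ≤ jumpCount p.1.1 u then b else 0) ≤ b := by
      split_ifs
      exacts [le_rfl, hb0]
    rw [Real.norm_of_nonneg (add_nonneg h2 h3)]
    exact add_le_add (min_le_left _ _) h4
  refine tendsto_of_double_limit
    (I := fun u t => ∫ p, H (age (t - u) (shift u p.1).1, backCount q α β u p) ∂(μ.prod m))
    (J := fun u => ∫ r, H (arrival 1 r.1.1, backCount q α β u r.2) ∂(μ.prod (μ.prod m)))
    (e := fun u t => ∫ p, (min b (l * (K * ‖backCount q α β t p - backCount q α β u p‖)) +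
      if jumpCount p.1.1 t ≤ jumpCount p.1.1 u then b else 0) ∂(μ.prod m))
    (e' := fun u => ∫ p, min b (l * (K * ‖S (jumpSeq p.1.1) - backCount q α β u p‖)) ∂(μ.prod m))
    (fun u => ?_) ?_ (fun u => ?_) ?_ (fun u t hut => ?_)
  · have e1 : ∀ s, ∫ p, H (age s (shift u p.1).1, backCount q α β u p) ∂(μ.prod m) =
        ∫ r, H (min (arrival 1 r.1.1) s, backCount q α β u r.2) ∂(μ.prod (μ.prod m)) := by
      intro s
      rw [← integral_map (hm5 u s).aemeasurable hHm.aestronglyMeasurable,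
        hμ.map_age_shift_backCount hreg hr', integral_map (hm3 u s).aemeasurable
          hHm.aestronglyMeasurable]
    simp only [e1]
    refine tendsto_integral_filter_of_dominated_convergence (fun _ => ‖h 0‖ + b)
      (Eventually.of_forall fun t => (hHm.comp (hm3 u _)).aestronglyMeasurable)
      (Eventually.of_forall fun t => ae_of_all _ fun r => hbound _) (integrable_const _)
      (ae_of_all _ fun r => tendsto_const_nhds.congr' ?_)
    filter_upwards [eventually_ge_atTop (u + arrival 1 r.1.1)] with t ht
    rw [min_eq_left (le_tsub_of_add_le_left ht)]
  · have e1 : ∫ v, h v ∂(expLaw q β (μ.map fun f => arrival 1 f.1)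
        ((μ.map fun f : CadlagPath => jumpSeq f.1).map S)) =
        ∫ r, H (arrival 1 r.1.1, S (jumpSeq r.2.1.1)) ∂(μ.prod (μ.prod m)) := by
      rw [expLaw_eq_map (m := m) hS.measurable β]
      exact integral_map (hΦ.comp hm6).aemeasurable hhm.aestronglyMeasurable
    rw [e1]
    refine tendsto_integral_filter_of_dominated_convergence (fun _ => ‖h 0‖ + b)
      (Eventually.of_forall fun t => (hHm.comp (hm4 _)).aestronglyMeasurable)
      (Eventually.of_forall fun t => ae_of_all _ fun r => hbound _) (integrable_const _) ?_
    filter_upwards [(Measure.quasiMeasurePreserving_snd (μ := μ) (ν := μ.prod m)).ae hconv] with r hr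
    exact ((hl.continuous.comp (hΦc _)).tendsto _).comp hr
  -- For fixed `u`, the indicator of no jump in `(u, t]` eventually vanishes almost surely, and the
  -- iterate converges.
  · refine tendsto_integral_filter_of_dominated_convergence (fun _ => b + b)
      (Eventually.of_forall fun t => ?_)
      (Eventually.of_forall fun t => ae_of_all _ fun p => ?_) (integrable_const _) ?_
    · exact hE1 t u
    · exact hE2 t u p
    · filter_upwards [hconv, hreg'] with p hp hp'
      have h1 : Tendsto (fun t => min b (l * (K * ‖backCount q α β t p - backCount q α β u p‖)))
          atTop (𝓝 (min b (l * (K * ‖S (jumpSeq p.1.1) - backCount q α β u p‖)))) :=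
        tendsto_const_nhds.min (((hp.sub_const _).norm.const_mul K).const_mul _)
      refine h1.congr' ?_
      filter_upwards [hp'.tendsto_jumpCount.eventually_gt_atTop (jumpCount p.1.1 u)] with t ht
      rw [if_neg (not_le.2 ht), add_zero]
  · have : (0 : ℝ) = ∫ p : CadlagPath × (Fin q → ℝ), min b (l * (K * ‖S (jumpSeq p.1.1) -
        S (jumpSeq p.1.1)‖)) ∂(μ.prod m) := by
      simp [hb0]
    rw [this]
    refine tendsto_integral_filter_of_dominated_convergence (fun _ => b)
      (Eventually.of_forall fun t => ?_)
      (Eventually.of_forall fun t => ae_of_all _ fun p => ?_) (integrable_const _) ?_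
    · exact (measurable_const.min (((hSm.sub
        (measurable_backCount t)).norm.const_mul K).const_mul (l : ℝ))).aestronglyMeasurable
    · have h1 : 0 ≤ l * (K * ‖S (jumpSeq p.1.1) - backCount q α β t p‖) := by positivity
      rw [Real.norm_of_nonneg (le_min hb0 h1)]
      exact min_le_left _ _
    · filter_upwards [hconv] with p hp
      exact tendsto_const_nhds.min (((tendsto_const_nhds.sub hp).norm.const_mul K).const_mul _)
  · have i1 : Integrable (fun p => h (backState q α β t p)) (μ.prod m) :=
      Integrable.of_bound (hhm.comp (measurable_backState t)).aestronglyMeasurable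
        (‖h 0‖ + b) (ae_of_all _ fun p => hbound _)
    have i2 : Integrable (fun p => H (age (t - u) (shift u p.1).1, backCount q α β u p))
        (μ.prod m) :=
      Integrable.of_bound (hHm.comp (hm5 u (t - u))).aestronglyMeasurable
        (‖h 0‖ + b) (ae_of_all _ fun p => hbound _)
    rw [← integral_sub i1 i2, ← Real.norm_eq_abs]
    refine norm_integral_le_of_norm_le ?_ ?_
    · exact Integrable.of_bound (hE1 t u) (b + b) (ae_of_all _ (hE2 t u))
    · filter_upwards [hreg'] with p hp
      rw [← dist_eq_norm]
      have h1 : 0 ≤ l * (K * ‖backCount q α β t p - backCount q α β u p‖) := by positivity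
      have h2 : 0 ≤ min b (l * (K * ‖backCount q α β t p - backCount q α β u p‖)) :=
        le_min hb0 h1
      split_ifs with hc
      · exact (hb _ _).trans (le_add_of_nonneg_left h2)
      · rw [add_zero]
        refine le_min (hb _ _) ?_
        have h3 : age (t - u) (shift u p.1).1 = age t p.1.1 :=
          hp.age_shiftPath p.1.2 hut (not_le.1 hc)
        simp only [hH, backState, h3]
        refine (hl.dist_le_mul _ _).trans (mul_le_mul_of_nonneg_left ?_ l.2)
        rw [dist_eq_norm, ← Matrix.mulVec_sub]
        exact hK _ _

end Limit

/-! ### The Lévy measure and the drift condition -/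

section LevyMeasure

open CadlagPath

/-- The count agrees almost everywhere with a measurable series over arrivals; this justifies
transferring the defining integral of the Lévy measure to the path space. -/
theorem aemeasurable_encard_jumps {μ : Measure CadlagPath} (hreg : ∀ᵐ f ∂μ, IsRegular f.1)
    {A : Set ℝ} (hAm : MeasurableSet A) (hA : (0 : ℝ) ∉ A) :
    AEMeasurable (fun f : CadlagPath =>
      (({s ∈ Set.Ioc (0 : ℝ≥0) 1 | jump f.1 s ∈ A}.encard : ℕ∞) : ℝ≥0∞)) μ := by
  have hms : ∀ n, MeasurableSet
      {f : CadlagPath | arrival (n + 1) f.1 ≤ 1 ∧ mark (n + 1) f.1 ∈ A} := fun n =>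
    (measurable_arrival (n + 1) measurableSet_Iic).inter (measurable_mark (n + 1) hAm)
  refine ⟨fun f => ∑' n, Set.indicator
    {f : CadlagPath | arrival (n + 1) f.1 ≤ 1 ∧ mark (n + 1) f.1 ∈ A} 1 f,
    Measurable.tsum fun n => measurable_one.indicator (hms n), ?_⟩
  filter_upwards [hreg] with f hf
  rw [hf.encard_jumps_eq A hA]
  rfl

variable {Ω : Type*} [MeasurableSpace Ω] {P : Measure Ω} [IsProbabilityMeasure P]
  {L : ℝ≥0 → Ω → ℝ} {ν : Measure ℝ} {F : Ω → CadlagPath}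

omit [IsProbabilityMeasure P] in
theorem IsLevyMeasure.jumpRate_eq (hν : IsLevyMeasure P L ν) (hF : Measurable F)
    (hFL : ∀ᵐ ω ∂P, (F ω).1 = fun t => L t ω) : jumpRate (P.map F) = ν Set.univ := by
  have h1 : ν Set.univ = ν {0}ᶜ := by
    rw [← measure_add_measure_compl (measurableSet_singleton (0 : ℝ)), hν.1, zero_add]
  rw [h1, hν.2 _ (measurableSet_singleton 0).compl (by simp), jumpRate,
    lintegral_map (measurable_jumpNum_ennreal 1) hF]
  refine lintegral_congr_ae ?_
  filter_upwards [hFL] with ω hω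
  have : {s ∈ Set.Ioc (0 : ℝ≥0) 1 | jump (fun t => L t ω) s ∈ ({0}ᶜ : Set ℝ)} =
      jumpSet (fun t => L t ω) 1 := by
    ext s
    simp [jumpSet, and_assoc]
  rw [this, hω, jumpNum]

theorem IsLevyMeasure.eq_smul (hν : IsLevyMeasure P L ν) (hF : Measurable F)
    (hFL : ∀ᵐ ω ∂P, (F ω).1 = fun t => L t ω) (hlaw : IsLevyLaw (P.map F))
    (hreg : ∀ᵐ f ∂(P.map F), IsRegular f.1) :
    ν = jumpRate (P.map F) • (P.map F).map (fun f => mark 1 f.1) := by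
  have := Measure.isProbabilityMeasure_map (μ := P) hF.aemeasurable
  have h0 : (P.map F).map (fun f : CadlagPath => mark 1 f.1) {0} = 0 := by
    rw [Measure.map_apply (measurable_mark 1) (measurableSet_singleton 0)]
    refine measure_eq_zero_iff_ae_notMem.2 ?_
    filter_upwards [hreg] with f hf
    exact hf.mark_ne_zero one_ne_zero
  have key : ∀ A : Set ℝ, MeasurableSet A → (0 : ℝ) ∉ A →
      ν A = (jumpRate (P.map F) • (P.map F).map (fun f : CadlagPath => mark 1 f.1)) A := by
    intro A hAm hA
    rw [Measure.smul_apply, smul_eq_mul, ← hlaw.lintegral_jumps hreg hAm hA, hν.2 A hAm hA,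
      lintegral_map' (aemeasurable_encard_jumps hreg hAm hA) hF.aemeasurable]
    refine lintegral_congr_ae ?_
    filter_upwards [hFL] with ω hω
    rw [hω]
  ext A hA
  have e1 : ∀ ρ : Measure ℝ, ρ {0} = 0 → ρ A = ρ (A \ {0}) := fun ρ hρ =>
    (measure_sdiff_null hρ).symm
  rw [e1 ν hν.1, e1 _ (by rw [Measure.smul_apply, h0, smul_zero]),
    key _ (hA.diff (measurableSet_singleton 0)) (by simp)]

end LevyMeasure

section Drift

open CadlagPath

variable {μ : Measure CadlagPath} [IsProbabilityMeasure μ]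

theorem IsLevyLaw.map_jumpSeq_zero (hμ : IsLevyLaw μ) (hreg : ∀ᵐ f ∂μ, IsRegular f.1) :
    μ.map (fun f => jumpSeq f.1 0) =
      (μ.map fun f => arrival 1 f.1).prod (μ.map fun f => mark 1 f.1) := by
  have h := hμ.indepFun_arrival_mark hreg
  rw [indepFun_iff_map_prod_eq_prod_map_map (measurable_arrival 1).aemeasurable
    (measurable_mark 1).aemeasurable] at h
  rw [← h]
  simp only [jumpSeq_zero]

omit [IsProbabilityMeasure μ] in
theorem integrable_arrival (h : meanWait μ ≠ ⊤) :
    Integrable (fun f : CadlagPath => (arrival 1 f.1 : ℝ)) μ := by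
  refine ⟨(measurable_coe_nnreal_real.comp (measurable_arrival 1)).aestronglyMeasurable, ?_⟩
  rw [hasFiniteIntegral_iff_enorm]
  have : ∀ f : CadlagPath, ‖(arrival 1 f.1 : ℝ)‖ₑ = (arrival 1 f.1 : ℝ≥0∞) := fun f => by
    
    exact (Real.enorm_of_nonneg (arrival 1 f.1).2).trans ENNReal.ofReal_coe_nnreal
  simp only [this]
  exact lt_top_iff_ne_top.2 h

omit [IsProbabilityMeasure μ] in
theorem integral_arrival : ∫ f : CadlagPath, (arrival 1 f.1 : ℝ) ∂μ = (meanWait μ).toReal := by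
  have h0 : 0 ≤ᵐ[μ] fun f : CadlagPath => (arrival 1 f.1 : ℝ) :=
    ae_of_all _ fun f => NNReal.coe_nonneg _
  have hm : Measurable fun f : CadlagPath => (arrival 1 f.1 : ℝ) :=
    measurable_coe_nnreal_real.comp (measurable_arrival 1)
  rw [integral_eq_lintegral_of_nonneg_ae h0 hm.aestronglyMeasurable, meanWait]
  simp only [ENNReal.ofReal_coe_nnreal]

/-- With `r` the jump rate, `r (E log(1 + c Z) + λ E T) = ∫ log(1 + c y²) dν + λ r E T`. The first
term is below `-λ`, and `λ r E T ≤ λ` since `λ < 0` and `r E T ≥ 1`. Hence the drift is negative. -/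
theorem IsLevyLaw.exists_isPerpetuity (hμ : IsLevyLaw μ) (hreg : ∀ᵐ f ∂μ, IsRegular f.1)
    (hr : jumpRate μ ≠ 0) (hr' : jumpRate μ ≠ ⊤) {q : ℕ} {α β : ℕ → ℝ} (hα : 0 < α 0)
    {c lam K : ℝ} {ρ : Matrix (Fin q) (Fin q) ℝ → ℝ} (h : IsContractive q α β c lam K ρ)
    {κ : Measure (ℝ≥0 × ℝ)} [IsProbabilityMeasure κ]
    (hκ : κ = μ.map fun f => jumpSeq f.1 0) {ν : Measure ℝ}
    (hν : ν = jumpRate μ • μ.map (fun f => mark 1 f.1))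
    (hint : Integrable (fun y : ℝ => Real.log (1 + c * y ^ 2)) ν)
    (hlt : ∫ y, Real.log (1 + c * y ^ 2) ∂ν < -lam) : ∃ S, IsPerpetuity q α β κ S := by
  set r := (jumpRate μ).toReal
  have hr0 : 0 < r := ENNReal.toReal_pos hr hr'
  have hw := hμ.meanWait_ne_top hreg hr
  have hone : 1 ≤ r * (meanWait μ).toReal := by
    have := ENNReal.toReal_mono (ENNReal.mul_ne_top hr' hw)
      (hμ.one_le_jumpRate_mul_meanWait hreg hr hr')
    rwa [ENNReal.toReal_one, ENNReal.toReal_mul] at this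
  have hmg : Measurable fun y : ℝ => Real.log (1 + c * y ^ 2) := by fun_prop
  have hm0 : Measurable fun f : CadlagPath => jumpSeq f.1 0 :=
    (measurable_pi_apply 0).comp measurable_jumpSeq
  have hmap1 : κ.map Prod.fst = μ.map fun f => arrival 1 f.1 := by
    rw [hκ, Measure.map_map measurable_fst hm0]
    simp only [jumpSeq_zero, Function.comp_def]
  have hmap2 : κ.map Prod.snd = μ.map fun f => mark 1 f.1 := by
    rw [hκ, Measure.map_map measurable_snd hm0]
    simp only [jumpSeq_zero, Function.comp_def]
  have hint2 : Integrable (fun y : ℝ => Real.log (1 + c * y ^ 2)) (κ.map Prod.snd) := by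
    rw [hν, integrable_smul_measure hr hr'] at hint
    rwa [hmap2]
  have hint1 : Integrable (fun y : ℝ≥0 => (y : ℝ)) (κ.map Prod.fst) := by
    rw [hmap1, integrable_map_measure measurable_coe_nnreal_real.aestronglyMeasurable
      (measurable_arrival 1).aemeasurable]
    exact integrable_arrival hw
  have hi1 : Integrable (fun a : ℝ≥0 × ℝ => (a.1 : ℝ)) κ := hint1.comp_measurable measurable_fst
  have hi2 : Integrable (fun a : ℝ≥0 × ℝ => Real.log (1 + c * a.2 ^ 2)) κ :=
    hint2.comp_measurable measurable_snd
  refine h.exists_isPerpetuity hα hi2 hi1 ?_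
  rw [integral_add hi2 (hi1.const_mul lam), integral_const_mul]
  have e1 : ∫ a, (a.1 : ℝ) ∂κ = (meanWait μ).toReal := by
    rw [← integral_arrival, ← integral_map (φ := Prod.fst) (f := fun y : ℝ≥0 => (y : ℝ))
      measurable_fst.aemeasurable measurable_coe_nnreal_real.aestronglyMeasurable, hmap1,
      integral_map (measurable_arrival 1).aemeasurable measurable_coe_nnreal_real.aestronglyMeasurable]
  have e2 : r * ∫ a, Real.log (1 + c * a.2 ^ 2) ∂κ < -lam := by
    rw [← integral_map (φ := Prod.snd) (f := fun y : ℝ => Real.log (1 + c * y ^ 2))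
      measurable_snd.aemeasurable hmg.aestronglyMeasurable, hmap2]
    rwa [hν, integral_smul_measure, smul_eq_mul] at hlt
  rw [e1]
  have h3 := h.lam_neg
  have h4 : r * (∫ a, Real.log (1 + c * a.2 ^ 2) ∂κ + lam * (meanWait μ).toReal) < 0 := by
    nlinarith
  exact (pos_iff_neg_of_mul_neg h4).1 hr0

end Drift

/-! ### The recursion in terms of waiting times and jumps -/

section Match

variable {q : ℕ} {α β : ℕ → ℝ} {f : ℝ≥0 → ℝ}

theorem IsRegular.waitTime_eq (hf : IsRegular f) (n : ℕ) :
    waitTime f (n + 1) = (jumpSeq f n).1 := by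
  rw [waitTime, hf.jumpTime_eq_arrival, Nat.add_sub_cancel, hf.jumpTime_eq_arrival, jumpSeq,
    NNReal.coe_sub (hf.arrival_strictMono (Nat.lt_succ_self n)).le]

theorem IsRegular.sqJump_eq (hf : IsRegular f) (n : ℕ) :
    sqJump f (n + 1) = (jumpSeq f n).2 ^ 2 := by
  rw [sqJump, hf.jumpTime_eq_arrival, jumpSeq, mark]

theorem IsRegular.seqC_eq (hf : IsRegular f) (n : ℕ) :
    seqC q α β f (n + 1) = driveC q α β (jumpSeq f) (n + 1) := by
  rw [seqC, driveC, stepC, hf.waitTime_eq, hf.sqJump_eq, Nat.add_sub_cancel]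

theorem IsRegular.seqD_eq (hf : IsRegular f) (n : ℕ) :
    seqD q α f (n + 1) = driveD q α (jumpSeq f) (n + 1) := by
  rw [seqD, driveD, stepD, hf.sqJump_eq, Nat.add_sub_cancel]

theorem IsRegular.ascProd_seqC (hf : IsRegular f) (k : ℕ) :
    ascProd (seqC q α β f) k = ascProd (driveC q α β (jumpSeq f)) k := by
  simp only [ascProd, hf.seqC_eq]

theorem IsRegular.backwardSum_seq (hf : IsRegular f) (n : ℕ) (v : Fin q → ℝ) :
    backwardSum (seqC q α β f) (seqD q α f) n v = backIter q α β (jumpSeq f) n v := by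
  simp only [backIter, backwardSum_eq, hf.ascProd_seqC, hf.seqD_eq]

theorem IsRegular.forwardSum_seq (hf : IsRegular f) (n : ℕ) (v : Fin q → ℝ) :
    forwardSum (seqC q α β f) (seqD q α f) n v = fwdIter q α β (jumpSeq f) n v := by
  induction n with
  | zero => rw [fwdIter, forwardSum_zero, forwardSum_zero]
  | succ n ih => rw [fwdIter, forwardSum_succ, forwardSum_succ, ih, hf.seqC_eq, hf.seqD_eq, fwdIter]

theorem IsRegular.coe_age (hf : IsRegular f) (t : ℝ≥0) :
    (age t f : ℝ) = (t : ℝ) - jumpTime f (jumpCount f t) := by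
  rw [age, hf.jumpTime_eq_arrival, NNReal.coe_sub ((hf.arrival_le_iff _ _).2 le_rfl)]

/-- Peels off the first step rather than the last: the chain after one step is the same chain,
driven by the tail and started from its new position. -/
theorem fwdIter_succ' (x : ℕ → ℝ≥0 × ℝ) (n : ℕ) (v : Fin q → ℝ) :
    fwdIter q α β x (n + 1) v = fwdIter q α β (tailSeq x) n (step q α β (x 0) v) := by
  induction n with
  | zero =>
    rw [fwdIter, forwardSum_succ, forwardSum_zero, fwdIter, forwardSum_zero]
    rfl
  | succ n ih =>
    have h1 : ∀ (x : ℕ → ℝ≥0 × ℝ) (n : ℕ) (v : Fin q → ℝ),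
        fwdIter q α β x (n + 1) v = step q α β (x n) (fwdIter q α β x n v) := fun x n v =>
      forwardSum_succ _ _ _ _
    rw [h1, ih, h1, tailSeq]

variable {y : ℝ≥0 → Fin q → ℝ} (hf : IsRegular f) (hy : IsCadlag y) (hsde : SolvesStateEq α β f y)

include hf hy hsde

theorem SolvesStateEq.eq_forwardSum (n : ℕ) :
    y (jumpTime f n) = forwardSum (seqC q α β f) (seqD q α f) n (y 0) :=
  Cogarch.eq_forwardSum _ _ (x := fun n => y (jumpTime f n)) (hsde.recursion hf hy) n

theorem SolvesStateEq.eq_exp_mulVec (t : ℝ≥0) :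
    y t = NormedSpace.exp (((t : ℝ) - jumpTime f (jumpCount f t)) • matB q β) *ᵥ
      forwardSum (seqC q α β f) (seqD q α f) (jumpCount f t) (y 0) := by
  obtain ⟨h1, h2⟩ := (hf.jumpCount_eq_iff _ t).1 rfl
  rw [← hsde.eq_forwardSum hf hy, hf.jumpTime_eq_arrival]
  exact hsde.flow hf hy h1 h2

end Match

/-! ### Stationarity of the embedded chain -/

section Chain

variable {q : ℕ} {α β : ℕ → ℝ}

theorem measurable_head_step : Measurable fun p : (ℕ → ℝ≥0 × ℝ) × (Fin q → ℝ) =>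
    step q α β (p.1 0) p.2 := by
  have h0 : Measurable fun p : (ℕ → ℝ≥0 × ℝ) × (Fin q → ℝ) => (p.1 0, p.2) :=
    ((measurable_pi_apply 0).comp measurable_fst).prodMk measurable_snd
  have h := (measurable_step (q := q) (α := α) (β := β)).comp h0
  exact h

theorem measurable_tail_step : Measurable fun p : (ℕ → ℝ≥0 × ℝ) × (Fin q → ℝ) =>
    (tailSeq p.1, step q α β (p.1 0) p.2) :=
  (measurable_tailSeq.comp measurable_fst).prodMk measurable_head_step

variable {κ : Measure (ℝ≥0 × ℝ)} [IsProbabilityMeasure κ]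
  {m : Measure (Fin q → ℝ)} [IsProbabilityMeasure m]

/-- After one step the remaining driving sequence is again i.i.d. and independent of the new state.
Consequently a law fixed by one step makes the whole orbit stationary. -/
theorem map_tail_step : ((Measure.infinitePi fun _ : ℕ => κ).prod m).map
    (fun p => (tailSeq p.1, step q α β (p.1 0) p.2)) =
      (Measure.infinitePi fun _ : ℕ => κ).prod (stepLaw q α β κ m) := by
  set I := Measure.infinitePi fun _ : ℕ => κ with hI
  have hc : Measurable fun p : (ℕ → ℝ≥0 × ℝ) × (ℝ≥0 × ℝ) => consSeq p.2 p.1 :=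
    measurable_consSeq.comp measurable_swap
  have h1 : I = (I.prod κ).map (fun p => consSeq p.2 p.1) := by
    rw [← Measure.prod_swap, Measure.map_map hc measurable_swap]
    exact (map_consSeq κ).symm
  have h2 : I.prod m = ((I.prod (κ.prod m)).map MeasurableEquiv.prodAssoc.symm).map
      (Prod.map (fun p => consSeq p.2 p.1) id) := by
    rw [(measurePreserving_prodAssoc I κ m).symm.map_eq, ← Measure.map_prod_map _ _ hc
      measurable_id, ← h1, Measure.map_id]
  have h4 := Measure.map_prod_map I (κ.prod m) measurable_id
    (measurable_step (q := q) (α := α) (β := β))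
  rw [Measure.map_id] at h4
  rw [stepLaw, h4, h2, Measure.map_map measurable_tail_step (hc.prodMap measurable_id),
    Measure.map_map (measurable_tail_step.comp (hc.prodMap measurable_id)) (MeasurableEquiv.measurable _)]
  rfl

theorem map_head_step : ((Measure.infinitePi fun _ : ℕ => κ).prod m).map
    (fun p => step q α β (p.1 0) p.2) = stepLaw q α β κ m := by
  have h := congrArg (Measure.map Prod.snd) (map_tail_step (α := α) (β := β) (κ := κ) (m := m))
  rw [Measure.map_snd_prod, measure_univ, one_smul, Measure.map_map measurable_snd
    measurable_tail_step] at h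
  exact h

theorem fwdIter_zero (x : ℕ → ℝ≥0 × ℝ) (v : Fin q → ℝ) : fwdIter q α β x 0 v = v :=
  forwardSum_zero _ _ _

theorem measurable_orbit (k : ℕ) :
    Measurable fun (p : (ℕ → ℝ≥0 × ℝ) × (Fin q → ℝ)) (n : ℕ) => fwdIter q α β p.1 (n + k) p.2 :=
  measurable_pi_lambda _ fun n => measurable_fwdIter (n + k)

theorem map_orbit_of_stepLaw_eq (hm : stepLaw q α β κ m = m) (k : ℕ) :
    ((Measure.infinitePi fun _ : ℕ => κ).prod m).map
      (fun p (n : ℕ) => fwdIter q α β p.1 (n + k) p.2) =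
    ((Measure.infinitePi fun _ : ℕ => κ).prod m).map
      (fun p (n : ℕ) => fwdIter q α β p.1 n p.2) := by
  induction k with
  | zero => rfl
  | succ k ih =>
    have h1 := map_tail_step (α := α) (β := β) (κ := κ) (m := m)
    rw [hm] at h1
    rw [← ih]
    conv_rhs => rw [← h1]
    rw [Measure.map_map (measurable_orbit k) measurable_tail_step]
    congr 1
    ext p n : 2
    exact fwdIter_succ' _ (n + k) _

end Chain

/-! ### The fixed point equation -/

section FixedPoint

variable {q : ℕ} {α β : ℕ → ℝ}

theorem continuous_coefQ_coefR : Continuous fun p : ℝ × ℝ =>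
    ((fun i j => coefQ q α β p.1 p.2 i j : Fin q → Fin q → ℝ), coefR q α β p.1 p.2) := by
  have h0 : Continuous fun p : ℝ × ℝ => NormedSpace.exp (p.1 • matB q β) :=
    (continuous_exp_smul (matB q β)).comp continuous_fst
  have h1 : Continuous fun p : ℝ × ℝ => coefQ q α β p.1 p.2 :=
    h0.matrix_mul (continuous_const.add (continuous_snd.smul continuous_const))
  have h2 : Continuous fun p : ℝ × ℝ => coefR q α β p.1 p.2 :=
    (continuous_const.mul continuous_snd).smul (h0.matrix_mulVec continuous_const)
  have h3 : Continuous fun p : ℝ × ℝ =>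
      (fun i j => coefQ q α β p.1 p.2 i j : Fin q → Fin q → ℝ) :=
    continuous_pi fun i => continuous_pi fun j => h1.matrix_elem i j
  exact h3.prodMk h2

theorem continuous_matrix_affine :
    Continuous fun r : (Fin q → ℝ) × ((Fin q → Fin q → ℝ) × (Fin q → ℝ)) =>
      (Matrix.of r.2.1 : Matrix (Fin q) (Fin q) ℝ) *ᵥ r.1 + r.2.2 := by
  refine continuous_pi fun i => ?_
  simp only [Pi.add_apply, Matrix.mulVec, dotProduct, Matrix.of_apply]
  fun_prop

/-- The law of `Q X + R` when `X` is independent of `(Q, R)`. -/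
theorem map_eq_reverseLaw {Ω : Type*} [MeasurableSpace Ω] {P : Measure Ω} [IsProbabilityMeasure P]
    {T Z : Ω → ℝ} {X : Ω → Fin q → ℝ} {κ : Measure (ℝ≥0 × ℝ)} [IsProbabilityMeasure κ]
    (hTZm : AEMeasurable (fun ω => (T ω, Z ω)) P)
    (hTZ : P.map (fun ω => (T ω, Z ω)) = κ.map fun a => ((a.1 : ℝ), a.2 ^ 2))
    (hX : AEMeasurable X P)
    (hind : IndepFun X (fun ω => ((fun i j => coefQ q α β (T ω) (Z ω) i j : Fin q → Fin q → ℝ),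
      coefR q α β (T ω) (Z ω))) P) :
    AEMeasurable (fun ω => coefQ q α β (T ω) (Z ω) *ᵥ X ω + coefR q α β (T ω) (Z ω)) P ∧
    P.map (fun ω => coefQ q α β (T ω) (Z ω) *ᵥ X ω + coefR q α β (T ω) (Z ω)) =
      reverseLaw q α β κ (P.map X) := by
  have hgm := (continuous_coefQ_coefR (q := q) (α := α) (β := β)).measurable
  have hφ := (continuous_matrix_affine (q := q)).measurable
  have hsq : Measurable fun a : ℝ≥0 × ℝ => ((a.1 : ℝ), a.2 ^ 2) :=
    (measurable_coe_nnreal_real.comp measurable_fst).prodMk (measurable_snd.pow_const 2)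
  have hQR := hgm.comp_aemeasurable hTZm
  have := Measure.isProbabilityMeasure_map (μ := P) hX
  have h0 := AEMeasurable.map_map_of_aemeasurable hgm.aemeasurable hTZm
  rw [hTZ, Measure.map_map hgm hsq] at h0
  have hpair := hX.prodMk hQR
  have hind' := (indepFun_iff_map_prod_eq_prod_map_map hX hQR).1 hind
  rw [← h0] at hind'
  have h2 := AEMeasurable.map_map_of_aemeasurable hφ.aemeasurable hpair
  have h3 := Measure.map_prod_map κ (P.map X) (hgm.comp hsq) measurable_id
  rw [Measure.map_id] at h3
  have h5 : Measurable (Prod.map ((fun p : ℝ × ℝ =>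
    ((fun i j => coefQ q α β p.1 p.2 i j : Fin q → Fin q → ℝ), coefR q α β p.1 p.2)) ∘
      fun a : ℝ≥0 × ℝ => ((a.1 : ℝ), a.2 ^ 2)) (id : (Fin q → ℝ) → Fin q → ℝ)) :=
    (hgm.comp hsq).prodMap measurable_id
  rw [hind', ← Measure.prod_swap, h3, Measure.map_map measurable_swap h5,
    Measure.map_map hφ (measurable_swap.comp h5)] at h2
  have h6 := hφ.comp_aemeasurable hpair
  refine ⟨?_, ?_⟩
  · exact h6
  · exact h2.symm

theorem map_exp_mulVec_eq_expLaw {Ω : Type*} [MeasurableSpace Ω] {P : Measure Ω}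
    [IsProbabilityMeasure P] {T : Ω → ℝ} {X : Ω → Fin q → ℝ} {τ : Measure ℝ≥0}
    [IsProbabilityMeasure τ] (hTm : AEMeasurable T P) (hT : P.map T = τ.map fun a : ℝ≥0 => (a : ℝ))
    (hX : AEMeasurable X P) (hind : IndepFun T X P) :
    AEMeasurable (fun ω => NormedSpace.exp (T ω • matB q β) *ᵥ X ω) P ∧
    P.map (fun ω => NormedSpace.exp (T ω • matB q β) *ᵥ X ω) = expLaw q β τ (P.map X) := by
  have hφ := (continuous_exp_mulVec (q := q) (β := β)).measurable
  have hpair := hTm.prodMk hX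
  have := Measure.isProbabilityMeasure_map (μ := P) hX
  refine ⟨hφ.comp_aemeasurable hpair, ?_⟩
  have h2 := AEMeasurable.map_map_of_aemeasurable hφ.aemeasurable hpair
  have h3 := Measure.map_prod_map τ (P.map X) measurable_coe_nnreal_real measurable_id
  rw [Measure.map_id] at h3
  rw [(indepFun_iff_map_prod_eq_prod_map_map hTm hX).1 hind, hT, h3,
    Measure.map_map hφ (measurable_coe_nnreal_real.prodMap measurable_id)] at h2
  exact h2.symm

end FixedPoint



end Cogarch

end

/-! ### Assembly of the theorem -/

open Cogarch in
theorem theorem3p5 {Ω : Type*} [MeasurableSpace Ω] (P : Measure Ω) [IsProbabilityMeasure P]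
    (p q : ℕ) (α β : ℕ → ℝ) (hparam : IsParam p q α β)
    (L : ℝ≥0 → Ω → ℝ) (hL : IsLevyProcess P L)
    (ν : Measure ℝ) (hν : IsLevyMeasure P L ν) (hν_nontrivial : ν ≠ 0)
    (hν_finite : IsFiniteMeasure ν)
    (Y : ℝ≥0 → Ω → Fin q → ℝ) (hY : IsStateProcess P α β L Y)
    -- the jump data `N(t)`, `Γ_n`, `T_i`, `Z_i` and the coefficients `C_i`, `D_i`
    (N : ℝ≥0 → Ω → ℕ) (hN : N = fun t ω => jumpCount (fun s => L s ω) t)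
    (Γ : ℕ → Ω → ℝ≥0) (hΓ : Γ = fun n ω => jumpTime (fun s => L s ω) n)
    (T : ℕ → Ω → ℝ) (hT : T = fun i ω => waitTime (fun s => L s ω) i)
    (Z : ℕ → Ω → ℝ) (hZ : Z = fun i ω => sqJump (fun s => L s ω) i)
    (C : ℕ → Ω → Matrix (Fin q) (Fin q) ℝ) (hC : C = fun i ω => seqC q α β (fun s => L s ω) i)
    (D : ℕ → Ω → Fin q → ℝ) (hD : D = fun i ω => seqD q α (fun s => L s ω) i) :
    -- the representation of `[L, L]^{(d)}` as a sum over finitely many jumps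
    (∀ᵐ ω ∂P, ∀ t : ℝ≥0, (jumpSet (fun s => L s ω) t).Finite ∧
      jumpIntegral (fun _ => 1) (fun s => L s ω) t = ∑ i ∈ Finset.Icc 1 (N t ω), Z i ω) ∧
    -- the random recurrence equation
    (∀ᵐ ω ∂P, ∀ n : ℕ,
      Y (Γ (n + 1) ω) ω = C (n + 1) ω *ᵥ Y (Γ n ω) ω + D (n + 1) ω) ∧
    -- the pathwise representation of `Y_t`
    (∀ᵐ ω ∂P, ∀ t : ℝ≥0, 0 < t →
      Y t ω = NormedSpace.exp (((t : ℝ) - Γ (N t ω) ω) • matB q β) *ᵥ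
        forwardSum (fun i => C i ω) (fun i => D i ω) (N t ω) (Y 0 ω)) ∧
    -- the representation of `Y_t` in distribution
    (∀ t : ℝ≥0, 0 < t → IdentDistrib (Y t)
      (fun ω => NormedSpace.exp (((t : ℝ) - Γ (N t ω) ω) • matB q β) *ᵥ
        backwardSum (fun i => C i ω) (fun i => D i ω) (N t ω) (Y 0 ω)) P P) ∧
    -- under the stationarity conditions:
    (StationarityCondition q α β ν →
      ∃ Yhat : Ω → Fin q → ℝ, Measurable Yhat ∧
        -- almost sure absolute convergence of `∑ C_1 ⋯ C_i D_{i+1}` to `Yhat`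
        (∀ᵐ ω ∂P, Summable (fun i : ℕ => ‖ascProd (fun j => C j ω) i *ᵥ D (i + 1) ω‖) ∧
          HasSum (fun i : ℕ => ascProd (fun j => C j ω) i *ᵥ D (i + 1) ω) (Yhat ω)) ∧
        -- the law of `Yhat` is the stationary distribution of `(Y_{Γ_n})`
        (IsStrictlyStationary P (fun n ω => Y (Γ n ω) ω) ↔ IdentDistrib (Y 0) Yhat P P) ∧
        -- `Y_t` has a limit in distribution, whose law `π` is that of `Y_∞`
        ∃ (π : Measure (Fin q → ℝ)) (_ : IsProbabilityMeasure π),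
          TendstoInDistribution Y atTop id (fun _ => P) π ∧
          -- `Y_∞` is distributed as `e^{B T} Yhat`, with `T ∼ T_1` independent of `Yhat`
          (∀ (Ω' : Type*) [MeasurableSpace Ω'] (P' : Measure Ω') [IsProbabilityMeasure P']
            (T' : Ω' → ℝ) (X : Ω' → Fin q → ℝ),
            IdentDistrib T' (T 1) P' P → IdentDistrib X Yhat P' P → IndepFun T' X P' →
            HasLaw (fun ω => NormedSpace.exp (T' ω • matB q β) *ᵥ X ω) π P') ∧
          -- `Y_∞` is the unique solution in law of the fixed point equation `X =_d Q X + R`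
          (∀ (Ω' : Type*) [MeasurableSpace Ω'] (P' : Measure Ω') [IsProbabilityMeasure P']
            (T₀ Z₀ : Ω' → ℝ) (X : Ω' → Fin q → ℝ),
            IdentDistrib (fun ω => (T₀ ω, Z₀ ω)) (fun ω => (T 1 ω, Z 1 ω)) P' P →
            AEMeasurable X P' →
            IndepFun X
              (fun ω => ((fun i j => coefQ q α β (T₀ ω) (Z₀ ω) i j : Fin q → Fin q → ℝ),
                coefR q α β (T₀ ω) (Z₀ ω))) P' →
            (IdentDistrib
              (fun ω => coefQ q α β (T₀ ω) (Z₀ ω) *ᵥ X ω + coefR q α β (T₀ ω) (Z₀ ω)) X P' P'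
              ↔ HasLaw X π P'))) := by
  subst hN hΓ hT hZ hC hD
  have := hν_finite
  have hα := hparam.alpha_zero_pos
  obtain ⟨F, hF, hFL, hlaw⟩ := hL.exists_path
  have hμp := Measure.isProbabilityMeasure_map (μ := P) hF.aemeasurable
  have hmp := Measure.isProbabilityMeasure_map (μ := P) (hY.measurable 0).aemeasurable
  set μ := P.map F with hμ
  set m := P.map (Y 0) with hm
  have hrate := hν.jumpRate_eq hF hFL
  -- The total mass of `ν` is the expected number of jumps in `(0, 1]`, so the assumptions on `ν`
  -- become a jump rate in `(0, ∞)`.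
  have hr : jumpRate μ ≠ 0 := by rwa [hrate, Measure.measure_univ_ne_zero]
  have hr' : jumpRate μ ≠ ⊤ := by rw [hrate]; exact measure_ne_top _ _
  have hreg := hlaw.ae_regular hr hr'
  have hgood : ∀ᵐ ω ∂P, (F ω).1 = (fun t => L t ω) ∧ Cogarch.IsRegular (fun t => L t ω) := by
    filter_upwards [hFL, ae_of_ae_map hF.aemeasurable hreg] with ω h1 h2
    exact ⟨h1, h1 ▸ h2⟩
  have hsde : ∀ᵐ ω ∂P, SolvesStateEq α β (fun t => L t ω) (fun t => Y t ω) := hY.sde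
  -- the joint law of the driving path and the initial value
  have hjoint : P.map (fun ω => (F ω, Y 0 ω)) = μ.prod m := by
    refine (indepFun_iff_map_prod_eq_prod_map_map hF.aemeasurable
      (hY.measurable 0).aemeasurable).1 (CadlagPath.indepFun_iff.2 ?_)
    exact hY.indep.symm.congr (hFL.mono fun ω hω => hω.symm) (ae_eq_refl _)
  have hpm : Measurable fun ω => (F ω, Y 0 ω) := hF.prodMk (hY.measurable 0)
  -- From here on the state enters only as a measurable function of the driving path and the
  -- starting value, whose joint law is a product.
  have hfwd : ∀ t, Y t =ᵐ[P] fun ω => fwdState q α β t (F ω, Y 0 ω) := fun t => by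
    filter_upwards [hgood, hY.cadlag, hsde] with ω h1 h2 h3
    rw [fwdState, h1.1, ← h1.2.forwardSum_seq, h1.2.coe_age]
    exact h3.eq_exp_mulVec h1.2 h2 t
  have hYmap : ∀ t, P.map (Y t) = (μ.prod m).map (backState q α β t) := fun t => by
    rw [← hlaw.map_fwdState hreg, Measure.map_congr (hfwd t), ← hjoint,
      Measure.map_map (measurable_fwdState t) hpm]
    rfl
  refine ⟨?_, ?_, ?_, ?_, fun hstat => ?_⟩
  · filter_upwards [hgood] with ω h t
    refine ⟨h.2.finite t, ?_⟩
    rw [h.2.jumpIntegral_eq]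
    refine Finset.sum_congr rfl fun i _ => ?_
    rw [continuousWithinAt_const.leftLim_eq, one_mul, sqJump, h.2.jumpTime_eq_arrival, mark]
  · filter_upwards [hgood, hY.cadlag, hsde] with ω h1 h2 h3 n
    exact h3.recursion h1.2 h2 n
  · filter_upwards [hgood, hY.cadlag, hsde] with ω h1 h2 h3 t _
    exact h3.eq_exp_mulVec h1.2 h2 t
  · intro t _
    have hae : (fun ω => backState q α β t (F ω, Y 0 ω)) =ᵐ[P] fun ω =>
        NormedSpace.exp (((t : ℝ) - jumpTime (fun s => L s ω) (jumpCount (fun s => L s ω) t)) •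
          matB q β) *ᵥ backwardSum (fun i => seqC q α β (fun s => L s ω) i)
            (fun i => seqD q α (fun s => L s ω) i) (jumpCount (fun s => L s ω) t) (Y 0 ω) := by
      filter_upwards [hgood] with ω h1
      rw [backState, backCount, h1.1, ← h1.2.backwardSum_seq, h1.2.coe_age]
    have hbm := (measurable_backState (q := q) (α := α) (β := β) t).comp hpm
    refine ⟨(hY.measurable t).aemeasurable, hbm.aemeasurable.congr hae, ?_⟩
    rw [hYmap, ← Measure.map_congr hae, ← hjoint, Measure.map_map (measurable_backState t) hpm]
    rfl
  obtain ⟨c, lam, K, ρ, hcon, hint, hlt⟩ := hstat.exists_isContractive hparam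
  have hm0 : Measurable fun f : CadlagPath => jumpSeq f.1 0 :=
    (measurable_pi_apply 0).comp measurable_jumpSeq
  have hκp := Measure.isProbabilityMeasure_map (μ := μ) hm0.aemeasurable
  have hτp := Measure.isProbabilityMeasure_map (μ := μ) (measurable_arrival 1).aemeasurable
  have hζp := Measure.isProbabilityMeasure_map (μ := μ) (measurable_mark 1).aemeasurable
  set κ := μ.map (fun f : CadlagPath => jumpSeq f.1 0) with hκ
  set τ := μ.map (fun f : CadlagPath => arrival 1 f.1) with hτ
  set ζ := μ.map (fun f : CadlagPath => mark 1 f.1) with hζ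
  have hprod : κ = τ.prod ζ := hlaw.map_jumpSeq_zero hreg
  obtain ⟨S, hS⟩ := hlaw.exists_isPerpetuity hreg hr hr' hα hcon hκ
    (hν.eq_smul hF hFL hlaw hreg) hint hlt
  have hseq : μ.map (fun f : CadlagPath => jumpSeq f.1) = Measure.infinitePi fun _ : ℕ => κ :=
    hlaw.map_jumpSeq hreg
  have hseqF : P.map (fun ω => jumpSeq (F ω).1) = Measure.infinitePi fun _ : ℕ => κ := by
    rw [← hseq, hμ, Measure.map_map measurable_jumpSeq hF]
    rfl
  have hmF : Measurable fun ω => jumpSeq (F ω).1 := measurable_jumpSeq.comp hF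
  have hyhat := hS.isProbabilityMeasure
  have hYhat : Measurable fun ω => S (jumpSeq (F ω).1) := hS.measurable.comp hmF
  have hYhat_map : P.map (fun ω => S (jumpSeq (F ω).1)) =
      (Measure.infinitePi fun _ : ℕ => κ).map S := by
    rw [← hseqF, Measure.map_map hS.measurable hmF]
    rfl
  -- the embedded chain
  have hchain : ∀ᵐ ω ∂P, ∀ n, Y (jumpTime (fun s => L s ω) n) ω =
      fwdIter q α β (jumpSeq (F ω).1) n (Y 0 ω) := by
    filter_upwards [hgood, hY.cadlag, hsde] with ω h1 h2 h3 n
    rw [h1.1, ← h1.2.forwardSum_seq]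
    exact h3.eq_forwardSum h1.2 h2 n
  have hpm' : Measurable fun ω => (jumpSeq (F ω).1, Y 0 ω) := hmF.prodMk (hY.measurable 0)
  have hjoint' : P.map (fun ω => (jumpSeq (F ω).1, Y 0 ω)) =
      (Measure.infinitePi fun _ : ℕ => κ).prod m := by
    have h1 := Measure.map_prod_map μ m measurable_jumpSeq measurable_id
    rw [Measure.map_id, hseq] at h1
    rw [h1, ← hjoint, Measure.map_map (measurable_jumpSeq.prodMap measurable_id) hpm]
    rfl
  have horbit : ∀ k, AEMeasurable
      (fun ω (n : ℕ) => Y (jumpTime (fun s => L s ω) (n + k)) ω) P ∧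
      P.map (fun ω (n : ℕ) => Y (jumpTime (fun s => L s ω) (n + k)) ω) =
        ((Measure.infinitePi fun _ : ℕ => κ).prod m).map
          (fun p (n : ℕ) => fwdIter q α β p.1 (n + k) p.2) := by
    intro k
    have hae : (fun ω (n : ℕ) => fwdIter q α β (jumpSeq (F ω).1) (n + k) (Y 0 ω)) =ᵐ[P]
        fun ω (n : ℕ) => Y (jumpTime (fun s => L s ω) (n + k)) ω :=
      hchain.mono fun ω hω => funext fun n => (hω (n + k)).symm
    have hom := (measurable_orbit (q := q) (α := α) (β := β) k).comp hpm'
    refine ⟨hom.aemeasurable.congr hae, ?_⟩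
    rw [← Measure.map_congr hae, ← hjoint', Measure.map_map (measurable_orbit k) hpm']
    rfl
  have hT1 : (fun ω => waitTime (fun s => L s ω) 1) =ᵐ[P] fun ω => (arrival 1 (F ω).1 : ℝ) := by
    filter_upwards [hgood] with ω h1
    rw [h1.2.waitTime_eq 0, h1.1, jumpSeq_zero]
  have hZ1 : (fun ω => sqJump (fun s => L s ω) 1) =ᵐ[P] fun ω => mark 1 (F ω).1 ^ 2 := by
    filter_upwards [hgood] with ω h1
    rw [h1.2.sqJump_eq 0, h1.1, jumpSeq_zero]
  have hm1 : Measurable fun ω => arrival 1 (F ω).1 := (measurable_arrival 1).comp hF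
  have hT1map : P.map (fun ω => waitTime (fun s => L s ω) 1) = τ.map fun a : ℝ≥0 => (a : ℝ) := by
    rw [Measure.map_congr hT1, hτ, hμ, Measure.map_map (measurable_arrival 1) hF]
    exact (Measure.map_map measurable_coe_nnreal_real hm1).symm
  have hTZ1map : P.map (fun ω => (waitTime (fun s => L s ω) 1, sqJump (fun s => L s ω) 1)) =
      (τ.prod ζ).map fun a => ((a.1 : ℝ), a.2 ^ 2) := by
    have hsq : Measurable fun a : ℝ≥0 × ℝ => ((a.1 : ℝ), a.2 ^ 2) :=
      (measurable_coe_nnreal_real.comp measurable_fst).prodMk (measurable_snd.pow_const 2)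
    rw [Measure.map_congr (hT1.prodMk hZ1), ← hprod, hκ, hμ, Measure.map_map hm0 hF,
      Measure.map_map hsq (hm0.comp hF)]
    simp only [Function.comp_def, jumpSeq_zero]
  have hS' : IsPerpetuity q α β (τ.prod ζ) S := by
    have := hS
    simpa only [hprod] using this
  have hlawS : (Measure.infinitePi fun _ : ℕ => τ.prod ζ).map S =
      (Measure.infinitePi fun _ : ℕ => κ).map S := by
    simp only [hprod]
  refine ⟨fun ω => S (jumpSeq (F ω).1), hYhat, ?_, ?_,
    expLaw q β τ ((Measure.infinitePi fun _ : ℕ => κ).map S), inferInstance, ?_, ?_, ?_⟩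
  · have h1 := hS.ae_summable.and hS.ae_hasSum
    rw [← hseqF] at h1
    filter_upwards [ae_of_ae_map hmF.aemeasurable h1, hgood] with ω h2 h3
    rw [h3.1] at h2 ⊢
    have h4 : ∀ i, ascProd (fun j => seqC q α β (fun s => L s ω) j) i *ᵥ
        seqD q α (fun s => L s ω) (i + 1) = ascProd (driveC q α β (jumpSeq fun s => L s ω)) i *ᵥ
        driveD q α (jumpSeq fun s => L s ω) (i + 1) := fun i => by
      rw [← h3.2.ascProd_seqC, ← h3.2.seqD_eq]
    simp only [h4]
    exact h2
  · constructor
    · intro hst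
      -- Only the shift by one and the coordinate `0` are needed: equal laws of the first two states
      -- say that the initial law is fixed by one step.
      have h1 := ((hst 1).comp (measurable_pi_apply 0)).map_eq
      have h2 : P.map (Y 0) = stepLaw q α β κ (P.map (Y 0)) := by
        have e1 : ((fun x : ℕ → Fin q → ℝ => x 0) ∘
            fun ω n => Y (jumpTime (fun s => L s ω) n) ω) = Y 0 := rfl
        have e2 : ((fun x : ℕ → Fin q → ℝ => x 0) ∘
            fun ω n => Y (jumpTime (fun s => L s ω) (n + 1)) ω) =ᵐ[P]
            fun ω => step q α β (jumpSeq (F ω).1 0) (Y 0 ω) := by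
          filter_upwards [hchain] with ω hω
          exact (hω 1).trans ((fwdIter_succ' _ 0 _).trans (fwdIter_zero _ _))
        rw [e1, Measure.map_congr e2] at h1
        have e3 := map_head_step (α := α) (β := β) (κ := κ) (m := m)
        rw [← hjoint', Measure.map_map measurable_head_step hpm'] at e3
        exact h1.symm.trans e3
      refine ⟨(hY.measurable 0).aemeasurable, hYhat.aemeasurable, ?_⟩
      rw [hYhat_map]
      exact hS.eq_map_of_stepLaw_eq h2.symm
    · intro hid
      have h1 : m = (Measure.infinitePi fun _ : ℕ => κ).map S := by
        rw [← hYhat_map]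
        exact hid.map_eq
      have h2 : stepLaw q α β κ m = m := by
        rw [h1]
        exact hS.stepLaw_map
      intro k
      refine ⟨(horbit k).1, (horbit 0).1, ?_⟩
      rw [(horbit k).2, map_orbit_of_stepLaw_eq h2]
      exact (horbit 0).2.symm
  · refine ⟨fun t => (hY.measurable t).aemeasurable, aemeasurable_id, ?_⟩
    -- Bounded Lipschitz test functions suffice for convergence in distribution, and the limit
    -- theorem above is stated for exactly these.
    refine tendsto_iff_forall_lipschitz_integral_tendsto.2 fun h hb hl => ?_
    obtain ⟨b, hb⟩ := hb
    obtain ⟨l, hl⟩ := hl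
    have hlim := hlaw.tendsto_integral_backState (m := m) hreg hr' hseq hS hcon.K_pos.le
      (fun s v => hcon.norm_exp_mulVec_le s.2 v) hb hl
    rw [hseq] at hlim
    simp only [ProbabilityMeasure.coe_mk, Measure.map_id]
    refine hlim.congr fun t => ?_
    rw [hYmap, integral_map (measurable_backState t).aemeasurable
      hl.continuous.aestronglyMeasurable]
  · intro Ω' _ P' _ T' X hT' hX hind
    have h1 := map_exp_mulVec_eq_expLaw (β := β) hT'.aemeasurable_fst
      (hT'.map_eq.trans hT1map) hX.aemeasurable_fst hind
    refine ⟨h1.1, ?_⟩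
    rw [h1.2, hX.map_eq, hYhat_map]
  · intro Ω' _ P' _ T₀ Z₀ X hTZ hX hind
    have h1 := map_eq_reverseLaw hTZ.aemeasurable_fst (hTZ.map_eq.trans hTZ1map) hX hind
    have hXp := Measure.isProbabilityMeasure_map (μ := P') hX
    have h2 := hS'.reverseLaw_eq_iff (m := P'.map X)
    rw [hlawS] at h2
    constructor
    · intro h
      exact ⟨hX, h2.1 (h1.2.symm.trans h.map_eq)⟩
    · intro h
      exact ⟨h1.1, hX, h1.2.trans (h2.2 h.map_eq)⟩
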